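/- Let $u,v,w\in\mathbb R$, $f(t)=\exp(ut^2+vt+w)$, and let $p,q$ be positive integers. Running times refer to a random access machine with natural-number cells (constants, addition, truncated subtraction, halving, comparison, indirect addressing) and exact complex cells (field operations, $\exp$, the constant $\pi i$, conversion of a natural number to a scalar), every operation costing one step. In each running-time statement below a single program and a single constant in $O(\cdot)$ serve all inputs; both are independent of $f$, $p$, $q$ and the sizes. 1. *(Factorization.)* Let $x\in\mathbb R^a$, $y\in\mathbb R^b$ with $s_j:=qy_j\in\mathbb N$ for all $j$, and put $r_i=\exp(2ux_i/q)$. Then $$[f(x_i+y_j)]_{i,j}=e^{w}D_1VD_2,\qquad V=[r_i^{s_j}]_{i,j},$$ where $D_1=\mathrm{diag}(e^{ux_i^2+vx_i})$, $D_2=\mathrm{diag}(e^{uy_j^2+vy_j})$, so $V$ is a generalized Vandermonde matrix. 2. *(Padding of columns.)* For every $K$ with $s_j<K$ for all $j$, $V$ consists of the columns $s_1,\dots,s_b$ of the ordinary Vandermonde matrix $\widehat V=[r_i^{k}]_{1\le i\le a,\,0\le k<K}$, which has the same number of rows, and $Vz=\widehat V\hat z$ for all $z\in\mathbb R^b$,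 where $\hat z_k=\sum_{j:\,s_j=k}z_j$ (zero if $k$ is not one of the $s_j$). 3. *(Number of columns.)* Let $T$ be a finite tree whose edge weights lie in $\{e/q: e\in\{1,\dots,p\}\}$ and let $o$ be a vertex. All numbers $q\,\mathrm{dist}(o,i)$, $i\in V(T)$, are natural numbers, and if $b$ of them are distinct, then all of them are less than $pb$. Hence for the distances from $o$ one can take $K\le pb$: padding multiplies the number of columns by a factor of at most $p$. 4. *(Multiplication by an ordinary Vandermonde matrix.)* For all $a,K\ge1$, given $r\in\mathbb R^a$ and $c\in\mathbb R^K$, the vector $[r_i^k]_{1\le i\le a,\,0\le k<K}\,c$ can be computed exactly in $O\big((a+K)\log^2(a+K)\big)$ steps. 5. *(Multiplication by $[f(x_i+y_j)]$.)* For all $a,b\ge1$, given $u,v,w,q$, $x\in\mathbb R^a$, $s\in\mathbb N^b$ and $z\in\mathbb R^b$, the vector $[f(x_i+y_j)]\,z$ with $y_j=s_j/q$ can be computed exactly in $O\big((a+b+K)\log^2(a+b+K)\big)$ steps, for every $K$ that exceeds all $s_j$. 6. *(Fast exact $f$-integration.)* Let $T$ be a tree on $N$ vertices with edge weights in $\{e/q: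 e\in\{1,\dots,p\}\}$. Given $u,v,w,q$, a list of the edges of $T$ with the numerators of their weights, and a field $X\in\mathbb R^{N\times D}$, $D\ge1$, the field $i\mapsto\sum_{j}f(\mathrm{dist}(i,j))\,X[j]$ can be computed exactly in $$O\big(D\cdot pN\,\log^2(pN+1)\,\log(N+1)\big)$$ steps; in particular in $O(N\log^3 N)$ steps if $p$ and $D$ are constant. -/

import Mathlib

namespace FTFI

/-! ## Matrices and distances -/

/-- The exponentiated quadratic function `t ↦ exp (u t² + v t + w)`. -/
noncomputable def quadExp (u v w : ℝ) (t : ℝ) : ℝ := Real.exp (u * t ^ 2 + v * t + w)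

/-- The `a × b` matrix `[f (x i + y j)]`. -/
def sumMatrix {a b : ℕ} (f : ℝ → ℝ) (x : Fin a → ℝ) (y : Fin b → ℝ) :
    Matrix (Fin a) (Fin b) ℝ :=
  Matrix.of fun i j => f (x i + y j)

/-- The generalized Vandermonde matrix `[r i ^ s j]`, with arbitrary natural exponents. -/
def genVandermonde {a b : ℕ} (r : Fin a → ℝ) (s : Fin b → ℕ) : Matrix (Fin a) (Fin b) ℝ :=
  Matrix.of fun i j => r i ^ s j

/-- The ordinary (rectangular) Vandermonde matrix with `K` columns: its exponents are the
consecutive integers `0, 1, …, K - 1`. -/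
def ordVandermonde {a : ℕ} (r : Fin a → ℝ) (K : ℕ) : Matrix (Fin a) (Fin K) ℝ :=
  Matrix.of fun i k => r i ^ (k : ℕ)

/-- The vector `z`, indexed by the exponents `s j`, padded to a vector indexed by
`0, 1, …, K - 1`: the entry at an exponent that is not realized is zero. -/
def padVector {b : ℕ} (s : Fin b → ℕ) (z : Fin b → ℝ) (K : ℕ) : Fin K → ℝ :=
  fun k => ∑ j : Fin b, if s j = (k : ℕ) then z j else 0

/-- The shortest-path distance of a graph with edge weights `W`. -/
noncomputable def wdist {V : Type*} (G : SimpleGraph V) (W : Sym2 V → ℝ) (i j : V) : ℝ :=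
  ⨅ γ : G.Walk i j, (γ.edges.map W).sum

/-- The `f`-distance matrix `[f (dist (i, j))]` of a weighted graph. -/
noncomputable def fDistMatrix {V : Type*} (f : ℝ → ℝ) (G : SimpleGraph V) (W : Sym2 V → ℝ) :
    Matrix V V ℝ :=
  Matrix.of fun i j => f (wdist G W i j)

/-- `G` is a tree, and every edge of it has the weight `e / q` for some `e ∈ {1, …, p}`;
the function `e` gives the numerators. -/
structure IsWeightedTree {N : ℕ} (G : SimpleGraph (Fin N)) (e : Sym2 (Fin N) → ℕ)
    (p : ℕ) : Prop where
  isTree : G.IsTree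
  one_le : ∀ ε ∈ G.edgeSet, 1 ≤ e ε
  le_bound : ∀ ε ∈ G.edgeSet, e ε ≤ p

/-- The edge weights `e / q`. -/
noncomputable def ratWeight {N : ℕ} (e : Sym2 (Fin N) → ℕ) (q : ℕ) : Sym2 (Fin N) → ℝ :=
  fun ε => (e ε : ℝ) / (q : ℝ)

/-! ## The machine model

A random access machine with exact scalar arithmetic at unit cost.  The memory consists of
arrays of natural numbers (for sizes, addresses and other discrete data) and arrays of complex
numbers; a simple variable is the cell `0` of an array.  The operations on natural numbers are
constants, addition, truncated subtraction, halving and comparison.  The operations on scalars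
are the field operations (with `x / 0 = 0`), the exponential function, the constant `π i` and the
conversion of a natural number to a scalar.  Scalars can neither be compared nor be rounded. -/

/-- Expressions with natural values. -/
inductive IExp : Type
  | const (n : ℕ)
  | get (A : ℕ) (i : IExp)
  | add (x y : IExp)
  | sub (x y : IExp)
  | half (x : IExp)

/-- Expressions with scalar values. -/
inductive SExp : Type
  | piI
  | ofNat (x : IExp)
  | get (A : ℕ) (i : IExp)
  | add (x y : SExp)
  | sub (x y : SExp)
  | mul (x y : SExp)
  | div (x y : SExp)
  | exp (x : SExp)

/-- Tests. -/
inductive Test : Type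
  | lt (x y : IExp)
  | eq (x y : IExp)

/-- Programs. -/
inductive Prog : Type
  | skip
  | setI (A : ℕ) (i x : IExp)
  | setS (A : ℕ) (i : IExp) (x : SExp)
  | seq (P Q : Prog)
  | ite (b : Test) (P Q : Prog)
  | loop (b : Test) (P : Prog)

/-- The contents of the memory: `ints A i` and `nums A i` are the cells `i` of the integer array
and of the scalar array with the name `A`. -/
structure Store : Type where
  ints : ℕ → ℕ → ℕ
  nums : ℕ → ℕ → ℂ

def IExp.eval (σ : Store) : IExp → ℕ
  | .const n => n
  | .get A i => σ.ints A (i.eval σ)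
  | .add x y => x.eval σ + y.eval σ
  | .sub x y => x.eval σ - y.eval σ
  | .half x => x.eval σ / 2

/-- The number of operations in an expression. -/
def IExp.cost : IExp → ℕ
  | .const _ => 1
  | .get _ i => 1 + i.cost
  | .add x y => 1 + x.cost + y.cost
  | .sub x y => 1 + x.cost + y.cost
  | .half x => 1 + x.cost

noncomputable def SExp.eval (σ : Store) : SExp → ℂ
  | .piI => (Real.pi : ℂ) * Complex.I
  | .ofNat x => (x.eval σ : ℂ)
  | .get A i => σ.nums A (i.eval σ)
  | .add x y => x.eval σ + y.eval σ
  | .sub x y => x.eval σ - y.eval σ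
  | .mul x y => x.eval σ * y.eval σ
  | .div x y => x.eval σ / y.eval σ
  | .exp x => Complex.exp (x.eval σ)

/-- The number of operations in an expression. -/
def SExp.cost : SExp → ℕ
  | .piI => 1
  | .ofNat x => 1 + x.cost
  | .get _ i => 1 + i.cost
  | .add x y => 1 + x.cost + y.cost
  | .sub x y => 1 + x.cost + y.cost
  | .mul x y => 1 + x.cost + y.cost
  | .div x y => 1 + x.cost + y.cost
  | .exp x => 1 + x.cost

def Test.Holds (σ : Store) : Test → Prop
  | .lt x y => x.eval σ < y.eval σ
  | .eq x y => x.eval σ = y.eval σ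

def Test.cost : Test → ℕ
  | .lt x y => 1 + x.cost + y.cost
  | .eq x y => 1 + x.cost + y.cost

/-- Write `n` into the cell `i` of the integer array `A`. -/
def Store.putI (σ : Store) (A i n : ℕ) : Store where
  ints := fun B j => if B = A ∧ j = i then n else σ.ints B j
  nums := σ.nums

/-- Write `c` into the cell `i` of the scalar array `A`. -/
noncomputable def Store.putS (σ : Store) (A i : ℕ) (c : ℂ) : Store where
  ints := σ.ints
  nums := fun B j => if B = A ∧ j = i then c else σ.nums B j

/-- `Exec P σ t τ`: the program `P`, started in the memory `σ`, halts in the memory `τ` after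
exactly `t` steps. -/
inductive Exec : Prog → Store → ℕ → Store → Prop
  | skip (σ : Store) : Exec .skip σ 1 σ
  | setI (A : ℕ) (i x : IExp) (σ : Store) :
      Exec (.setI A i x) σ (1 + i.cost + x.cost) (σ.putI A (i.eval σ) (x.eval σ))
  | setS (A : ℕ) (i : IExp) (x : SExp) (σ : Store) :
      Exec (.setS A i x) σ (1 + i.cost + x.cost) (σ.putS A (i.eval σ) (x.eval σ))
  | seq {P Q : Prog} {σ τ ρ : Store} {t t' : ℕ} :
      Exec P σ t τ → Exec Q τ t' ρ → Exec (.seq P Q) σ (t + t') ρ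
  | iteTrue {b : Test} {P Q : Prog} {σ τ : Store} {t : ℕ} :
      b.Holds σ → Exec P σ t τ → Exec (.ite b P Q) σ (b.cost + t) τ
  | iteFalse {b : Test} {P Q : Prog} {σ τ : Store} {t : ℕ} :
      ¬ b.Holds σ → Exec Q σ t τ → Exec (.ite b P Q) σ (b.cost + t) τ
  | loopStop {b : Test} {P : Prog} {σ : Store} :
      ¬ b.Holds σ → Exec (.loop b P) σ b.cost σ
  | loopStep {b : Test} {P : Prog} {σ τ ρ : Store} {t t' : ℕ} :
      b.Holds σ → Exec P σ t τ → Exec (.loop b P) τ t' ρ →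
      Exec (.loop b P) σ (b.cost + t + t') ρ

/-- The program `P`, started in the memory `σ`, halts within `T` steps in a memory that
satisfies `post`. -/
def RunsWithin (P : Prog) (σ : Store) (T : ℝ) (post : Store → Prop) : Prop :=
  ∃ (t : ℕ) (τ : Store), Exec P σ t τ ∧ (t : ℝ) ≤ T ∧ post τ

/-! ## Inputs

All cells that hold no part of the input are zero. -/

/-- An array that holds a finite sequence. -/
def arr {α : Type*} [Zero α] {n : ℕ} (g : Fin n → α) : ℕ → α :=
  fun i => if h : i < n then g ⟨i, h⟩ else 0

/-- The input `(r, c)` of the multiplication of an `a × K` Vandermonde matrix by a vector. -/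
noncomputable def vandInput {a K : ℕ} (r : Fin a → ℝ) (c : Fin K → ℝ) : Store where
  ints := fun A => match A with
    | 0 => arr ![a, K]
    | _ => fun _ => 0
  nums := fun A => match A with
    | 0 => arr fun i => (r i : ℂ)
    | 1 => arr fun k => (c k : ℂ)
    | _ => fun _ => 0

/-- The input of the multiplication of `[f (x i + s j / q)]` by the vector `z`, where
`f t = exp (u t² + v t + w)`. -/
noncomputable def sumMatrixInput {a b : ℕ} (u v w : ℝ) (q : ℕ) (x : Fin a → ℝ)
    (s : Fin b → ℕ) (z : Fin b → ℝ) : Store where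
  ints := fun A => match A with
    | 0 => arr ![a, b, q]
    | 1 => arr s
    | _ => fun _ => 0
  nums := fun A => match A with
    | 0 => arr ![(u : ℂ), (v : ℂ), (w : ℂ)]
    | 1 => arr fun i => (x i : ℂ)
    | 2 => arr fun j => (z j : ℂ)
    | _ => fun _ => 0

/-- `E` is a list of the edges of `G`, each given by its two ends, in any order. -/
def IsEdgeList {N m : ℕ} (G : SimpleGraph (Fin N)) (E : Fin m → Fin N × Fin N) : Prop :=
  ∀ i j, G.Adj i j ↔ ∃ k, E k = (i, j) ∨ E k = (j, i)

/-- The input of the integration of a field `X` with `D` components: the edge list `E` with the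
numerators `e` of the weights, their common denominator `q`, the coefficients of
`f t = exp (u t² + v t + w)`, and the field, the component `d` at the vertex `i` in the cell
`d * N + i`. -/
noncomputable def treeInput {N m D : ℕ} (u v w : ℝ) (q : ℕ) (E : Fin m → Fin N × Fin N)
    (e : Sym2 (Fin N) → ℕ) (X : Matrix (Fin N) (Fin D) ℝ) : Store where
  ints := fun A => match A with
    | 0 => arr ![N, q, D]
    | 1 => arr fun k => ((E k).1 : ℕ)
    | 2 => arr fun k => ((E k).2 : ℕ)
    | 3 => arr fun k => e s((E k).1, (E k).2)
    | _ => fun _ => 0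
  nums := fun A => match A with
    | 0 => arr ![(u : ℂ), (v : ℂ), (w : ℂ)]
    | 1 => arr fun k : Fin (D * N) =>
        (X (finProdFinEquiv.symm k).2 (finProdFinEquiv.symm k).1 : ℂ)
    | _ => fun _ => 0

end FTFI

namespace FTFI

/-! ## Reasoning about programs -/

/-! Factorization. In the exponent of $f(x+y)$ the only mixed term is $2uxy=s\cdot(2ux/q)$ with
$s=qy$, so $[f(x_i+y_j)]$ is a diagonally scaled matrix of powers $r_i^{s_j}$, whose columns occur
in the ordinary Vandermonde matrix (`sumMatrix_quadExp`, `genVandermonde_mulVec`).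

Vandermonde multiplication is evaluation of a polynomial at the nodes $r_i$. If the coefficients are
reversed into a polynomial $R$ of degree less than $n=2^m$, the value at $r$ is the coefficient of
$X^{n-1}$ in $R/(1-rX)$ (`coeff_mul_geom`). A product tree holds the products of the factors
$1-r_iX$ over dyadic blocks; its root is inverted modulo $X^n$ by Newton iteration (`newton_step`),
which gives $R/\prod_i(1-r_iX)$. On the way down, multiplication by the product of the sibling block
removes the factors of the sibling (`mul_blockInv_left`, `mul_blockInv_right`), and at level $l$
only the $2^l$ coefficients just below $X^n$ are needed (`coeff_mul_of_window`). Each level costs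
$O(n\log n)$ by fast convolution, and there are $\log_2 n$ levels. The only divisors of scalars are
integers such as the transform length, so nodes may vanish or coincide.

Distances. On the path to $o$ the distance drops by at most $p$ (in units of $1/q$) per edge; hence
every value lies within $p$ of a smaller one, and the largest is bounded by $p$ times the number of
values (`le_mul_card_image_of_gaps`).

Integration on a tree. The tree is rooted by peeling leaves and numbered with parents before
children (`peel_runs`). In each component a centroid $z$ is chosen and all edges at it are cut. Two
vertices that this separates satisfy $d(x,y)=d(x,z)+d(z,y)$ (`tdist_separated`), so their
contribution is a sum of $f(d_x+d_y)X_y$ over the component minus the same sums over its parts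
(`sepSum_cutAt`). Such a sum is a product with a Hankel matrix whose order is at most $2p$ times the
size of the group, hence one convolution (`hankelBlock_runs`, `groupSum_runs`). Component sizes
halve (`card_cutAt_le`), so $\log_2N$ rounds separate all pairs (`treeSum_runs`).

Correctness and running time are proved together through the triples `Runs`: loops carry indexed
invariants, loop-free code is evaluated symbolically, and everything outside the arrays that a
program writes is preserved by `Exec.frame`. -/

instance : Add IExp := ⟨IExp.add⟩
instance : Sub IExp := ⟨IExp.sub⟩
instance (n : ℕ) : OfNat IExp n := ⟨IExp.const n⟩
instance : Add SExp := ⟨SExp.add⟩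
instance : Sub SExp := ⟨SExp.sub⟩
instance : Mul SExp := ⟨SExp.mul⟩
instance : Div SExp := ⟨SExp.div⟩

/-- The simple integer variable with the name `A`. -/
abbrev V (A : ℕ) : IExp := .get A (.const 0)

infixr:30 " ;; " => Prog.seq

@[simp] theorem IExp.eval_add' (σ : Store) (x y : IExp) : (x + y).eval σ = x.eval σ + y.eval σ := rfl
@[simp] theorem IExp.eval_sub' (σ : Store) (x y : IExp) : (x - y).eval σ = x.eval σ - y.eval σ := rfl
@[simp] theorem IExp.eval_lit (σ : Store) (n : ℕ) : (no_index (OfNat.ofNat n : IExp)).eval σ = n := rfl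
@[simp] theorem SExp.eval_add' (σ : Store) (x y : SExp) : (x + y).eval σ = x.eval σ + y.eval σ := rfl
@[simp] theorem SExp.eval_sub' (σ : Store) (x y : SExp) : (x - y).eval σ = x.eval σ - y.eval σ := rfl
@[simp] theorem SExp.eval_div' (σ : Store) (x y : SExp) : (x / y).eval σ = x.eval σ / y.eval σ := rfl

attribute [simp] IExp.eval SExp.eval

@[simp] theorem Test.holds_lt (σ : Store) (x y : IExp) :
    (Test.lt x y).Holds σ ↔ x.eval σ < y.eval σ := Iff.rfl
@[simp] theorem Test.holds_eq (σ : Store) (x y : IExp) :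
    (Test.eq x y).Holds σ ↔ x.eval σ = y.eval σ := Iff.rfl

@[simp] theorem Store.putI_ints (σ : Store) (A i n B j : ℕ) :
    (σ.putI A i n).ints B j = if B = A ∧ j = i then n else σ.ints B j := rfl
@[simp] theorem Store.putI_nums (σ : Store) (A i n : ℕ) : (σ.putI A i n).nums = σ.nums := rfl
@[simp] theorem Store.putS_nums (σ : Store) (A i : ℕ) (c : ℂ) (B j : ℕ) :
    (σ.putS A i c).nums B j = if B = A ∧ j = i then c else σ.nums B j := rfl
@[simp] theorem Store.putS_ints (σ : Store) (A i : ℕ) (c : ℂ) : (σ.putS A i c).ints = σ.ints := rfl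

theorem Store.putI_ints_ne (σ : Store) {A B : ℕ} (i n : ℕ) (h : B ≠ A) :
    (σ.putI A i n).ints B = σ.ints B := by
  funext j; simp [h]
theorem Store.putS_nums_ne (σ : Store) {A B : ℕ} (i : ℕ) (c : ℂ) (h : B ≠ A) :
    (σ.putS A i c).nums B = σ.nums B := by
  funext j; simp [h]

instance (σ : Store) (b : Test) : Decidable (b.Holds σ) := by
  cases b <;> unfold Test.Holds <;> infer_instance

/-- The integer arrays that a program may write. -/
def Prog.wI : Prog → List ℕ
  | .skip => []
  | .setI A _ _ => [A]
  | .setS _ _ _ => []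
  | .seq P Q => P.wI ++ Q.wI
  | .ite _ P Q => P.wI ++ Q.wI
  | .loop _ P => P.wI

/-- The scalar arrays that a program may write. -/
def Prog.wS : Prog → List ℕ
  | .skip => []
  | .setI _ _ _ => []
  | .setS A _ _ => [A]
  | .seq P Q => P.wS ++ Q.wS
  | .ite _ P Q => P.wS ++ Q.wS
  | .loop _ P => P.wS

/-- The memories `σ` and `τ` agree outside the arrays that `P` may write. -/
structure Prog.Frame (P : Prog) (σ τ : Store) : Prop where
  ints : ∀ A, A ∉ P.wI → τ.ints A = σ.ints A
  nums : ∀ A, A ∉ P.wS → τ.nums A = σ.nums A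

theorem Prog.Frame.refl (P : Prog) (σ : Store) : P.Frame σ σ := ⟨fun _ _ => rfl, fun _ _ => rfl⟩

theorem Prog.Frame.trans {P : Prog} {σ τ ρ : Store} (h : P.Frame σ τ) (h' : P.Frame τ ρ) :
    P.Frame σ ρ :=
  ⟨fun A hA => (h'.ints A hA).trans (h.ints A hA), fun A hA => (h'.nums A hA).trans (h.nums A hA)⟩

theorem Prog.Frame.mono {P Q : Prog} {σ τ : Store} (h : P.Frame σ τ)
    (hI : P.wI ⊆ Q.wI) (hS : P.wS ⊆ Q.wS) : Q.Frame σ τ :=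
  ⟨fun A hA => h.ints A fun h' => hA (hI h'), fun A hA => h.nums A fun h' => hA (hS h')⟩

/-- The lists of written arrays are computable, so for a concrete program the survival of a value
across it is settled by `decide`. This is how facts travel through sequences of subprograms. -/
theorem Exec.frame {P : Prog} {σ τ : Store} {t : ℕ} (h : Exec P σ t τ) : P.Frame σ τ := by
  induction h with
  | skip σ => exact .refl _ _
  | setI A i x σ =>
    exact ⟨fun B hB => Store.putI_ints_ne _ _ _ (by simpa [Prog.wI] using hB), fun _ _ => rfl⟩
  | setS A i x σ =>
    exact ⟨fun _ _ => rfl, fun B hB => Store.putS_nums_ne _ _ _ (by simpa [Prog.wS] using hB)⟩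
  | seq _ _ h1 h2 =>
    exact (h1.mono (by simp [Prog.wI]) (by simp [Prog.wS])).trans
      (h2.mono (by simp [Prog.wI]) (by simp [Prog.wS]))
  | iteTrue _ _ h => exact h.mono (by simp [Prog.wI]) (by simp [Prog.wS])
  | iteFalse _ _ h => exact h.mono (by simp [Prog.wI]) (by simp [Prog.wS])
  | loopStop => exact .refl _ _
  | loopStep _ _ _ h1 h2 =>
    exact (h1.mono (by simp [Prog.wI]) (by simp [Prog.wS])).trans h2

/-- The program `P`, started in `σ`, halts within `T` steps in a memory that satisfies `post`. -/
def Runs (P : Prog) (σ : Store) (T : ℕ) (post : Store → Prop) : Prop :=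
  ∃ (t : ℕ) (τ : Store), Exec P σ t τ ∧ t ≤ T ∧ post τ

theorem Runs.within {P : Prog} {σ : Store} {T : ℕ} {post : Store → Prop} (h : Runs P σ T post)
    {T' : ℝ} (hT : (T : ℝ) ≤ T') : RunsWithin P σ T' post := by
  obtain ⟨t, τ, h1, h2, h3⟩ := h
  exact ⟨t, τ, h1, le_trans (by exact_mod_cast h2) hT, h3⟩

theorem Runs.mono {P : Prog} {σ : Store} {T T' : ℕ} {post post' : Store → Prop}
    (h : Runs P σ T post) (hT : T ≤ T') (hp : ∀ τ, P.Frame σ τ → post τ → post' τ) :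
    Runs P σ T' post' := by
  obtain ⟨t, τ, h1, h2, h3⟩ := h
  exact ⟨t, τ, h1, h2.trans hT, hp τ h1.frame h3⟩

theorem Runs.le {P : Prog} {σ : Store} {T T' : ℕ} {post : Store → Prop}
    (h : Runs P σ T post) (hT : T ≤ T') : Runs P σ T' post := h.mono hT fun _ _ h => h

theorem Runs.seq {P Q : Prog} {σ : Store} {T T' : ℕ} {mid post : Store → Prop}
    (h : Runs P σ T mid) (h' : ∀ τ, P.Frame σ τ → mid τ → Runs Q τ T' post) :
    Runs (P ;; Q) σ (T + T') post := by
  obtain ⟨t, τ, h1, h2, h3⟩ := h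
  obtain ⟨t', ρ, h1', h2', h3'⟩ := h' τ h1.frame h3
  exact ⟨_, ρ, h1.seq h1', add_le_add h2 h2', h3'⟩

theorem Runs.setI {A : ℕ} {i x : IExp} {σ : Store} {post : Store → Prop}
    (h : post (σ.putI A (i.eval σ) (x.eval σ))) :
    Runs (.setI A i x) σ (1 + i.cost + x.cost) post := ⟨_, _, .setI A i x σ, le_rfl, h⟩

theorem Runs.setS {A : ℕ} {i : IExp} {x : SExp} {σ : Store} {post : Store → Prop}
    (h : post (σ.putS A (i.eval σ) (x.eval σ))) :
    Runs (.setS A i x) σ (1 + i.cost + x.cost) post := ⟨_, _, .setS A i x σ, le_rfl, h⟩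

theorem Runs.ite {b : Test} {P Q : Prog} {σ : Store} {T : ℕ} {post : Store → Prop}
    (h1 : b.Holds σ → Runs P σ T post) (h2 : ¬ b.Holds σ → Runs Q σ T post) :
    Runs (.ite b P Q) σ (b.cost + T) post := by
  by_cases hb : b.Holds σ
  · obtain ⟨t, τ, h, ht, hp⟩ := h1 hb
    exact ⟨_, τ, .iteTrue hb h, by omega, hp⟩
  · obtain ⟨t, τ, h, ht, hp⟩ := h2 hb
    exact ⟨_, τ, .iteFalse hb h, by omega, hp⟩

/-- The effect of a program without loops. -/
noncomputable def Prog.run : Prog → Store → Store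
  | .skip, σ => σ
  | .setI A i x, σ => σ.putI A (i.eval σ) (x.eval σ)
  | .setS A i x, σ => σ.putS A (i.eval σ) (x.eval σ)
  | .seq P Q, σ => Q.run (P.run σ)
  | .ite b P Q, σ => if b.Holds σ then P.run σ else Q.run σ
  | .loop _ _, σ => σ

attribute [simp] Prog.run

/-- A bound for the running time of a program without loops. -/
def Prog.bound : Prog → ℕ
  | .skip => 1
  | .setI _ i x => 1 + i.cost + x.cost
  | .setS _ i x => 1 + i.cost + x.cost
  | .seq P Q => P.bound + Q.bound
  | .ite b P Q => b.cost + (P.bound + Q.bound)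
  | .loop _ _ => 0

/-- The program has no loops. -/
def Prog.flat : Prog → Bool
  | .seq P Q => P.flat && Q.flat
  | .ite _ P Q => P.flat && Q.flat
  | .loop _ _ => false
  | _ => true

/-- Reduces loop-free code to the evaluation of `run`. `bound` charges both branches of a
conditional, so that it does not depend on the memory and is compared with a numeral by `decide`. -/
theorem Runs.flat {P : Prog} {σ : Store} {T : ℕ} {post : Store → Prop} (hP : P.flat = true)
    (hT : P.bound ≤ T) (h : post (P.run σ)) : Runs P σ T post := by
  suffices key : ∀ (P : Prog) (σ : Store), P.flat = true →
      ∃ t ≤ P.bound, Exec P σ t (P.run σ) by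
    obtain ⟨t, h1, h2⟩ := key P σ hP
    exact ⟨t, _, h2, h1.trans hT, h⟩
  intro P
  induction P with
  | skip => exact fun σ _ => ⟨1, le_rfl, .skip σ⟩
  | setI A i x => exact fun σ _ => ⟨_, le_rfl, .setI A i x σ⟩
  | setS A i x => exact fun σ _ => ⟨_, le_rfl, .setS A i x σ⟩
  | seq P Q ihP ihQ =>
    intro σ h
    simp only [Prog.flat, Bool.and_eq_true] at h
    obtain ⟨t, h1, h2⟩ := ihP σ h.1
    obtain ⟨t', h1', h2'⟩ := ihQ (P.run σ) h.2
    exact ⟨_, add_le_add h1 h1', h2.seq h2'⟩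
  | ite b P Q ihP ihQ =>
    intro σ h
    simp only [Prog.flat, Bool.and_eq_true] at h
    obtain ⟨t, h1, h2⟩ := ihP σ h.1
    obtain ⟨t', h1', h2'⟩ := ihQ σ h.2
    by_cases hb : b.Holds σ
    · exact ⟨b.cost + t, by simp only [Prog.bound]; omega, by
        simpa only [Prog.run, if_pos hb] using Exec.iteTrue hb h2⟩
    · exact ⟨b.cost + t', by simp only [Prog.bound]; omega, by
        simpa only [Prog.run, if_neg hb] using Exec.iteFalse hb h2'⟩
  | loop b P ih => intro σ h; simp [Prog.flat] at h

theorem Runs.pre {P Q : Prog} {σ : Store} {T T' : ℕ} {post : Store → Prop} (c : ℕ)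
    (hP : P.flat = true) (hc : P.bound ≤ c) (hT : c + T' ≤ T) (h : Runs Q (P.run σ) T' post) :
    Runs (P ;; Q) σ T post :=
  (Runs.seq (mid := fun τ => τ = P.run σ) (Runs.flat hP hc rfl)
    (fun τ _ hτ => by rw [hτ]; exact h)).le hT

/-- The number of iterations is fixed beforehand: the invariant with index `k < n` must force the
test, the one with index `n` must refute it. Termination therefore needs no separate measure. -/
theorem Runs.loop {b : Test} {P : Prog} {σ : Store} {n : ℕ} (c : ℕ → ℕ)
    (Inv : ℕ → Store → Prop) (h0 : Inv 0 σ)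
    (hstep : ∀ k < n, ∀ τ, P.Frame σ τ → Inv k τ → b.Holds τ ∧ Runs P τ (c k) (Inv (k + 1)))
    (hend : ∀ τ, P.Frame σ τ → Inv n τ → ¬ b.Holds τ) :
    Runs (.loop b P) σ (∑ k ∈ Finset.range n, (b.cost + c k) + b.cost) (Inv n) := by
  -- Induction on the number `j` of iterations that remain, since `Exec` unfolds a loop at its first
  -- iteration.
  suffices key : ∀ j ≤ n, ∀ τ, P.Frame σ τ → Inv (n - j) τ → ∃ t ρ, Exec (.loop b P) τ t ρ ∧
      t ≤ ∑ k ∈ Finset.Ico (n - j) n, (b.cost + c k) + b.cost ∧ Inv n ρ by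
    simpa [Runs] using key n le_rfl σ (.refl _ _) (by simpa using h0)
  intro j
  induction j with
  | zero =>
    intro _ τ hF hI
    exact ⟨_, τ, .loopStop (hend τ hF hI), by simp, hI⟩
  | succ j ih =>
    intro hj τ hF hI
    obtain ⟨hb, t, τ', hE, ht, hI'⟩ := hstep (n - (j + 1)) (by omega) τ hF hI
    rw [show n - (j + 1) + 1 = n - j by omega] at hI'
    obtain ⟨t', ρ, hE', ht', hI''⟩ := ih (by omega) τ' (hF.trans hE.frame) hI'
    refine ⟨_, ρ, .loopStep hb hE hE', ?_, hI''⟩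
    rw [Finset.sum_eq_sum_Ico_succ_bot (by omega : n - (j + 1) < n),
      show n - (j + 1) + 1 = n - j by omega]
    omega

/-- The program `for v = 0, …, x - 1 do P`. -/
def forUp (v : ℕ) (x : IExp) (P : Prog) : Prog :=
  .setI v 0 0 ;; .loop (.lt (V v) x) (P ;; .setI v 0 (V v + 1))

/-- The body has to establish the invariant in the memory whose counter is already advanced, which
is the memory seen by the next iteration. -/
theorem Runs.forUp {v : ℕ} {x : IExp} {P : Prog} {σ : Store} {n : ℕ} (c : ℕ → ℕ)
    (Inv : ℕ → Store → Prop) (hv : v ∉ P.wI) (h0 : Inv 0 (σ.putI v 0 0))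
    (hx : ∀ τ, (forUp v x P).Frame σ τ → x.eval τ = n)
    (hP : ∀ k < n, ∀ τ, (FTFI.forUp v x P).Frame σ τ → τ.ints v 0 = k → Inv k τ →
      Runs P τ (c k) (fun τ' => Inv (k + 1) (τ'.putI v 0 (k + 1)))) :
    Runs (FTFI.forUp v x P) σ
      (∑ k ∈ Finset.range n, c k + n * (x.cost + 10) + (x.cost + 10))
      (fun τ => Inv n τ ∧ τ.ints v 0 = n) := by
  have hsub : ∀ τ, (P ;; .setI v 0 (V v + 1)).Frame (σ.putI v 0 0) τ →
      (FTFI.forUp v x P).Frame σ τ := by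
    intro τ h
    refine ⟨fun A hA => ?_, fun A hA => ?_⟩
    · have hA' : A ∉ (P ;; .setI v 0 (V v + 1)).wI := by
        intro h'; apply hA; simp [FTFI.forUp, Prog.wI] at h' ⊢; tauto
      rw [h.ints A hA', Store.putI_ints_ne]
      rintro rfl; apply hA; simp [FTFI.forUp, Prog.wI]
    · have hA' : A ∉ (P ;; .setI v 0 (V v + 1)).wS := by
        intro h'; apply hA; simpa [FTFI.forUp, Prog.wS] using h'
      rw [h.nums A hA']; rfl
  refine Runs.le (Runs.seq (mid := fun τ => τ = σ.putI v 0 0) (Runs.setI rfl)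
    (T' := ∑ k ∈ Finset.range n, ((Test.lt (V v) x).cost + (c k + 7)) +
      (Test.lt (V v) x).cost) ?_) ?_
  · rintro τ - rfl
    refine (Runs.loop (fun k => c k + 7) (fun k τ => Inv k τ ∧ τ.ints v 0 = k) ⟨h0, by simp⟩
      ?_ ?_)
    · rintro k hk τ hF ⟨hI, hvk⟩
      refine ⟨by simp [hx τ (hsub τ hF), hvk, hk], ?_⟩
      refine Runs.seq (T' := 7) (hP k hk τ (hsub τ hF) hvk hI) ?_
      intro τ' hF' hI'
      refine Runs.le (Runs.setI ?_) (show 6 ≤ 7 by omega)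
      have : τ'.ints v 0 = k := by rw [hF'.ints v hv, hvk]
      simpa [this] using hI'
    · rintro τ hF ⟨hI, hvk⟩
      simp [hx τ (hsub τ hF), hvk]
  · have e1 : (Test.lt (V v) x).cost = 3 + x.cost := by
      simp only [Test.cost, IExp.cost]
    have e2 : (0 : IExp).cost = 1 := rfl
    simp only [e1, e2, Finset.sum_add_distrib, Finset.sum_const, Finset.card_range, smul_eq_mul]
    have e3 : n * (3 + x.cost) = 3 * n + n * x.cost := by ring
    have e4 : n * (x.cost + 10) = n * x.cost + 10 * n := by ring
    omega

theorem Runs.forUp_const {v : ℕ} {x : IExp} {P : Prog} {σ : Store} {n : ℕ} (c : ℕ)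
    (Inv : ℕ → Store → Prop) (hv : v ∉ P.wI) (h0 : Inv 0 (σ.putI v 0 0))
    (hx : ∀ τ, (FTFI.forUp v x P).Frame σ τ → x.eval τ = n)
    (hP : ∀ k < n, ∀ τ, (FTFI.forUp v x P).Frame σ τ → τ.ints v 0 = k → Inv k τ →
      Runs P τ c (fun τ' => Inv (k + 1) (τ'.putI v 0 (k + 1)))) :
    Runs (FTFI.forUp v x P) σ ((n + 1) * (c + x.cost + 10))
      (fun τ => Inv n τ ∧ τ.ints v 0 = n) := by
  refine (Runs.forUp (fun _ => c) Inv hv h0 hx hP).le ?_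
  simp only [Finset.sum_const, Finset.card_range, smul_eq_mul]
  nlinarith

/-- A loop that fills the cells `o, …, o + n - 1` of a scalar array. -/
theorem Runs.fillS {v : ℕ} {x : IExp} {P : Prog} {σ : Store} {n : ℕ} (B o : ℕ) (f : ℕ → ℂ)
    (hv : v ∉ P.wI) (hflat : P.flat = true)
    (hx : ∀ τ, (FTFI.forUp v x P).Frame σ τ → x.eval τ = n)
    (hP : ∀ k < n, ∀ τ, (FTFI.forUp v x P).Frame σ τ → τ.ints v 0 = k →
      (∀ j, j < o ∨ o + k ≤ j → τ.nums B j = σ.nums B j) →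
      (P.run τ).nums B = (τ.putS B (o + k) (f k)).nums B) :
    Runs (FTFI.forUp v x P) σ ((n + 1) * (P.bound + x.cost + 10))
      (fun τ => (∀ k < n, τ.nums B (o + k) = f k) ∧
        ∀ j, j < o ∨ o + n ≤ j → τ.nums B j = σ.nums B j) := by
  refine (Runs.forUp_const P.bound (fun i τ => (∀ k < i, τ.nums B (o + k) = f k) ∧
        ∀ j, j < o ∨ o + i ≤ j → τ.nums B j = σ.nums B j) hv ⟨by simp, by simp⟩ hx ?_).mono le_rfl
        fun τ _ h => h.1
  rintro k hk τ hF hvk ⟨h1, h2⟩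
  refine Runs.flat hflat le_rfl ?_
  have h := hP k hk τ hF hvk h2
  simp only [Store.putI_nums, h]
  refine ⟨fun i hi => ?_, fun j hj => ?_⟩
  · rcases Nat.lt_succ_iff_lt_or_eq.mp hi with h' | rfl
    · simp [h1 i h', h'.ne]
    · simp
  · have : j ≠ o + k := by omega
    simp [this, h2 j (by omega)]

theorem Runs.fillS_zero {v : ℕ} {x : IExp} {P : Prog} {σ : Store} {n : ℕ} (c B : ℕ) (f : ℕ → ℂ)
    (hv : v ∉ P.wI) (hflat : P.flat = true) (hc : P.bound + x.cost + 10 ≤ c)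
    (hx : ∀ τ, (FTFI.forUp v x P).Frame σ τ → x.eval τ = n)
    (hP : ∀ k < n, ∀ τ, (FTFI.forUp v x P).Frame σ τ → τ.ints v 0 = k →
      (∀ j, k ≤ j → τ.nums B j = σ.nums B j) →
      (P.run τ).nums B = (τ.putS B k (f k)).nums B) :
    Runs (FTFI.forUp v x P) σ ((n + 1) * c) (fun τ => ∀ k < n, τ.nums B k = f k) :=
  (Runs.fillS B 0 f hv hflat hx fun k hk τ hF hvk hj => by
    simpa using hP k hk τ hF hvk fun j h => hj j (by omega)).mono
      (Nat.mul_le_mul_left _ hc) fun τ _ h => by simpa using h.1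

/-- A loop that fills the cells `o, …, o + n - 1` of an integer array. -/
theorem Runs.fillI {v : ℕ} {x : IExp} {P : Prog} {σ : Store} {n : ℕ} (B o : ℕ) (f : ℕ → ℕ)
    (hv : v ∉ P.wI) (hB : B ≠ v) (hflat : P.flat = true)
    (hx : ∀ τ, (FTFI.forUp v x P).Frame σ τ → x.eval τ = n)
    (hP : ∀ k < n, ∀ τ, (FTFI.forUp v x P).Frame σ τ → τ.ints v 0 = k →
      (∀ j, j < o ∨ o + k ≤ j → τ.ints B j = σ.ints B j) → (∀ j < k, τ.ints B (o + j) = f j) →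
      (P.run τ).ints B = (τ.putI B (o + k) (f k)).ints B) :
    Runs (FTFI.forUp v x P) σ ((n + 1) * (P.bound + x.cost + 10))
      (fun τ => (∀ k < n, τ.ints B (o + k) = f k) ∧
        ∀ j, j < o ∨ o + n ≤ j → τ.ints B j = σ.ints B j) := by
  refine (Runs.forUp_const P.bound (fun i τ => (∀ k < i, τ.ints B (o + k) = f k) ∧
        ∀ j, j < o ∨ o + i ≤ j → τ.ints B j = σ.ints B j) hv
        ⟨by simp, by simp [hB]⟩ hx ?_).mono le_rfl
        fun τ _ h => h.1
  rintro k hk τ hF hvk ⟨h1, h2⟩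
  refine Runs.flat hflat le_rfl ?_
  have h := hP k hk τ hF hvk h2 h1
  rw [Store.putI_ints_ne _ _ _ hB, h]
  refine ⟨fun i hi => ?_, fun j hj => ?_⟩
  · rcases Nat.lt_succ_iff_lt_or_eq.mp hi with h' | rfl
    · simp [h1 i h', h'.ne]
    · simp
  · have : j ≠ o + k := by omega
    simp [this, h2 j (by omega)]

theorem Runs.fillI_zero {v : ℕ} {x : IExp} {P : Prog} {σ : Store} {n : ℕ} (c B : ℕ) (f : ℕ → ℕ)
    (hv : v ∉ P.wI) (hB : B ≠ v) (hflat : P.flat = true) (hc : P.bound + x.cost + 10 ≤ c)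
    (hx : ∀ τ, (FTFI.forUp v x P).Frame σ τ → x.eval τ = n)
    (hP : ∀ k < n, ∀ τ, (FTFI.forUp v x P).Frame σ τ → τ.ints v 0 = k →
      (∀ j, k ≤ j → τ.ints B j = σ.ints B j) → (∀ j < k, τ.ints B j = f j) →
      (P.run τ).ints B = (τ.putI B k (f k)).ints B) :
    Runs (FTFI.forUp v x P) σ ((n + 1) * c) (fun τ => ∀ k < n, τ.ints B k = f k) :=
  (Runs.fillI B 0 f hv hB hflat hx fun k hk τ hF hvk hj hj' => by
    simpa using hP k hk τ hF hvk (fun j h => hj j (by omega)) (by simpa using hj')).mono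
      (Nat.mul_le_mul_left _ hc) fun τ _ h => by simpa using h.1

end FTFI

namespace FTFI

/-! ## The fast Fourier transform -/

open Finset

/-- The primitive root of unity `exp (2 π i / n)`. -/
noncomputable def om (n : ℕ) : ℂ := Complex.exp (2 * Real.pi * Complex.I / (n : ℂ))

theorem om_isPrimitiveRoot {n : ℕ} (hn : n ≠ 0) : IsPrimitiveRoot (om n) n :=
  Complex.isPrimitiveRoot_exp n hn

/-- The machine supplies $\pi i$ rather than $2\pi i$; the missing factor two is put into the
natural number, as `k + k`. -/
theorem exp_eq_om_pow (n k : ℕ) :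
    Complex.exp (Real.pi * Complex.I * ((k + k : ℕ) : ℂ) / (n : ℂ)) = om n ^ k := by
  rw [om, ← Complex.exp_nat_mul]
  congr 1
  push_cast
  ring

theorem sum_om_pow {n : ℕ} (hn : n ≠ 0) (t : ℕ) :
    ∑ j ∈ range n, om n ^ (j * t) = if n ∣ t then (n : ℂ) else 0 := by
  have hω := om_isPrimitiveRoot hn
  simp_rw [mul_comm _ t, pow_mul]
  split_ifs with h
  · rw [(hω.pow_eq_one_iff_dvd t).2 h]; simp
  · have h1 : om n ^ t ≠ 1 := fun h' => h ((hω.pow_eq_one_iff_dvd t).1 h')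
    have h2 := mul_neg_geom_sum (om n ^ t) n
    rw [← pow_mul, mul_comm t n, pow_mul, hω.pow_eq_one, one_pow, sub_self, mul_eq_zero] at h2
    exact h2.resolve_left (sub_ne_zero.2 (Ne.symm h1))

/-- The discrete Fourier transform of length `n`. -/
noncomputable def dft (n : ℕ) (a : ℕ → ℂ) (j : ℕ) : ℂ := ∑ l ∈ range n, a l * om n ^ (j * l)

/-- The partial transforms of the autosort algorithm for the length `2 ^ m`. -/
noncomputable def partDft (m t : ℕ) (a : ℕ → ℂ) (q p : ℕ) : ℂ :=
  ∑ l ∈ range (2 ^ t), a (p + 2 ^ (m - t) * l) * om (2 ^ m) ^ (q * (p + 2 ^ (m - t) * l))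

theorem partDft_zero (m : ℕ) (a : ℕ → ℂ) (p : ℕ) : partDft m 0 a 0 p = a p := by
  simp [partDft]

theorem partDft_self (m : ℕ) (a : ℕ → ℂ) (q : ℕ) : partDft m m a q 0 = dft (2 ^ m) a q := by
  simp [partDft, dft]

theorem sum_range_two_mul {M : Type*} [AddCommMonoid M] (f : ℕ → M) (n : ℕ) :
    ∑ l ∈ range (2 * n), f l = ∑ l ∈ range n, (f (2 * l) + f (2 * l + 1)) := by
  induction n with
  | zero => simp
  | succ n ih =>
    rw [show 2 * (n + 1) = 2 * n + 1 + 1 by ring, sum_range_succ, sum_range_succ, ih,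
      sum_range_succ, add_assoc]

theorem om_two_pow_half (m : ℕ) : om (2 ^ (m + 1)) ^ (2 ^ m) = -1 := by
  have h := om_isPrimitiveRoot (n := 2 ^ (m + 1)) (by positivity)
  have h1 : (om (2 ^ (m + 1)) ^ (2 ^ m)) ^ 2 = 1 := by
    rw [← pow_mul, ← pow_succ, h.pow_eq_one]
  have h2 : om (2 ^ (m + 1)) ^ (2 ^ m) ≠ 1 :=
    h.pow_ne_one_of_pos_of_lt (by positivity) (Nat.pow_lt_pow_right (by omega) (by omega))
  have h3 : (om (2 ^ (m + 1)) ^ (2 ^ m) - 1) * (om (2 ^ (m + 1)) ^ (2 ^ m) + 1) = 0 := by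
    linear_combination h1
  exact eq_neg_of_add_eq_zero_left ((mul_eq_zero.1 h3).resolve_left (sub_ne_zero.2 h2))

/-- `partDft m t a q p` consists of the terms of the `q`-th Fourier coefficient whose index is
congruent to `p` modulo $2^{m-t}$. Splitting `l` by parity breaks the class of `p` modulo $2^r$ into
the classes of `p` and `p + 2 ^ r` modulo $2^{r+1}$. -/
theorem partDft_succ (t r : ℕ) (a : ℕ → ℂ) (q p : ℕ) :
    partDft (t + 1 + r) (t + 1) a q p =
      partDft (t + 1 + r) t a q p + partDft (t + 1 + r) t a q (p + 2 ^ r) := by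
  have e1 : t + 1 + r - (t + 1) = r := by omega
  have e2 : t + 1 + r - t = r + 1 := by omega
  rw [partDft, pow_succ' 2 t, sum_range_two_mul, sum_add_distrib, partDft, partDft, e1, e2]
  congr 1 <;> refine sum_congr rfl fun l _ => ?_
  · rw [show p + 2 ^ r * (2 * l) = p + 2 ^ (r + 1) * l by ring]
  · rw [show p + 2 ^ r * (2 * l + 1) = p + 2 ^ r + 2 ^ (r + 1) * l by ring]

/-- Raising the frequency by $2^t$ multiplies every term of the class of `p` by the same factor
$\omega^{2^tp}$; the terms with odd `l` get in addition $\omega^{2^{t+r}}=-1$. -/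
theorem partDft_succ_add (t r : ℕ) (a : ℕ → ℂ) (q p : ℕ) :
    partDft (t + 1 + r) (t + 1) a (q + 2 ^ t) p =
      (partDft (t + 1 + r) t a q p - partDft (t + 1 + r) t a q (p + 2 ^ r)) *
        om (2 ^ (t + 1 + r)) ^ (2 ^ t * p) := by
  have e1 : t + 1 + r - (t + 1) = r := by omega
  have e2 : t + 1 + r - t = r + 1 := by omega
  have e3 : om (2 ^ (t + 1 + r)) ^ (2 ^ (t + r)) = -1 := by
    rw [show t + 1 + r = t + r + 1 by ring]; exact om_two_pow_half _
  have e4 : ∀ l, om (2 ^ (t + 1 + r)) ^ (2 ^ (t + 1 + r) * l) = 1 := fun l => by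
    rw [pow_mul, (om_isPrimitiveRoot (by positivity)).pow_eq_one, one_pow]
  rw [partDft, pow_succ' 2 t, sum_range_two_mul, sum_add_distrib, partDft, partDft, e1, e2,
    sub_mul, sum_mul, sum_mul, sub_eq_add_neg, ← sum_neg_distrib]
  congr 1 <;> refine sum_congr rfl fun l _ => ?_
  · rw [show p + 2 ^ r * (2 * l) = p + 2 ^ (r + 1) * l by ring,
      show (q + 2 ^ t) * (p + 2 ^ (r + 1) * l) =
        q * (p + 2 ^ (r + 1) * l) + 2 ^ t * p + 2 ^ (t + 1 + r) * l by ring,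
      pow_add, pow_add, e4]
    ring
  · rw [show p + 2 ^ r * (2 * l + 1) = p + 2 ^ r + 2 ^ (r + 1) * l by ring,
      show (q + 2 ^ t) * (p + 2 ^ r + 2 ^ (r + 1) * l) =
        q * (p + 2 ^ r + 2 ^ (r + 1) * l) + 2 ^ t * p + 2 ^ (t + r) + 2 ^ (t + 1 + r) * l by ring,
      pow_add, pow_add, pow_add, e4, e3]
    ring

/-- Used to see that different butterflies write to different cells. -/
theorem mixed_radix_inj {s p p' q q' : ℕ} (hq : q < s) (hq' : q' < s)
    (h : q + s * p = q' + s * p') : q = q' ∧ p = p' := by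
  have h1 : q = q' := by
    have := congrArg (· % s) h
    simpa [Nat.add_mul_mod_self_left, Nat.mod_eq_of_lt, hq, hq'] using this
  subst h1
  exact ⟨rfl, Nat.eq_of_mul_eq_mul_left (by omega) (by omega : s * p = s * p')⟩

/-- The butterflies of one stage; `10` and `11` name the scalar arrays, the integer variables are
the length `10`, its half `11`, the stride `12`, the counter `13 = q + s * p` and `14 = q`,
`15 = s * p`. -/
def butterflies : Prog :=
  .setI 14 0 0 ;; .setI 15 0 0 ;;
  forUp 13 (V 11) (
    .setS 11 (V 13 + V 15) (.get 10 (V 13) + .get 10 (V 13 + V 11)) ;;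
    .setS 11 (V 13 + V 15 + V 12) ((.get 10 (V 13) - .get 10 (V 13 + V 11)) *
      .exp (.piI * .ofNat (V 15 + V 15) / .ofNat (V 10))) ;;
    .setI 14 0 (V 14 + 1) ;;
    .ite (.eq (V 14) (V 12)) (.setI 14 0 0 ;; .setI 15 0 (V 15 + V 12)) .skip)

def fftStage : Prog :=
  butterflies ;;
  forUp 13 (V 10) (.setS 10 (V 13) (.get 11 (V 13))) ;;
  .setI 12 0 (V 12 + V 12)

/-- The discrete Fourier transform of the scalar array `10`, in place. -/
def fft : Prog :=
  .setI 11 0 (.half (V 10)) ;; .setI 12 0 1 ;; .loop (.lt (V 12) (V 10)) fftStage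

/-- Natural numbers can be neither multiplied nor divided, so the digits of the counter `i = q + s *
p` are maintained incrementally: `q` is counted up, and on reaching `s` it is reset while `s * p`
grows by `s`. The output cells are then `i + s * p` and `i + s * p + s`. -/
theorem butterflies_runs {n h s : ℕ} {σ : Store} (hs : 0 < s) (h10 : σ.ints 10 0 = n)
    (h11 : σ.ints 11 0 = h) (h12 : σ.ints 12 0 = s) :
    Runs butterflies σ (110 * (h + 1)) (fun τ => ∀ p q, q < s → q + s * p < h →
      τ.nums 11 (q + 2 * s * p) = σ.nums 10 (q + s * p) + σ.nums 10 (q + s * p + h) ∧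
      τ.nums 11 (q + 2 * s * p + s) =
        (σ.nums 10 (q + s * p) - σ.nums 10 (q + s * p + h)) * om n ^ (s * p)) := by
  have key : ∀ ρ : Store, ρ.ints 10 0 = n → ρ.ints 11 0 = h → ρ.ints 12 0 = s →
      ρ.ints 14 0 = 0 → ρ.ints 15 0 = 0 → ρ.nums = σ.nums → ∀ T, 95 * (h + 1) ≤ T → Runs
        (forUp 13 (V 11) (
    .setS 11 (V 13 + V 15) (.get 10 (V 13) + .get 10 (V 13 + V 11)) ;;
    .setS 11 (V 13 + V 15 + V 12) ((.get 10 (V 13) - .get 10 (V 13 + V 11)) *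
      .exp (.piI * .ofNat (V 15 + V 15) / .ofNat (V 10))) ;;
    .setI 14 0 (V 14 + 1) ;;
    .ite (.eq (V 14) (V 12)) (.setI 14 0 0 ;; .setI 15 0 (V 15 + V 12)) .skip)) ρ T
        (fun τ => ∀ p q, q < s → q + s * p < h →
      τ.nums 11 (q + 2 * s * p) = σ.nums 10 (q + s * p) + σ.nums 10 (q + s * p + h) ∧
      τ.nums 11 (q + 2 * s * p + s) =
        (σ.nums 10 (q + s * p) - σ.nums 10 (q + s * p + h)) * om n ^ (s * p)) := by
    intro ρ r10 r11 r12 r14 r15 rn T hT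
    refine (Runs.forUp_const (n := h) 83 (fun i τ => τ.ints 14 0 = i % s ∧
      τ.ints 15 0 = s * (i / s) ∧ ∀ p q, q < s → q + s * p < i →
      τ.nums 11 (q + 2 * s * p) = σ.nums 10 (q + s * p) + σ.nums 10 (q + s * p + h) ∧
      τ.nums 11 (q + 2 * s * p + s) =
        (σ.nums 10 (q + s * p) - σ.nums 10 (q + s * p + h)) * om n ^ (s * p)) (by decide)
      (by simp [r14, r15]) ?_ ?_).mono ?_ ?_
    · intro τ hF
      have := hF.ints 11 (by decide)
      simp [this, r11]
    · rintro i hi τ hF hv ⟨i14, i15, hI⟩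
      have f10 := hF.ints 10 (by decide)
      have f11 := hF.ints 11 (by decide)
      have f12 := hF.ints 12 (by decide)
      have g10 := hF.nums 10 (by decide)
      refine Runs.flat rfl (by decide) ?_
      have hdm := Nat.mod_add_div i s
      set q0 := i % s with hq0
      set p0 := i / s with hp0
      have hq0s : q0 < s := Nat.mod_lt _ hs
      -- In base `2 * s` the two cells written now have the last digits `q0` and `q0 + s` and the
      -- leading part `p0`; no earlier butterfly shares both, so earlier results survive.
      have hfin : ∀ ρ' : Store, (ρ'.nums 11 = fun j => if j = i + s * p0 + s then
          (σ.nums 10 i - σ.nums 10 (i + h)) * om n ^ (s * p0) else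
          if j = i + s * p0 then σ.nums 10 i + σ.nums 10 (i + h) else τ.nums 11 j) →
          ∀ p q, q < s → q + s * p < i + 1 →
          ρ'.nums 11 (q + 2 * s * p) = σ.nums 10 (q + s * p) + σ.nums 10 (q + s * p + h) ∧
          ρ'.nums 11 (q + 2 * s * p + s) =
            (σ.nums 10 (q + s * p) - σ.nums 10 (q + s * p + h)) * om n ^ (s * p) := by
        intro ρ' hρ' p q hq hlt
        rw [hρ']
        have e0 : i + s * p0 = q0 + 2 * s * p0 := by rw [← hdm]; ring
        have e1 : i + s * p0 + s = (q0 + s) + 2 * s * p0 := by rw [e0]; ring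
        have e2 : q + 2 * s * p + s = (q + s) + 2 * s * p := by ring
        by_cases hc : q = q0 ∧ p = p0
        · rw [hc.1, hc.2, e0, hdm]
          have hne : ¬ (q0 + 2 * s * p0 = q0 + 2 * s * p0 + s) := by omega
          simp only [if_neg hne, if_true, and_self]
        · have hlt' : q + s * p < i := by
            rcases Nat.lt_succ_iff_lt_or_eq.mp hlt with h' | h'
            · exact h'
            · exact absurd (mixed_radix_inj hq hq0s (h'.trans hdm.symm)) hc
          obtain ⟨k1, k2⟩ := hI p q hq hlt'
          have n1 : ¬ (q + 2 * s * p = i + s * p0 + s) := by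
            intro h'; rw [e1] at h'
            have := (mixed_radix_inj (by omega) (by omega) h').1
            omega
          have n2 : ¬ (q + 2 * s * p = i + s * p0) := by
            intro h'; rw [e0] at h'
            exact hc (mixed_radix_inj (by omega) (by omega) h')
          have n3 : ¬ (q + 2 * s * p + s = i + s * p0 + s) := by
            intro h'; exact n2 (by omega)
          have n4 : ¬ (q + 2 * s * p + s = i + s * p0) := by
            intro h'; rw [e0, e2] at h'
            have := (mixed_radix_inj (by omega) (by omega) h').1
            omega
          simp only [if_neg n1, if_neg n2, if_neg n3, if_neg n4]
          exact ⟨k1, k2⟩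
      have hval := exp_eq_om_pow n (s * p0)
      push_cast at hval
      by_cases hc : q0 + 1 = s
      · have hi1 : i + 1 = s * (p0 + 1) := by rw [← hdm, ← hc]; ring
        refine ⟨?_, ?_, hfin _ ?_⟩
        · simp [i14, f12, r12, hc, hi1]
        · simp [i14, f12, r12, hc, hi1, i15, Nat.mul_div_cancel_left _ hs]
          ring
        · funext j
          simp [i14, f10, f11, f12, r12, hc, i15, hv, g10, rn, r11, r10, hval]
      · have hi1 : i + 1 = (q0 + 1) + s * p0 := by rw [← hdm]; ring
        refine ⟨?_, ?_, hfin _ ?_⟩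
        · rw [hi1, Nat.add_mul_mod_self_left]
          simp [i14, f12, r12, hc, Nat.mod_eq_of_lt (by omega : q0 + 1 < s)]
        · rw [hi1, Nat.add_mul_div_left _ _ hs]
          simp [i14, f12, r12, hc, i15, Nat.div_eq_of_lt (by omega : q0 + 1 < s)]
        · funext j
          simp [i14, f10, f11, f12, r12, hc, i15, hv, g10, rn, r11, r10, hval]
    · have : (V 11).cost = 2 := rfl
      rw [this]; omega
    · exact fun τ _ h' => h'.1.2.2
  refine Runs.pre 3 rfl (by decide) (T' := 95 * (h + 1) + 3) (by omega) ?_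
  refine Runs.pre 3 rfl (by decide) (T' := 95 * (h + 1)) (by omega) ?_
  refine key _ ?_ ?_ ?_ ?_ ?_ ?_ (95 * (h + 1)) le_rfl
  all_goals simp [h10, h11, h12]

theorem fftStage_runs {t r : ℕ} {a : ℕ → ℂ} {σ : Store} (h10 : σ.ints 10 0 = 2 ^ (t + 1 + r))
    (h11 : σ.ints 11 0 = 2 ^ (t + r)) (h12 : σ.ints 12 0 = 2 ^ t)
    (hx : ∀ p < 2 ^ (r + 1), ∀ q < 2 ^ t,
      σ.nums 10 (q + 2 ^ t * p) = partDft (t + 1 + r) t a q p) :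
    Runs fftStage σ (200 * 2 ^ (t + 1 + r)) (fun τ => τ.ints 12 0 = 2 ^ (t + 1) ∧
      ∀ p < 2 ^ r, ∀ q < 2 ^ (t + 1),
        τ.nums 10 (q + 2 ^ (t + 1) * p) = partDft (t + 1 + r) (t + 1) a q p) := by
  refine (Runs.seq (butterflies_runs (by positivity) h10 h11 h12)
    (T' := (2 ^ (t + 1 + r) + 1) * 18 + 10) ?_).le ?_
  · intro τ hF h1
    refine Runs.seq (Runs.fillS (n := 2 ^ (t + 1 + r)) 10 0 (τ.nums 11) (by decide) rfl ?_ ?_) ?_ (T' := 10)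
    · intro τ' hF'
      simp [hF'.ints 10 (by decide), hF.ints 10 (by decide), h10]
    · intro k hk τ' hF' hv hj
      funext j
      simp [hv, hF'.nums 11 (by decide)]
    · rintro τ' hF' ⟨h2, -⟩
      refine Runs.flat rfl (by decide) ?_
      have e12 : τ'.ints 12 0 = 2 ^ t := by
        rw [hF'.ints 12 (by decide), hF.ints 12 (by decide), h12]
      refine ⟨by simp [e12]; ring, ?_⟩
      intro p hp q hq
      have hlt : q + 2 ^ (t + 1) * p < 2 ^ (t + 1 + r) := by
        rw [pow_add 2 (t + 1) r]
        calc q + 2 ^ (t + 1) * p < 2 ^ (t + 1) * (p + 1) := by linarith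
          _ ≤ _ := Nat.mul_le_mul_left _ hp
      have e := h2 _ hlt
      simp only [Prog.run, Store.putI_nums]
      rw [zero_add] at e
      rw [e]
      have hb : ∀ q' < 2 ^ t, q' + 2 ^ t * p < 2 ^ (t + r) := by
        intro q' hq'
        rw [pow_add 2 t r]
        calc q' + 2 ^ t * p < 2 ^ t * (p + 1) := by linarith
          _ ≤ _ := Nat.mul_le_mul_left _ hp
      have hxp : ∀ q' < 2 ^ t, σ.nums 10 (q' + 2 ^ t * p) = partDft (t + 1 + r) t a q' p :=
        fun q' hq' => hx p (by rw [pow_succ]; omega) q' hq'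
      have hxp' : ∀ q' < 2 ^ t, σ.nums 10 (q' + 2 ^ t * p + 2 ^ (t + r)) =
          partDft (t + 1 + r) t a q' (p + 2 ^ r) := fun q' hq' => by
        rw [← hx (p + 2 ^ r) (by rw [pow_succ]; omega) q' hq']
        congr 1; ring
      rcases lt_or_ge q (2 ^ t) with hq' | hq'
      · rw [partDft_succ, show 2 ^ (t + 1) * p = 2 * 2 ^ t * p by ring,
          (h1 p q hq' (hb q hq')).1, hxp q hq', hxp' q hq']
      · obtain ⟨q', rfl⟩ := Nat.exists_eq_add_of_le' hq'
        have hq2 : q' < 2 ^ t := by rw [pow_succ] at hq; omega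
        rw [partDft_succ_add, show q' + 2 ^ t + 2 ^ (t + 1) * p = q' + 2 * 2 ^ t * p + 2 ^ t by ring,
          (h1 p q' hq2 (hb q' hq2)).2, hxp q' hq2, hxp' q' hq2]
  · have := Nat.one_le_two_pow (n := t + r)
    rw [show t + 1 + r = t + r + 1 by ring, pow_succ]
    omega

/-- After `t` stages the cell `q + 2 ^ t * p` holds `partDft m t a q p`. For `t = 0` this is the
input and for `t = m` the transform in natural order, so no bit reversal is needed. -/
theorem fft_runs {m : ℕ} {σ : Store} (h10 : σ.ints 10 0 = 2 ^ m) :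
    Runs fft σ (250 * ((m + 1) * 2 ^ m)) (fun τ =>
      ∀ j < 2 ^ m, τ.nums 10 j = dft (2 ^ m) (σ.nums 10) j) := by
  have hpos := Nat.one_le_two_pow (n := m)
  refine Runs.pre 5 rfl (by decide) (T' := 5 + m * (5 + 200 * 2 ^ m) + 5) (by nlinarith) ?_
  refine Runs.pre 3 rfl (by decide) (T' := m * (5 + 200 * 2 ^ m) + 5) (by omega) ?_
  refine (Runs.loop (n := m) (fun _ => 200 * 2 ^ m) (fun t τ => τ.ints 12 0 = 2 ^ t ∧
    ∀ p < 2 ^ (m - t), ∀ q < 2 ^ t, τ.nums 10 (q + 2 ^ t * p) = partDft m t (σ.nums 10) q p)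
    ?_ ?_ ?_).mono ?_ ?_
  · simp [partDft_zero]
  · rintro t ht τ hF ⟨h12, hI⟩
    obtain ⟨r, rfl⟩ : ∃ r, m = t + 1 + r := ⟨m - (t + 1), by omega⟩
    have f10 : τ.ints 10 0 = 2 ^ (t + 1 + r) := by
      rw [hF.ints 10 (by decide)]; simp [h10]
    have f11 : τ.ints 11 0 = 2 ^ (t + r) := by
      rw [hF.ints 11 (by decide)]
      simp [h10, show t + 1 + r = t + r + 1 by ring, pow_succ]
    refine ⟨?_, ?_⟩
    · simp only [Test.holds_lt, IExp.eval, h12, f10]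
      exact Nat.pow_lt_pow_right (by omega) (by omega)
    · rw [show t + 1 + r - t = r + 1 by omega] at hI
      rw [show t + 1 + r - (t + 1) = r by omega]
      exact fftStage_runs f10 f11 h12 hI
  · rintro τ hF ⟨h12, -⟩
    have f10 : τ.ints 10 0 = 2 ^ m := by
      rw [hF.ints 10 (by decide)]; simp [h10]
    simp [h12, f10]
  · have : (Test.lt (V 12) (V 10)).cost = 5 := rfl
    simp [this]
  · rintro τ - ⟨-, h⟩ j hj
    have := h 0 (by simp) j hj
    rw [← partDft_self, ← this]; simp

end FTFI

namespace FTFI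

open Finset

/-! ## Cyclic convolution -/

/-- The cyclic convolution of length `n`. -/
noncomputable def cyc (n : ℕ) (a b : ℕ → ℂ) (k : ℕ) : ℂ :=
  ∑ x ∈ range n, ∑ y ∈ range n, if (x + y) % n = k then a x * b y else 0

theorem cyc_congr {n k : ℕ} {a a' b b' : ℕ → ℂ} (ha : ∀ i < n, a i = a' i)
    (hb : ∀ i < n, b i = b' i) : cyc n a b k = cyc n a' b' k := by
  refine sum_congr rfl fun x hx => sum_congr rfl fun y hy => ?_
  rw [ha x (mem_range.1 hx), hb y (mem_range.1 hy)]

/-- As `x + y < 2 * n`, the only index that can be folded onto `k` is `k + n`; if those products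
vanish, the cyclic convolution is the ordinary one at `k`. -/
theorem cyc_eq_antidiagonal {n k : ℕ} {a b : ℕ → ℂ} (hk : k < n)
    (h : ∀ x < n, ∀ y < n, x + y = k + n → a x * b y = 0) :
    cyc n a b k = ∑ p ∈ antidiagonal k, a p.1 * b p.2 := by
  rw [cyc, ← sum_product', ← sum_filter]
  symm
  refine sum_subset (fun p hp => ?_) fun p hp hp' => ?_
  · rw [HasAntidiagonal.mem_antidiagonal] at hp
    simp only [mem_filter, mem_product, mem_range]
    exact ⟨⟨by omega, by omega⟩, by rw [hp, Nat.mod_eq_of_lt hk]⟩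
  · simp only [mem_filter, mem_product, mem_range] at hp
    rw [HasAntidiagonal.mem_antidiagonal] at hp'
    refine h _ hp.1.1 _ hp.1.2 ?_
    have h1 : p.1 + p.2 < n + n := by omega
    rcases lt_or_ge (p.1 + p.2) n with h2 | h2
    · rw [Nat.mod_eq_of_lt h2] at hp; exact absurd hp.2 hp'
    · rw [Nat.mod_eq_sub_mod h2, Nat.mod_eq_of_lt (by omega)] at hp; omega

theorem dvd_add_sub_iff {n k x : ℕ} (hk : k < n) : n ∣ x + (n - k) ↔ x % n = k := by
  have h : x % n = k ↔ x ≡ k [MOD n] := by rw [Nat.ModEq, Nat.mod_eq_of_lt hk]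
  rw [h, ← Nat.modEq_zero_iff_dvd]
  have h2 : k + (n - k) ≡ 0 [MOD n] := by
    rw [show k + (n - k) = n by omega, Nat.modEq_zero_iff_dvd]
  exact ⟨fun h' => Nat.ModEq.add_right_cancel' (n - k) (h'.trans h2.symm),
    fun h' => (h'.add_right _).trans h2⟩

/-- The inverse transform is the forward transform read at `n - k` and divided by `n`: the exponents
combine to $i(x+y+n-k)$, and the sum over $i$ detects $x+y\equiv k$ modulo $n$. -/
theorem dft_mul_dft {n k : ℕ} (hk : k < n) (a b : ℕ → ℂ) :
    dft n (fun j => dft n b j * dft n a j) (n - k) / n = cyc n a b k := by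
  have hn : (n : ℂ) ≠ 0 := by exact_mod_cast (by omega : n ≠ 0)
  rw [div_eq_iff hn, cyc, sum_mul, dft]
  simp_rw [dft, sum_mul_sum, sum_mul]
  rw [sum_comm]
  simp_rw [fun x => sum_comm (s := range n) (t := range n) (f := fun i j => b x * om n ^ (i * x) *
    (a j * om n ^ (i * j)) * om n ^ ((n - k) * i))]
  rw [sum_comm]
  refine sum_congr rfl fun x _ => sum_congr rfl fun y _ => ?_
  have h : ∀ i, b y * om n ^ (i * y) * (a x * om n ^ (i * x)) * om n ^ ((n - k) * i) =
      a x * b y * om n ^ (i * (x + y + (n - k))) := fun i => by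
    rw [show i * (x + y + (n - k)) = i * x + i * y + (n - k) * i by ring, pow_add, pow_add]
    ring
  simp_rw [h, ← mul_sum, sum_om_pow (by omega : n ≠ 0), dvd_add_sub_iff hk]
  split_ifs <;> simp

/-- Needed for `k = 0`, where the inverse transform is read at the index `n`. -/
theorem dft_self {n : ℕ} (hn : n ≠ 0) (a : ℕ → ℂ) : dft n a n = dft n a 0 := by
  simp [dft, pow_mul, (om_isPrimitiveRoot hn).pow_eq_one]

theorem dft_congr {n j : ℕ} {a a' : ℕ → ℂ} (ha : ∀ i < n, a i = a' i) : dft n a j = dft n a' j :=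
  sum_congr rfl fun x hx => by rw [ha x (mem_range.1 hx)]

/-- The cyclic convolution of the scalar arrays `12` and `13`, with the length in the integer
variable `10`.  The result is written to the array `15`, shifted by one cell. -/
def conv : Prog :=
  forUp 16 (V 10) (.setS 10 (V 16) (.get 12 (V 16))) ;; fft ;;
  forUp 16 (V 10) (.setS 14 (V 16) (.get 10 (V 16))) ;;
  forUp 16 (V 10) (.setS 10 (V 16) (.get 13 (V 16))) ;; fft ;;
  forUp 16 (V 10) (.setS 10 (V 16) (.get 10 (V 16) * .get 14 (V 16))) ;; fft ;;
  (.setS 10 (V 10) (.get 10 0) ;; .setS 15 0 (.ofNat 0)) ;;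
  forUp 16 (V 10) (.setS 15 (V 16 + 1) (.get 10 (V 10 - V 16) / .ofNat (V 10)))

/-- Cell `n` receives a copy of cell 0, so that reading at `n - k` also works for `k = 0`. With the
zero placed in front, the array `15` lists the coefficients of $X$ times the convolution; the
product tree needs exactly this form. -/
theorem conv_runs {m : ℕ} {σ : Store} (h10 : σ.ints 10 0 = 2 ^ m) :
    Runs conv σ (1100 * ((m + 1) * 2 ^ m)) (fun τ => τ.nums 15 0 = 0 ∧
      ∀ k < 2 ^ m, τ.nums 15 (k + 1) = cyc (2 ^ m) (σ.nums 12) (σ.nums 13) k) := by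
  set n := 2 ^ m with hn
  have hn1 : 1 ≤ n := Nat.one_le_two_pow
  refine (Runs.seq (Runs.fillS_zero (n := n) 20 10 (σ.nums 12) (by decide) rfl (by decide)
    (fun τ hF => by simp [hF.ints 10 (by decide), h10])
    (fun k hk τ hF hv _ => by funext j; simp [hv, hF.nums 12 (by decide)])) (T' := _)
    fun τ1 F1 e1 => ?_).le (T := (n + 1) * 20 + (250 * ((m + 1) * n) + ((n + 1) * 20 + ((n + 1) * 20
      + (250 * ((m + 1) * n) + ((n + 1) * 30 + (250 * ((m + 1) * n) + (20 + (n + 1) * 30)))))))) ?_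
  swap
  · have : n ≤ (m + 1) * n := Nat.le_mul_of_pos_left _ (by omega)
    omega
  have h1 : τ1.ints 10 0 = n := by rw [F1.ints 10 (by decide), h10]
  refine Runs.seq (fft_runs h1) fun τ2 F2 e2 => ?_
  have h2 : τ2.ints 10 0 = n := by rw [F2.ints 10 (by decide), h1]
  refine Runs.seq (Runs.fillS_zero (n := n) 20 14 (τ2.nums 10) (by decide) rfl (by decide)
    (fun τ hF => by simp [hF.ints 10 (by decide), h2])
    (fun k hk τ hF hv _ => by funext j; simp [hv, hF.nums 10 (by decide)])) fun τ3 F3 e3 => ?_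
  have h3 : τ3.ints 10 0 = n := by rw [F3.ints 10 (by decide), h2]
  have g3 : τ3.nums 13 = σ.nums 13 := by
    rw [F3.nums 13 (by decide), F2.nums 13 (by decide), F1.nums 13 (by decide)]
  refine Runs.seq (Runs.fillS_zero (n := n) 20 10 (σ.nums 13) (by decide) rfl (by decide)
    (fun τ hF => by simp [hF.ints 10 (by decide), h3])
    (fun k hk τ hF hv _ => by funext j; simp [hv, hF.nums 13 (by decide), g3])) fun τ4 F4 e4 => ?_
  have h4 : τ4.ints 10 0 = n := by rw [F4.ints 10 (by decide), h3]
  refine Runs.seq (fft_runs h4) fun τ5 F5 e5 => ?_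
  have h5 : τ5.ints 10 0 = n := by rw [F5.ints 10 (by decide), h4]
  refine Runs.seq (Runs.fillS_zero (n := n) 30 10 (fun k => τ5.nums 10 k * τ5.nums 14 k)
    (by decide) rfl (by decide)
    (fun τ hF => by simp [hF.ints 10 (by decide), h5])
    (fun k hk τ hF hv hj => by
      funext j; simp [hv, hF.nums 14 (by decide), hj k le_rfl])) fun τ6 F6 e6 => ?_
  have h6 : τ6.ints 10 0 = n := by rw [F6.ints 10 (by decide), h5]
  refine Runs.seq (fft_runs h6) fun τ7 F7 e7 => ?_
  have h7 : τ7.ints 10 0 = n := by rw [F7.ints 10 (by decide), h6]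
  refine Runs.pre 20 rfl (by decide) le_rfl ?_
  set τ8 := (Prog.setS 10 (V 10) (.get 10 0) ;; .setS 15 0 (.ofNat 0)).run τ7 with hτ8
  have h8 : τ8.ints 10 0 = n := by simp [hτ8, h7]
  have g8 : τ8.nums 15 0 = 0 := by simp [hτ8]
  have v5 : ∀ j < n, τ5.nums 10 j = dft n (σ.nums 13) j := fun j hj => by
    rw [e5 j hj]; exact dft_congr e4
  have v6 : ∀ j < n, τ6.nums 10 j = dft n (σ.nums 13) j * dft n (σ.nums 12) j := fun j hj => by
    rw [e6 j hj, v5 j hj, F5.nums 14 (by decide), F4.nums 14 (by decide), e3 j hj, e2 j hj,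
      dft_congr e1]
  have v7 : ∀ j < n, τ7.nums 10 j =
      dft n (fun j => dft n (σ.nums 13) j * dft n (σ.nums 12) j) j := fun j hj => by
    rw [e7 j hj, dft_congr v6]
  have v8 : ∀ j ≤ n, τ8.nums 10 j =
      dft n (fun j => dft n (σ.nums 13) j * dft n (σ.nums 12) j) j := fun j hj => by
    rcases hj.lt_or_eq with h | rfl
    · simp [hτ8, h7, h.ne, v7 j h]
    · rw [dft_self (by omega)]
      simp [hτ8, h7, v7 0 (by omega)]
  refine (Runs.fillS (n := n) 15 1 (cyc n (σ.nums 12) (σ.nums 13)) (by decide) rfl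
    (fun τ hF => by simp [hF.ints 10 (by decide), h8])
    (fun k hk τ hF hv hj => by
      funext j
      simp [hv, hF.ints 10 (by decide), h8, hF.nums 10 (by decide), v8 (n - k) (by omega),
        dft_mul_dft hk, add_comm])).mono ?_ fun τ _ h => ⟨?_, fun k hk => ?_⟩
  · refine Nat.mul_le_mul_left _ (by decide)
  · rw [h.2 0 (by omega), g8]
  · rw [add_comm, h.1 k hk]

end FTFI

namespace FTFI

open Finset PowerSeries

/-! ## Products of linear factors as power series -/

/-- The product of the factors `1 - r i X` over the block `β` of length `2 ^ l`. -/
noncomputable def blockProd (r : ℕ → ℂ) (l β : ℕ) : PowerSeries ℂ :=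
  ∏ i ∈ range (2 ^ l), (1 - C (r (β * 2 ^ l + i)) * X)

/-- The inverse of `blockProd`. -/
noncomputable def blockInv (r : ℕ → ℂ) (l β : ℕ) : PowerSeries ℂ :=
  ∏ i ∈ range (2 ^ l), PowerSeries.mk fun j => r (β * 2 ^ l + i) ^ j

theorem one_sub_mul_geom (r : ℂ) : (1 - C r * X) * (PowerSeries.mk fun j => r ^ j) = 1 := by
  ext k
  rw [sub_mul, one_mul, mul_assoc, map_sub, coeff_C_mul, coeff_mk, coeff_one]
  cases k with
  | zero => simp
  | succ k => rw [coeff_succ_X_mul, coeff_mk]; simp [pow_succ']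

theorem blockProd_mul_blockInv (r : ℕ → ℂ) (l β : ℕ) : blockProd r l β * blockInv r l β = 1 := by
  rw [blockProd, blockInv, ← prod_mul_distrib]
  exact prod_eq_one fun i _ => one_sub_mul_geom _

theorem block_split {M : Type*} [CommMonoid M] (f : ℕ → M) (l β : ℕ) :
    ∏ i ∈ range (2 ^ (l + 1)), f (β * 2 ^ (l + 1) + i) =
      (∏ i ∈ range (2 ^ l), f (2 * β * 2 ^ l + i)) *
        ∏ i ∈ range (2 ^ l), f ((2 * β + 1) * 2 ^ l + i) := by
  rw [show 2 ^ (l + 1) = 2 ^ l + 2 ^ l by ring, prod_range_add]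
  congr 1 <;> refine prod_congr rfl fun i _ => congrArg f (by ring)

theorem blockProd_succ (r : ℕ → ℂ) (l β : ℕ) :
    blockProd r (l + 1) β = blockProd r l (2 * β) * blockProd r l (2 * β + 1) :=
  block_split (fun i => 1 - C (r i) * X) l β

theorem blockInv_succ (r : ℕ → ℂ) (l β : ℕ) :
    blockInv r (l + 1) β = blockInv r l (2 * β) * blockInv r l (2 * β + 1) :=
  block_split (fun i => PowerSeries.mk fun j => r i ^ j) l β

theorem coeff_prod_linear (r : ℕ → ℂ) (n : ℕ) :
    coeff 0 (∏ i ∈ range n, (1 - C (r i) * X)) = 1 ∧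
      ∀ k, n < k → coeff k (∏ i ∈ range n, (1 - C (r i) * X)) = 0 := by
  induction n with
  | zero => simp +contextual [coeff_one, Nat.pos_iff_ne_zero]
  | succ n ih =>
    rw [prod_range_succ]
    refine ⟨by simp [mul_sub], fun k hk => ?_⟩
    obtain ⟨k, rfl⟩ : ∃ k', k = k' + 1 := ⟨k - 1, by omega⟩
    rw [mul_sub, mul_one, map_sub, mul_left_comm, coeff_C_mul, coeff_succ_mul_X,
      ih.2 _ (by omega), ih.2 _ (by omega)]
    simp

theorem coeff_blockProd_zero (r : ℕ → ℂ) (l β : ℕ) : coeff 0 (blockProd r l β) = 1 :=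
  (coeff_prod_linear (fun i => r (β * 2 ^ l + i)) _).1

theorem coeff_blockProd_eq_zero (r : ℕ → ℂ) (l β : ℕ) {k : ℕ} (hk : 2 ^ l < k) :
    coeff k (blockProd r l β) = 0 :=
  (coeff_prod_linear (fun i => r (β * 2 ^ l + i)) _).2 k hk

theorem coeff_one_blockProd (r : ℕ → ℂ) (β : ℕ) : coeff 1 (blockProd r 0 β) = -r β := by
  simp [blockProd, coeff_one]

/-- The coefficients of `(Q - 1) / X`. -/
noncomputable def tailCoeff (Q : PowerSeries ℂ) (j : ℕ) : ℂ := coeff (j + 1) Q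

theorem eq_one_add_X_mul_tailCoeff {Q : PowerSeries ℂ} (h : coeff 0 Q = 1) :
    Q = 1 + X * PowerSeries.mk (tailCoeff Q) := by
  ext k
  cases k with
  | zero => rw [h]; simp
  | succ k => rw [map_add, coeff_succ_X_mul, coeff_mk, tailCoeff, coeff_one]; simp

/-- This is $(1+XA)(1+XB)=1+X(A+B+XAB)$. Leaving the constant coefficient 1 implicit lets a product
of $2^l$ linear factors occupy exactly $2^l$ cells, so that every level of the tree fills $2^m$
cells. -/
theorem tailCoeff_mul {Q R : PowerSeries ℂ} (hQ : coeff 0 Q = 1) (hR : coeff 0 R = 1) (j : ℕ) :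
    tailCoeff (Q * R) j = tailCoeff Q j + tailCoeff R j +
      coeff j (X * (PowerSeries.mk (tailCoeff Q) * PowerSeries.mk (tailCoeff R))) := by
  have h : Q * R = 1 + X * (PowerSeries.mk (tailCoeff Q) + PowerSeries.mk (tailCoeff R) +
      X * (PowerSeries.mk (tailCoeff Q) * PowerSeries.mk (tailCoeff R))) := by
    conv_lhs => rw [eq_one_add_X_mul_tailCoeff hQ, eq_one_add_X_mul_tailCoeff hR]
    ring
  rw [h, tailCoeff, map_add, coeff_succ_X_mul, coeff_one]
  simp

theorem cyc_eq_coeff {n k : ℕ} {a b : ℕ → ℂ} (hk : k < n)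
    (h : ∀ x < n, ∀ y < n, x + y = k + n → a x * b y = 0) :
    cyc n a b k = coeff k (PowerSeries.mk a * PowerSeries.mk b) := by
  rw [cyc_eq_antidiagonal hk h, coeff_mul]
  simp

theorem coeff_mul_congr {k : ℕ} {f f' g g' : PowerSeries ℂ} (hf : ∀ i ≤ k, coeff i f = coeff i f')
    (hg : ∀ i ≤ k, coeff i g = coeff i g') : coeff k (f * g) = coeff k (f' * g') := by
  rw [coeff_mul, coeff_mul]
  refine sum_congr rfl fun p hp => ?_
  rw [HasAntidiagonal.mem_antidiagonal] at hp
  rw [hf _ (by omega), hg _ (by omega)]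

/-- A window of a product in which one factor is short. -/
theorem coeff_mul_window {S k d : ℕ} {a : ℕ → ℂ} {f : PowerSeries ℂ} (ha : ∀ x, S ≤ x → a x = 0)
    (hk : S ≤ k + 1) :
    coeff (k + d) (PowerSeries.mk a * f) =
      coeff k (PowerSeries.mk a * PowerSeries.mk fun y => coeff (y + d) f) := by
  -- As `k + 1` is at least `S`, the coefficient `k` uses all of the short factor, and it uses `g`
  -- only at indices from `k + 1 - S` to `k`; hence a shift of `g` is harmless.
  have key : ∀ (g : PowerSeries ℂ) (k : ℕ), S ≤ k + 1 →
      coeff k (PowerSeries.mk a * g) = ∑ x ∈ range S, a x * coeff (k - x) g := by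
    intro g k hk
    rw [coeff_mul, Finset.Nat.sum_antidiagonal_eq_sum_range_succ
      (fun x y => coeff x (PowerSeries.mk a) * coeff y g)]
    symm
    refine sum_subset (range_subset_range.2 hk) (fun x _ hx => ?_) |>.trans ?_
    · rw [ha x (by simpa using hx), zero_mul]
    · exact sum_congr rfl fun x _ => by rw [coeff_mk]
  rw [key _ _ (by omega), key _ _ hk]
  refine sum_congr rfl fun x hx => ?_
  rw [mem_range] at hx
  rw [coeff_mk, show k + d - x = k - x + d by omega]

/-- The error is squared: $G-g(2-gQ)=Q(G-g)^2$ because $QG=1$. -/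
theorem newton_step {Q G g : PowerSeries ℂ} (hQ : Q * G = 1) {s : ℕ}
    (hg : ∀ k < s, coeff k g = coeff k G) {k : ℕ} (hk : k < 2 * s) :
    coeff k (g * (2 - g * Q)) = coeff k G := by
  have h1 : X ^ s ∣ G - g := X_pow_dvd_iff.2 fun m hm => by rw [map_sub, hg m hm, sub_self]
  have h2 : X ^ (2 * s) ∣ G - g * (2 - g * Q) := by
    have e : G - g * (2 - g * Q) = Q * ((G - g) * (G - g)) := by
      linear_combination (2 * g - G) * hQ
    rw [e, two_mul, pow_add]
    exact Dvd.dvd.mul_left (mul_dvd_mul h1 h1) _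
  have h3 := X_pow_dvd_iff.1 h2 k hk
  rw [map_sub] at h3
  exact (sub_eq_zero.1 h3).symm

end FTFI

namespace FTFI

open Finset PowerSeries

/-! ## Multiplication by a Vandermonde matrix

The integer variables are the numbers `20` and `21` of rows and columns, the length `22 = 2 ^ m`,
the block length `23`, the start `24` of the current level of the product tree, the start `25`
of the current block in that level and the counter `26`.  The scalar arrays are the
nodes `20`, the coefficients `21`, the product tree `22`, the inverse of its root `23` and the
current remainders `24`. -/

/-- Fill the scalar array `B` by the values of `e` where `b` holds and by zeros elsewhere. -/
def loadPad (B : ℕ) (b : Test) (e : SExp) : Prog :=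
  forUp 26 (V 10) (.ite b (.setS B (V 26) e) (.setS B (V 26) (.ofNat 0)))

/-- In this form the source may be the array `B` itself, since the cells from `k` on are still
unchanged when the cell `k` is written. -/
theorem loadPad_runs_self {B : ℕ} {b : Test} {e : SExp} {σ : Store} {n : ℕ} (c : ℕ) (a : ℕ → ℂ)
    (hc : b.cost + (e.cost + 8) + 12 ≤ c) (h10 : σ.ints 10 0 = n)
    (h : ∀ k < n, ∀ τ : Store, (∀ A, A ≠ 26 → τ.ints A = σ.ints A) →
      (∀ A, A ≠ B → τ.nums A = σ.nums A) → τ.ints 26 0 = k →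
      (∀ j, k ≤ j → τ.nums B j = σ.nums B j) →
      (if b.Holds τ then e.eval τ else 0) = a k) :
    Runs (loadPad B b e) σ ((n + 1) * c) (fun τ => ∀ k < n, τ.nums B k = a k) := by
  refine Runs.fillS_zero c B a (by simp [Prog.wI]) rfl ?_ (fun τ hF => ?_)
    (fun k hk τ hF hv hj => ?_)
  · simp only [Prog.bound, IExp.cost, SExp.cost]; omega
  · have := hF.ints 10 (by simp [forUp, Prog.wI])
    simp [this, h10]
  · have := h k hk τ (fun A hA => hF.ints A (by simp [forUp, Prog.wI, hA]))
      (fun A hA => hF.nums A (by simp [forUp, Prog.wS, hA])) hv hj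
    rw [← this]
    funext j
    by_cases hb : b.Holds τ <;> simp [hb, hv]

theorem loadPad_runs {B : ℕ} {b : Test} {e : SExp} {σ : Store} {n : ℕ} (c : ℕ) (a : ℕ → ℂ)
    (hc : b.cost + (e.cost + 8) + 12 ≤ c) (h10 : σ.ints 10 0 = n)
    (h : ∀ k < n, ∀ τ : Store, (∀ A, A ≠ 26 → τ.ints A = σ.ints A) →
      (∀ A, A ≠ B → τ.nums A = σ.nums A) → τ.ints 26 0 = k →
      (if b.Holds τ then e.eval τ else 0) = a k) :
    Runs (loadPad B b e) σ ((n + 1) * c) (fun τ => ∀ k < n, τ.nums B k = a k) :=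
  loadPad_runs_self c a hc h10 fun k hk τ h1 h2 h3 _ => h k hk τ h1 h2 h3

/-- Write the values of `e` into the cells from `o` on of the scalar array `B`. -/
def storeS (B : ℕ) (x o : IExp) (e : SExp) : Prog :=
  forUp 26 x (.setS B (o + V 26) e)

theorem storeS_runs {B : ℕ} {x o : IExp} {e : SExp} {σ : Store} {n p : ℕ} (c : ℕ) (f : ℕ → ℂ)
    (hc : o.cost + e.cost + x.cost + 14 ≤ c)
    (hx : ∀ τ : Store, (∀ A, A ≠ 26 → τ.ints A = σ.ints A) → x.eval τ = n ∧ o.eval τ = p)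
    (h : ∀ k < n, ∀ τ : Store, (∀ A, A ≠ 26 → τ.ints A = σ.ints A) →
      (∀ A, A ≠ B → τ.nums A = σ.nums A) → τ.ints 26 0 = k →
      (∀ j, j < p ∨ p + k ≤ j → τ.nums B j = σ.nums B j) → e.eval τ = f k) :
    Runs (storeS B x o e) σ ((n + 1) * c) (fun τ => (∀ k < n, τ.nums B (p + k) = f k) ∧
      ∀ j, j < p ∨ p + n ≤ j → τ.nums B j = σ.nums B j) := by
  refine (Runs.fillS B p f (by simp [Prog.wI]) rfl (fun τ hF => ?_)
    (fun k hk τ hF hv hj => ?_)).le (Nat.mul_le_mul_left _ ?_)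
  · exact (hx τ (fun A hA => hF.ints A (by simp [forUp, Prog.wI, hA]))).1
  · have hI : ∀ A, A ≠ 26 → τ.ints A = σ.ints A :=
      fun A hA => hF.ints A (by simp [forUp, Prog.wI, hA])
    have := h k hk τ hI (fun A hA => hF.nums A (by simp [forUp, Prog.wS, hA])) hv hj
    rw [← this]
    funext j
    simp [hv, (hx τ hI).2]
  · have : (o + V 26).cost = o.cost + 3 := by
      change 1 + o.cost + 2 = _; omega
    simp only [Prog.bound, this]; omega

def productBlock : Prog :=
  loadPad 12 (.lt (V 26) (V 23)) (.get 22 (V 24 + V 25 + V 26)) ;;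
  loadPad 13 (.lt (V 26) (V 23)) (.get 22 (V 24 + V 25 + V 23 + V 26)) ;;
  conv ;;
  storeS 22 (V 10) (V 24 + V 22 + V 25)
    (.get 12 (V 26) + .get 13 (V 26) + .get 15 (V 26)) ;;
  .setI 25 0 (V 25 + V 10)

def productLevel : Prog :=
  (.setI 10 0 (V 23 + V 23) ;; .setI 25 0 0) ;;
  .loop (.lt (V 25) (V 22)) productBlock ;;
  (.setI 23 0 (V 23 + V 23) ;; .setI 24 0 (V 24 + V 22))

/-- Compute the product tree from its leaves. -/
def productTree : Prog :=
  (.setI 23 0 1 ;; .setI 24 0 0) ;;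
  .loop (.lt (V 23) (V 22)) productLevel

/-- The values of `f` on an initial segment, continued by zero. -/
noncomputable def trunc' (n : ℕ) (f : ℕ → ℂ) (k : ℕ) : ℂ := if k < n then f k else 0

theorem mk_trunc'_tailCoeff {Q : PowerSeries ℂ} {n : ℕ} (hQ : ∀ k, n < k → coeff k Q = 0) :
    trunc' n (tailCoeff Q) = tailCoeff Q := by
  funext k
  rw [trunc', tailCoeff]
  split_ifs with h
  · rfl
  · rw [hQ _ (by omega)]

/-- Both tails have degree less than $2^l$, so a convolution of length $2^{l+1}$ does not wrap
around, and the shift in the array `15` supplies the factor $X$ of `tailCoeff_mul`. -/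
theorem productBlock_runs {σ : Store} {l off b n : ℕ} {Q R : PowerSeries ℂ}
    (h10 : σ.ints 10 0 = 2 ^ (l + 1)) (h22 : σ.ints 22 0 = n) (h23 : σ.ints 23 0 = 2 ^ l)
    (h24 : σ.ints 24 0 = off) (h25 : σ.ints 25 0 = b)
    (hQ0 : coeff 0 Q = 1) (hR0 : coeff 0 R = 1) (hQ : ∀ k, 2 ^ l < k → coeff k Q = 0)
    (hR : ∀ k, 2 ^ l < k → coeff k R = 0)
    (hTQ : ∀ j < 2 ^ l, σ.nums 22 (off + b + j) = tailCoeff Q j)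
    (hTR : ∀ j < 2 ^ l, σ.nums 22 (off + b + 2 ^ l + j) = tailCoeff R j) :
    Runs productBlock σ (2000 * ((l + 2) * 2 ^ (l + 1))) (fun τ =>
      τ.ints 25 0 = b + 2 ^ (l + 1) ∧
      (∀ j < 2 ^ (l + 1), τ.nums 22 (off + n + b + j) = tailCoeff (Q * R) j) ∧
      ∀ j, j < off + n + b ∨ off + n + b + 2 ^ (l + 1) ≤ j → τ.nums 22 j = σ.nums 22 j) := by
  set S2 := 2 ^ (l + 1) with hS2
  have hS : S2 = 2 * 2 ^ l := by rw [hS2]; ring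
  have hS1 : 1 ≤ S2 := Nat.one_le_two_pow
  refine (Runs.seq (loadPad_runs 40 (tailCoeff Q) (by decide) h10 ?_) (T' := _)
    fun τ1 F1 e1 => ?_).le (T := (S2 + 1) * 40 + ((S2 + 1) * 40 + (1100 * ((l + 1 + 1) * S2) +
      ((S2 + 1) * 40 + 20)))) ?_
  · intro k hk τ hI hS hv
    rw [← mk_trunc'_tailCoeff hQ, trunc']
    simp only [Test.holds_lt, IExp.eval, SExp.eval, hv, hI 23 (by simp), h23]
    split_ifs with h
    · rw [hI 24 (by simp), hI 25 (by simp), hS 22 (by simp), h24, h25, hTQ k h]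
    · rfl
  swap
  · have : S2 ≤ (l + 1 + 1) * S2 := Nat.le_mul_of_pos_left _ (by omega)
    rw [show l + 2 = l + 1 + 1 by rfl]
    omega
  refine Runs.seq (loadPad_runs (n := S2) 40 (tailCoeff R) (by decide) ?_ ?_) fun τ2 F2 e2 => ?_
  · rw [F1.ints 10 (by decide), h10]
  · intro k hk τ hI hS hv
    rw [← mk_trunc'_tailCoeff hR, trunc']
    simp only [Test.holds_lt, IExp.eval, SExp.eval, hv, hI 23 (by simp),
      F1.ints 23 (by decide), h23]
    split_ifs with h
    · rw [hI 24 (by simp), hI 25 (by simp), hS 22 (by simp), F1.ints 24 (by decide),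
        F1.ints 25 (by decide), F1.nums 22 (by decide), h24, h25, hTR k h]
    · rfl
  have e1' : ∀ k < S2, τ2.nums 12 k = tailCoeff Q k := fun k hk => by
    rw [F2.nums 12 (by decide), e1 k hk]
  have tQ : ∀ k, 2 ^ l ≤ k → tailCoeff Q k = 0 := fun k hk => hQ _ (by omega)
  have tR : ∀ k, 2 ^ l ≤ k → tailCoeff R k = 0 := fun k hk => hR _ (by omega)
  refine Runs.seq (conv_runs (m := l + 1) ?_) fun τ3 F3 e3 => ?_
  · rw [F2.ints 10 (by decide), F1.ints 10 (by decide), h10]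
  have hI3 : ∀ A ∈ ([10, 22, 23, 24, 25] : List ℕ), τ3.ints A = σ.ints A := by
    intro A hA
    fin_cases hA <;>
      rw [F3.ints _ (by decide), F2.ints _ (by decide), F1.ints _ (by decide)]
  have e22 : τ3.nums 22 = σ.nums 22 := by
    rw [F3.nums _ (by decide), F2.nums _ (by decide), F1.nums _ (by decide)]
  have e4 : ∀ j < S2, τ3.nums 15 j =
      coeff j (X * (PowerSeries.mk (tailCoeff Q) * PowerSeries.mk (tailCoeff R))) := by
    intro j hj
    cases j with
    | zero => rw [e3.1]; simp
    | succ j =>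
      rw [e3.2 j (by omega), coeff_succ_X_mul, cyc_congr e1' e2]
      refine cyc_eq_coeff (by omega) fun x hx y hy hxy => ?_
      rcases lt_or_ge x (2 ^ l) with h | h
      · rw [tR y (by omega), mul_zero]
      · rw [tQ x h, zero_mul]
  refine Runs.seq (storeS_runs (n := S2) (p := off + n + b) 40 (tailCoeff (Q * R)) (by decide)
    ?_ ?_) (T' := 20) fun τ4 F4 e5 => ?_
  · intro τ hI
    simp [hI, hI3, h10, h22, h24, h25]
  · intro k hk τ hI hS hv _
    rw [tailCoeff_mul hQ0 hR0]
    simp only [SExp.eval, IExp.eval, hv]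
    rw [hS 12 (by simp), hS 13 (by simp), hS 15 (by simp), e4 k hk, F3.nums 12 (by decide), e1' k hk,
      F3.nums 13 (by decide), e2 k hk]
  refine Runs.flat rfl (by decide) ⟨?_, ?_, ?_⟩
  · simp [F4.ints 25 (by decide), F4.ints 10 (by decide), hI3, h25, h10]
  · exact e5.1
  · intro j hj
    rw [← e22]; exact e5.2 j hj

/-- The levels up to `L` of the product tree are stored in `T`. -/
def TreeStored (r : ℕ → ℂ) (m L : ℕ) (T : ℕ → ℂ) : Prop :=
  ∀ l ≤ L, ∀ β < 2 ^ (m - l), ∀ j < 2 ^ l,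
    T (l * 2 ^ m + β * 2 ^ l + j) = tailCoeff (blockProd r l β) j

/-- Writing $m=l+1+d$, the level has $2^d$ blocks of cost $O((l+2)2^{l+1})$, in total $O((l+2)2^m)$.
The new level is stored right behind the old one, which is still needed on the way down. -/
theorem productLevel_runs {σ : Store} {m l : ℕ} {r : ℕ → ℂ} (hl : l < m)
    (h22 : σ.ints 22 0 = 2 ^ m) (h23 : σ.ints 23 0 = 2 ^ l) (h24 : σ.ints 24 0 = l * 2 ^ m)
    (hT : TreeStored r m l (σ.nums 22)) :
    Runs productLevel σ (2100 * ((m + 1) * 2 ^ m)) (fun τ =>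
      τ.ints 23 0 = 2 ^ (l + 1) ∧ τ.ints 24 0 = (l + 1) * 2 ^ m ∧
      TreeStored r m (l + 1) (τ.nums 22)) := by
  obtain ⟨d, rfl⟩ : ∃ d, m = l + 1 + d := ⟨m - (l + 1), by omega⟩
  set m := l + 1 + d with hm
  have hpow : 2 ^ m = 2 ^ d * 2 ^ (l + 1) := by rw [hm]; ring
  have hpos := Nat.one_le_two_pow (n := l + 1)
  have hposd := Nat.one_le_two_pow (n := d)
  have hposm := Nat.one_le_two_pow (n := m)
  refine Runs.pre 10 rfl (by decide) (T' := (2 ^ d * (5 + 2000 * ((l + 2) * 2 ^ (l + 1))) + 5) + 20)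
    ?_ ?_
  · have h1 : 2 ^ d * (5 + 2000 * ((l + 2) * 2 ^ (l + 1))) = 5 * 2 ^ d + 2000 * ((l + 2) * 2 ^ m) := by
      rw [hpow]; ring
    have h2 : 2 ^ d ≤ 2 ^ m := Nat.pow_le_pow_right (by omega) (by omega)
    have h3 : (l + 2) * 2 ^ m ≤ (m + 1) * 2 ^ m := Nat.mul_le_mul_right _ (by omega)
    have h4 : 2 ^ m ≤ (m + 1) * 2 ^ m := Nat.le_mul_of_pos_left _ (by omega)
    omega
  set τ0 := (Prog.setI 10 0 (V 23 + V 23) ;; .setI 25 0 0).run σ with hτ0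
  have a10 : τ0.ints 10 0 = 2 ^ (l + 1) := by simp [hτ0, h23]; ring
  have a22 : τ0.ints 22 0 = 2 ^ m := by simp [hτ0, h22]
  have a23 : τ0.ints 23 0 = 2 ^ l := by simp [hτ0, h23]
  have a24 : τ0.ints 24 0 = l * 2 ^ m := by simp [hτ0, h24]
  refine Runs.seq (Runs.loop (n := 2 ^ d) (fun _ => 2000 * ((l + 2) * 2 ^ (l + 1)))
    (fun k τ => τ.ints 25 0 = k * 2 ^ (l + 1) ∧
      (∀ j < (l + 1) * 2 ^ m, τ.nums 22 j = σ.nums 22 j) ∧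
      ∀ β < k, ∀ j < 2 ^ (l + 1), τ.nums 22 ((l + 1) * 2 ^ m + β * 2 ^ (l + 1) + j) =
        tailCoeff (blockProd r (l + 1) β) j) ?_ ?_ ?_ |>.le ?_) fun τ1 F1 e1 => ?_
  · simp [hτ0]
  · rintro k hk τ F ⟨i25, iT, iN⟩
    have hk1 : (k + 1) * 2 ^ (l + 1) ≤ 2 ^ m := by
      rw [hpow]; exact Nat.mul_le_mul_right _ hk
    have c22 : τ.ints 22 0 = 2 ^ m := by rw [F.ints 22 (by decide), a22]
    have hold : ∀ β < 2 ^ (d + 1), ∀ j < 2 ^ l, τ.nums 22 (l * 2 ^ m + β * 2 ^ l + j) =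
        tailCoeff (blockProd r l β) j := by
      intro β hβ j hj
      have : l * 2 ^ m + β * 2 ^ l + j < (l + 1) * 2 ^ m := by
        have : (β + 1) * 2 ^ l ≤ 2 ^ m := by
          rw [hpow, show 2 ^ d * 2 ^ (l + 1) = 2 ^ (d + 1) * 2 ^ l by ring]
          exact Nat.mul_le_mul_right _ hβ
        rw [add_mul] at this ⊢; omega
      rw [iT _ this]
      exact hT l le_rfl β (by rw [hm, show l + 1 + d - l = d + 1 by omega]; exact hβ) j hj
    refine ⟨?_, ?_⟩
    · simp only [Test.holds_lt, IExp.eval, i25, c22]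
      rw [add_mul] at hk1; omega
    refine (productBlock_runs (Q := blockProd r l (2 * k)) (R := blockProd r l (2 * k + 1))
      (by rw [F.ints 10 (by decide), a10]) c22 (by rw [F.ints 23 (by decide), a23])
      (by rw [F.ints 24 (by decide), a24]) i25 (coeff_blockProd_zero _ _ _)
      (coeff_blockProd_zero _ _ _) (fun _ => coeff_blockProd_eq_zero _ _ _)
      (fun _ => coeff_blockProd_eq_zero _ _ _) ?_ ?_).mono le_rfl ?_
    · intro j hj
      rw [show k * 2 ^ (l + 1) = 2 * k * 2 ^ l by ring]
      exact hold _ (by rw [pow_succ]; omega) j hj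
    · intro j hj
      rw [show l * 2 ^ m + k * 2 ^ (l + 1) + 2 ^ l = l * 2 ^ m + (2 * k + 1) * 2 ^ l by ring]
      exact hold _ (by rw [pow_succ]; omega) j hj
    · rintro τ' - ⟨g1, g2, g3⟩
      refine ⟨by rw [g1]; ring, fun j hj => ?_, fun β hβ j hj => ?_⟩
      · rw [g3 j (Or.inl (by rw [add_mul] at hj; omega)), iT j hj]
      · rw [show l * 2 ^ m + 2 ^ m = (l + 1) * 2 ^ m by ring] at g2 g3
        rcases Nat.lt_succ_iff_lt_or_eq.mp hβ with h | rfl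
        · have : (β + 1) * 2 ^ (l + 1) ≤ k * 2 ^ (l + 1) := Nat.mul_le_mul_right _ h
          rw [add_mul] at this
          rw [g3 _ (Or.inl (by omega)), iN β h j hj]
        · rw [g2 j hj, blockProd_succ]
  · rintro τ F ⟨i25, -⟩
    simp [i25, F.ints 22 (by decide), a22, hpow]
  · have : (Test.lt (V 25) (V 22)).cost = 5 := rfl
    simp [this]
  · have c22 : τ1.ints 22 0 = 2 ^ m := by rw [F1.ints 22 (by decide), a22]
    refine Runs.flat rfl (by decide) ⟨?_, ?_, ?_⟩
    · simp [F1.ints 23 (by decide), a23]; ring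
    · simp [F1.ints 24 (by decide), a24, c22]; ring
    · intro l' hl' β hβ j hj
      simp only [Prog.run, Store.putI_nums]
      rcases hl'.lt_or_eq with h | rfl
      · have h2 : (β + 1) * 2 ^ l' ≤ 2 ^ m := by
          rw [show m = m - l' + l' by omega, pow_add]
          exact Nat.mul_le_mul_right _ hβ
        have h3 : (l' + 1) * 2 ^ m ≤ (l + 1) * 2 ^ m := Nat.mul_le_mul_right _ h
        rw [e1.2.1 _ (by rw [add_mul] at h2 h3; omega)]
        exact hT l' (by omega) β hβ j hj
      · exact e1.2.2 β (by rw [hm, show l + 1 + d - (l + 1) = d by omega] at hβ; exact hβ) j hj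

/-- The leaf of $1-rX$ is its tail coefficient $-r$. The final value of the variable `24` is the
start of the root, from which the inversion and the descent set out. -/
theorem productTree_runs {σ : Store} {m : ℕ} {r : ℕ → ℂ} (h22 : σ.ints 22 0 = 2 ^ m)
    (hT : ∀ i < 2 ^ m, σ.nums 22 i = -r i) :
    Runs productTree σ (2200 * ((m + 1) ^ 2 * 2 ^ m)) (fun τ =>
      τ.ints 24 0 = m * 2 ^ m ∧ TreeStored r m m (τ.nums 22)) := by
  have hposm := Nat.one_le_two_pow (n := m)
  refine Runs.pre 10 rfl (by decide) (T' := m * (5 + 2100 * ((m + 1) * 2 ^ m)) + 5) ?_ ?_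
  · nlinarith [Nat.zero_le (m * 2 ^ m), Nat.zero_le (m * m * 2 ^ m)]
  refine (Runs.loop (n := m) (fun _ => 2100 * ((m + 1) * 2 ^ m)) (fun l τ =>
    τ.ints 23 0 = 2 ^ l ∧ τ.ints 24 0 = l * 2 ^ m ∧ TreeStored r m l (τ.nums 22)) ?_ ?_ ?_).mono
    ?_ fun τ _ h => h.2
  · refine ⟨by simp, by simp, ?_⟩
    intro l hl β hβ j hj
    obtain rfl : l = 0 := by omega
    obtain rfl : j = 0 := by simpa using hj
    simp only [Prog.run, Store.putI_nums, tailCoeff, zero_add, coeff_one_blockProd]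
    simpa using hT β (by simpa using hβ)
  · rintro l hl τ F ⟨i23, i24, iT⟩
    have c22 : τ.ints 22 0 = 2 ^ m := by rw [F.ints 22 (by decide)]; simp [h22]
    refine ⟨?_, productLevel_runs hl c22 i23 i24 iT⟩
    simp only [Test.holds_lt, IExp.eval, i23, c22]
    exact Nat.pow_lt_pow_right (by omega) hl
  · rintro τ F ⟨i23, -⟩
    simp [i23, F.ints 22 (by decide), h22]
  · have : (Test.lt (V 23) (V 22)).cost = 5 := rfl
    simp [this]

end FTFI

/-! ### Inversion of the root of the product tree by Newton iteration -/

namespace FTFI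

open Finset PowerSeries

def newtonStep : Prog :=
  .setI 10 0 (V 23 + V 23 + (V 23 + V 23)) ;;
  loadPad 12 (.lt (V 26) (V 23)) (.get 23 (V 26)) ;;
  loadPad 13 (.lt (V 26) (V 23 + V 23)) (.get 22 (V 24 + V 26 - 1)) ;;
  .setS 13 0 (.ofNat 1) ;;
  conv ;;
  loadPad 13 (.lt (V 26) (V 23 + V 23)) (.ofNat 0 - .get 15 (V 26 + 1)) ;;
  .setS 13 0 (.get 13 0 + .ofNat 2) ;;
  conv ;;
  storeS 23 (V 23 + V 23) 0 (.get 15 (V 26 + 1)) ;;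
  .setI 23 0 (V 23 + V 23)

/-- Invert the root of the product tree as a power series. -/
def newton : Prog :=
  (.setS 23 0 (.ofNat 1) ;; .setI 23 0 1) ;;
  .loop (.lt (V 23) (V 22)) newtonStep

/-- One factor of each convolution has `s` coefficients and the other `2 * s`, so products stay
below index `3 * s` and the length `4 * s` prevents wrapping. Truncating the second factor at `2 *
s` does not affect the coefficients below `2 * s`. -/
theorem newtonStep_runs {σ : Store} {t off : ℕ} {Q G : PowerSeries ℂ}
    (h23 : σ.ints 23 0 = 2 ^ t) (h24 : σ.ints 24 0 = off)
    (hQ0 : coeff 0 Q = 1) (hQG : Q * G = 1)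
    (hT : ∀ j < 2 ^ (t + 1), σ.nums 22 (off + j) = tailCoeff Q j)
    (hg : ∀ k < 2 ^ t, σ.nums 23 k = coeff k G) :
    Runs newtonStep σ (3000 * ((t + 3) * 2 ^ (t + 2))) (fun τ => τ.ints 23 0 = 2 ^ (t + 1) ∧
      ∀ k < 2 ^ (t + 1), τ.nums 23 k = coeff k G) := by
  set s := 2 ^ t with hs
  have hs1 : 1 ≤ s := Nat.one_le_two_pow
  have e2s : 2 ^ (t + 1) = s + s := by rw [hs]; ring
  have e4s : 2 ^ (t + 2) = 4 * s := by rw [hs]; ring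
  rw [e2s] at hT ⊢
  rw [e4s]
  have hle : 4 * s ≤ (t + 3) * (4 * s) := Nat.le_mul_of_pos_left _ (by omega)
  refine Runs.pre (T' := (4 * s + 1) * 40 + ((4 * s + 1) * 50 + (10 + (1100 * ((t + 3) * (4 * s)) +
    ((4 * s + 1) * 50 + (10 + (1100 * ((t + 3) * (4 * s)) + ((s + s + 1) * 50 + 10))))))))
    20 rfl (by decide) (by omega) ?_
  set τ0 := (Prog.setI 10 0 (V 23 + V 23 + (V 23 + V 23))).run σ with hτ0
  have a10 : τ0.ints 10 0 = 4 * s := by simp [hτ0, h23]; ring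
  have a23 : τ0.ints 23 0 = s := by simp [hτ0, h23]
  have a24 : τ0.ints 24 0 = off := by simp [hτ0, h24]
  have an : τ0.nums = σ.nums := rfl
  refine Runs.seq (loadPad_runs (n := 4 * s) 40 (trunc' s fun k => coeff k G) (by decide) a10 ?_)
    fun τ1 F1 e1 => ?_
  · intro k hk τ hI hS hv
    simp only [Test.holds_lt, IExp.eval, SExp.eval, hv, hI 23 (by simp), a23, trunc']
    split_ifs with h
    · rw [hS 23 (by simp), an, hg k h]
    · rfl
  -- The root is stored without its constant coefficient, so its coefficient `k` lies in the cell
  -- `off + k - 1`. The value loaded for `k = 0` is meaningless and is overwritten by 1 right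
  -- afterwards.
  refine Runs.seq (loadPad_runs (n := 4 * s) 50
    (fun k => if k < s + s then σ.nums 22 (off + k - 1) else 0) (by decide) ?_ ?_) fun τ2 F2 e2 => ?_
  · rw [F1.ints 10 (by decide), a10]
  · intro k hk τ hI hS hv
    simp [hv, hI 23, hI 24, F1.ints 23 (by decide), F1.ints 24 (by decide), a23, a24,
      hS 22, F1.nums 22 (by decide), an]
  refine Runs.pre 10 rfl (by decide) le_rfl ?_
  set τ3 := (Prog.setS 13 0 (.ofNat 1)).run τ2 with hτ3
  have b12 : ∀ k < 4 * s, τ3.nums 12 k = trunc' s (fun k => coeff k G) k := fun k hk => by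
    rw [← e1 k hk, ← F2.nums 12 (by decide)]; simp [hτ3]
  have b13 : ∀ k < 4 * s, τ3.nums 13 k = trunc' (s + s) (fun k => coeff k Q) k := fun k hk => by
    simp only [hτ3, Prog.run, Store.putS_nums, IExp.eval_lit, SExp.eval, true_and, trunc']
    cases k with
    | zero => rw [if_pos rfl, if_pos (by omega), hQ0]; simp
    | succ k =>
      rw [if_neg (by omega), e2 _ hk]
      split_ifs with h
      · rw [show off + (k + 1) - 1 = off + k by omega, hT k (by omega)]; rfl
      · rfl
  have b10 : τ3.ints 10 0 = 4 * s := by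
    rw [← a10, ← F1.ints 10 (by decide), ← F2.ints 10 (by decide)]; rfl
  have b23 : τ3.ints 23 0 = s := by
    rw [← a23, ← F1.ints 23 (by decide), ← F2.ints 23 (by decide)]; rfl
  refine Runs.seq (conv_runs (m := t + 2) (by rw [b10, e4s]) |>.le (by rw [e4s])) fun τ4 F4 e4 => ?_
  rw [e4s] at e4
  have hwrap : ∀ f g : ℕ → ℂ, ∀ k, ∀ x < 4 * s, ∀ y < 4 * s, x + y = k + 4 * s →
      trunc' s f x * trunc' (s + s) g y = 0 := by
    intro f g k x _ y _ hxy
    rw [trunc', trunc']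
    split_ifs with h1 h2 <;> first | omega | simp
  set g := PowerSeries.mk (trunc' s fun k => coeff k G) with hgdef
  have c15 : ∀ k < s + s, τ4.nums 15 (k + 1) = coeff k (g * Q) := fun k hk => by
    rw [e4.2 k (by omega), cyc_congr b12 b13, cyc_eq_coeff (by omega) (hwrap _ _ k)]
    refine coeff_mul_congr (fun i _ => rfl) fun i hi => ?_
    rw [coeff_mk, trunc', if_pos (by omega)]
  have c10 : τ4.ints 10 0 = 4 * s := by rw [F4.ints 10 (by decide), b10]
  have c23 : τ4.ints 23 0 = s := by rw [F4.ints 23 (by decide), b23]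
  refine Runs.seq (loadPad_runs (n := 4 * s) 50 (trunc' (s + s) fun k => - coeff k (g * Q))
    (by decide) c10 ?_) fun τ5 F5 e5 => ?_
  · intro k hk τ hI hS hv
    simp only [Test.holds_lt, IExp.eval, SExp.eval, hv, hI 23 (by simp), c23, trunc',
      SExp.eval_sub', hS 15 (by simp)]
    split_ifs with h
    · rw [c15 k h]; simp
    · rfl
  refine Runs.pre 10 rfl (by decide) le_rfl ?_
  set τ6 := (Prog.setS 13 0 (.get 13 0 + .ofNat 2)).run τ5 with hτ6
  have d12 : ∀ k < 4 * s, τ6.nums 12 k = trunc' s (fun k => coeff k G) k := fun k hk => by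
    rw [← b12 k hk, ← F4.nums 12 (by decide), ← F5.nums 12 (by decide)]; simp [hτ6]
  have d13 : ∀ k < 4 * s, τ6.nums 13 k = trunc' (s + s) (fun k => coeff k (2 - g * Q)) k :=
      fun k hk => by
    have h2 : (2 : PowerSeries ℂ) = C 2 := (map_ofNat C 2).symm
    simp only [hτ6, Prog.run, Store.putS_nums, IExp.eval_lit, SExp.eval, true_and, trunc',
      map_sub]
    rw [h2, coeff_C]
    cases k with
    | zero => 
      have := e5 0 (by omega)
      rw [trunc', if_pos (by omega)] at this
      rw [if_pos rfl, if_pos (by omega), this]; simp; ring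
    | succ k =>
      rw [if_neg (by omega), e5 _ hk, trunc', if_neg (by omega : ¬ k + 1 = 0)]
      simp
  have d10 : τ6.ints 10 0 = 4 * s := by
    rw [← c10, ← F5.ints 10 (by decide)]; rfl
  have d23 : τ6.ints 23 0 = s := by
    rw [← c23, ← F5.ints 23 (by decide)]; rfl
  refine Runs.seq (conv_runs (m := t + 2) (by rw [d10, e4s]) |>.le (by rw [e4s])) fun τ7 F7 e7 => ?_
  rw [e4s] at e7
  have f23 : τ7.ints 23 0 = s := by rw [F7.ints 23 (by decide), d23]
  have hnew : ∀ k < s + s, τ7.nums 15 (k + 1) = coeff k G := fun k hk => by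
    rw [e7.2 k (by omega), cyc_congr d12 d13, cyc_eq_coeff (by omega) (hwrap _ _ k),
      ← newton_step hQG (s := s) (g := g) (fun i hi => by
        rw [hgdef, coeff_mk, trunc', if_pos hi]) (by omega : k < 2 * s)]
    refine coeff_mul_congr (fun i _ => rfl) fun i hi => ?_
    rw [coeff_mk, trunc', if_pos (by omega)]
  refine Runs.seq (storeS_runs (n := s + s) (p := 0) 50 (fun k => coeff k G) (by decide) ?_ ?_)
    fun τ8 F8 e8 => ?_
  · intro τ hI
    simp [hI, f23]
  · intro k hk τ hI hS hv _
    simp [hv, hS, hnew k hk]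
  refine Runs.flat rfl (by decide) ⟨?_, ?_⟩
  · simp [F8.ints 23 (by decide), f23]
  · simpa using e8.1

/-- Every step is charged at the rate of the last one. The sum would be geometric, but the product
tree costs $m^22^m$ anyway. -/
theorem newton_runs {σ : Store} {m off : ℕ} {Q G : PowerSeries ℂ}
    (h22 : σ.ints 22 0 = 2 ^ m) (h24 : σ.ints 24 0 = off)
    (hQ0 : coeff 0 Q = 1) (hQG : Q * G = 1)
    (hT : ∀ j < 2 ^ m, σ.nums 22 (off + j) = tailCoeff Q j) :
    Runs newton σ (13000 * ((m + 2) ^ 2 * 2 ^ m)) (fun τ =>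
      ∀ k < 2 ^ m, τ.nums 23 k = coeff k G) := by
  have hposm := Nat.one_le_two_pow (n := m)
  refine Runs.pre 20 rfl (by decide) (T' := m * (5 + 12000 * ((m + 2) * 2 ^ m)) + 5) ?_ ?_
  · nlinarith [Nat.zero_le (m * 2 ^ m), Nat.zero_le (m * m * 2 ^ m)]
  refine (Runs.loop (n := m) (fun _ => 12000 * ((m + 2) * 2 ^ m)) (fun t τ =>
    τ.ints 23 0 = 2 ^ t ∧ ∀ k < 2 ^ t, τ.nums 23 k = coeff k G) ?_ ?_ ?_).mono
    ?_ fun τ _ h => h.2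
  · refine ⟨by simp, ?_⟩
    intro k hk
    obtain rfl : k = 0 := by simpa using hk
    have h1 := congrArg constantCoeff hQG
    have h2 : constantCoeff Q = 1 := by simpa using hQ0
    rw [map_mul, h2, one_mul] at h1
    simp [h1]
  · rintro t ht τ F ⟨i23, iT⟩
    have c22 : τ.ints 22 0 = 2 ^ m := by rw [F.ints 22 (by decide)]; simp [h22]
    have c24 : τ.ints 24 0 = off := by rw [F.ints 24 (by decide)]; simp [h24]
    refine ⟨?_, (newtonStep_runs i23 c24 hQ0 hQG (fun j hj => ?_) iT).le ?_⟩
    · simp only [Test.holds_lt, IExp.eval, i23, c22]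
      exact Nat.pow_lt_pow_right (by omega) ht
    · rw [F.nums 22 (by decide), ← hT j (hj.trans_le (Nat.pow_le_pow_right (by omega) ht))]
      simp
    · have h1 : 2 ^ (t + 1) ≤ 2 ^ m := Nat.pow_le_pow_right (by omega) ht
      have h2 : (t + 3) * 2 ^ (t + 1) ≤ (m + 2) * 2 ^ m := Nat.mul_le_mul (by omega) h1
      have h3 : (t + 3) * 2 ^ (t + 2) = 2 * ((t + 3) * 2 ^ (t + 1)) := by ring
      omega
  · rintro τ F ⟨i23, -⟩
    simp [i23, F.ints 22 (by decide), h22]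
  · have : (Test.lt (V 23) (V 22)).cost = 5 := rfl
    simp [this]

end FTFI

/-! ### Descent from the root to the leaves by middle products -/

namespace FTFI

open Finset PowerSeries

def downBlock : Prog :=
  loadPad 13 (.lt (V 26) (V 10)) (.get 24 (V 25 + V 26)) ;;
  loadPad 12 (.lt (V 26) (V 23)) (.get 22 (V 24 + V 25 + V 23 + V 26)) ;;
  conv ;;
  storeS 24 (V 23) (V 25) (.get 13 (V 23 + V 26) + .get 15 (V 23 + V 26)) ;;
  loadPad 12 (.lt (V 26) (V 23)) (.get 22 (V 24 + V 25 + V 26)) ;;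
  conv ;;
  storeS 24 (V 23) (V 25 + V 23) (.get 13 (V 23 + V 26) + .get 15 (V 23 + V 26)) ;;
  .setI 25 0 (V 25 + V 10)

def downLevel : Prog :=
  (.setI 10 0 (V 23) ;; .setI 23 0 (.half (V 23)) ;; .setI 24 0 (V 24 - V 22) ;; .setI 25 0 0) ;;
  .loop (.lt (V 25) (V 22)) downBlock

/-- Pass from the root to the leaves of the product tree. -/
def goDown : Prog :=
  .setI 23 0 (V 22) ;;
  .loop (.lt 1 (V 23)) downLevel

/-- With $R=1+XA$ and $A$ of degree less than $S$, the coefficients of $FR$ from $d+S$ on involve no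
coefficient of $F$ below $d$. So a window of $F$ of length $2S$ determines the upper half of the
same window of $FR$. -/
theorem coeff_mul_of_window {F R : PowerSeries ℂ} {S d v : ℕ} (hS : 0 < S) (hR0 : coeff 0 R = 1)
    (hR : ∀ k, S < k → coeff k R = 0) :
    coeff (d + S + v) (F * R) = coeff (d + S + v) F +
      coeff (S + v - 1) (PowerSeries.mk (tailCoeff R) *
        PowerSeries.mk fun y => coeff (y + d) F) := by
  have h : F * R = F + X * (PowerSeries.mk (tailCoeff R) * F) := by
    conv_lhs => rw [eq_one_add_X_mul_tailCoeff hR0]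
    ring
  rw [h, map_add, show d + S + v = (S + v - 1) + d + 1 by omega, coeff_succ_X_mul,
    coeff_mul_window (S := S) (a := tailCoeff R) (fun x hx => hR _ (by omega)) (by omega)]

/-- `F` is the series of the parent block. The left child receives `F` times the product `R` of the
right block and the right child `F` times `Q`; each keeps the upper half of the window of the
parent, so the two results together fill its cells. -/
theorem downBlock_runs {σ : Store} {l off b d : ℕ} {Q R F : PowerSeries ℂ}
    (h10 : σ.ints 10 0 = 2 ^ (l + 1)) (h23 : σ.ints 23 0 = 2 ^ l)
    (h24 : σ.ints 24 0 = off) (h25 : σ.ints 25 0 = b)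
    (hQ0 : coeff 0 Q = 1) (hR0 : coeff 0 R = 1) (hQ : ∀ k, 2 ^ l < k → coeff k Q = 0)
    (hR : ∀ k, 2 ^ l < k → coeff k R = 0)
    (hTQ : ∀ j < 2 ^ l, σ.nums 22 (off + b + j) = tailCoeff Q j)
    (hTR : ∀ j < 2 ^ l, σ.nums 22 (off + b + 2 ^ l + j) = tailCoeff R j)
    (hF : ∀ j < 2 ^ (l + 1), σ.nums 24 (b + j) = coeff (d + j) F) :
    Runs downBlock σ (3000 * ((l + 2) * 2 ^ (l + 1))) (fun τ =>
      τ.ints 25 0 = b + 2 ^ (l + 1) ∧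
      (∀ j < 2 ^ l, τ.nums 24 (b + j) = coeff (d + 2 ^ l + j) (F * R)) ∧
      (∀ j < 2 ^ l, τ.nums 24 (b + 2 ^ l + j) = coeff (d + 2 ^ l + j) (F * Q)) ∧
      ∀ j, j < b ∨ b + 2 ^ (l + 1) ≤ j → τ.nums 24 j = σ.nums 24 j) := by
  set S2 := 2 ^ (l + 1) with hS2
  have hSS : S2 = 2 * 2 ^ l := by rw [hS2]; ring
  set S := 2 ^ l with hSdef
  have hS1 : 1 ≤ S := Nat.one_le_two_pow
  have hle : S2 ≤ (l + 2) * S2 := Nat.le_mul_of_pos_left _ (by omega)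
  have tQ : ∀ k, S ≤ k → tailCoeff Q k = 0 := fun k hk => hQ _ (by omega)
  have tR : ∀ k, S ≤ k → tailCoeff R k = 0 := fun k hk => hR _ (by omega)
  refine (Runs.seq (loadPad_runs 40 (fun y => coeff (y + d) F) (by decide) h10 ?_) (T' := _)
    fun τ1 F1 e1 => ?_).le (T := (S2 + 1) * 40 + ((S2 + 1) * 40 + (1100 * ((l + 2) * S2) +
      ((S + 1) * 40 + ((S2 + 1) * 40 + (1100 * ((l + 2) * S2) + ((S + 1) * 40 + 20))))))) (by omega)
  · intro k hk τ hI hS hv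
    simp only [Test.holds_lt, IExp.eval, SExp.eval, hv, hI 10 (by simp), h10, if_pos hk]
    rw [hI 25 (by simp), hS 24 (by simp), h25, hF k hk, add_comm]
  refine Runs.seq (loadPad_runs (n := S2) 40 (tailCoeff R) (by decide) ?_ ?_) fun τ2 F2 e2 => ?_
  · rw [F1.ints 10 (by decide), h10]
  · intro k hk τ hI hS hv
    rw [← mk_trunc'_tailCoeff hR, trunc']
    simp only [Test.holds_lt, IExp.eval, SExp.eval, hv, hI 23 (by simp),
      F1.ints 23 (by decide), h23]
    split_ifs with h
    · rw [hI 24 (by simp), hI 25 (by simp), hS 22 (by simp), F1.ints 24 (by decide),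
        F1.ints 25 (by decide), F1.nums 22 (by decide), h24, h25, hTR k h]
    · rfl
  -- A cyclic convolution of length `2 * S` is enough although the full product is longer: as the
  -- first factor ends before `S`, wrapping reaches only positions below `S - 1`, and none of them
  -- is read.
  have hwin : ∀ {U : PowerSeries ℂ}, coeff 0 U = 1 → (∀ k, S < k → coeff k U = 0) →
      ∀ {a b' : ℕ → ℂ}, (∀ k < S2, a k = tailCoeff U k) → (∀ k < S2, b' k = coeff (k + d) F) →
      ∀ j < S, coeff (d + S + j) (F * U) = coeff (d + S + j) F + cyc S2 a b' (S + j - 1) := by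
    intro U hU0 hU a b' ha hb j hj
    have tU : ∀ k, S ≤ k → tailCoeff U k = 0 := fun k hk => hU _ (by omega)
    rw [coeff_mul_of_window hS1 hU0 hU, cyc_congr ha hb, cyc_eq_coeff (by omega)]
    intro x hx y hy hxy
    rw [tU x (by omega), zero_mul]
  have e1' : ∀ k < S2, τ2.nums 13 k = coeff (k + d) F := fun k hk => by
    rw [F2.nums 13 (by decide), e1 k hk]
  refine Runs.seq (conv_runs (m := l + 1) ?_) fun τ3 F3 e3 => ?_
  · rw [F2.ints 10 (by decide), F1.ints 10 (by decide), h10]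
  have hI3 : ∀ A ∈ ([10, 22, 23, 24, 25] : List ℕ), τ3.ints A = σ.ints A := by
    intro A hA
    fin_cases hA <;>
      rw [F3.ints _ (by decide), F2.ints _ (by decide), F1.ints _ (by decide)]
  refine Runs.seq (storeS_runs (n := S) (p := b) 40 (fun j => coeff (d + S + j) (F * R)) (by decide)
    ?_ ?_) fun τ4 F4 e4 => ?_
  · intro τ hI
    simp [hI, hI3, h23, h25]
  · intro k hk τ hI hS hv _
    rw [hwin hR0 hR e2 e1' k hk]
    simp only [SExp.eval, IExp.eval, hv, hI 23 (by simp), hI3 23 (by simp), h23]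
    rw [hS 13 (by simp), hS 15 (by simp), F3.nums 13 (by decide), e1' _ (by omega),
      show S + k = S + k - 1 + 1 by omega, e3.2 _ (by omega),
      show S + k - 1 + 1 + d = d + S + k by omega]
    rfl
  have hI4 : ∀ A ∈ ([10, 22, 23, 24, 25] : List ℕ), τ4.ints A = σ.ints A := by
    intro A hA
    rw [← hI3 A hA]
    fin_cases hA <;> exact F4.ints _ (by decide)
  refine Runs.seq (loadPad_runs (n := S2) 40 (tailCoeff Q) (by decide) ?_ ?_) fun τ5 F5 e5 => ?_
  · rw [hI4 10 (by simp), h10]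
  · intro k hk τ hI hS hv
    rw [← mk_trunc'_tailCoeff hQ, trunc']
    simp only [Test.holds_lt, IExp.eval, SExp.eval, hv, hI 23 (by simp), hI4 23 (by simp), h23]
    split_ifs with h
    · rw [hI 24 (by simp), hI 25 (by simp), hS 22 (by simp), hI4 24 (by simp), hI4 25 (by simp),
        F4.nums 22 (by decide), F3.nums 22 (by decide), F2.nums 22 (by decide),
        F1.nums 22 (by decide), h24, h25, hTQ k h]
    · rfl
  have e5' : ∀ k < S2, τ5.nums 13 k = coeff (k + d) F := fun k hk => by
    rw [F5.nums 13 (by decide), F4.nums 13 (by decide), F3.nums 13 (by decide), e1' k hk]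
  refine Runs.seq (conv_runs (m := l + 1) ?_) fun τ6 F6 e6 => ?_
  · rw [F5.ints 10 (by decide), hI4 10 (by simp), h10]
  have hI6 : ∀ A ∈ ([10, 22, 23, 24, 25] : List ℕ), τ6.ints A = σ.ints A := by
    intro A hA
    rw [← hI4 A hA]
    fin_cases hA <;> rw [F6.ints _ (by decide), F5.ints _ (by decide)]
  refine Runs.seq (storeS_runs (n := S) (p := b + S) 40 (fun j => coeff (d + S + j) (F * Q))
    (by decide) ?_ ?_) fun τ7 F7 e7 => ?_
  · intro τ hI
    simp [hI, hI6, h23, h25]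
  · intro k hk τ hI hS hv _
    rw [hwin hQ0 hQ e5 e5' k hk]
    simp only [SExp.eval, IExp.eval, hv, hI 23 (by simp), hI6 23 (by simp), h23]
    rw [hS 13 (by simp), hS 15 (by simp), F6.nums 13 (by decide), e5' _ (by omega),
      show S + k = S + k - 1 + 1 by omega, e6.2 _ (by omega),
      show S + k - 1 + 1 + d = d + S + k by omega]
    rfl
  have hn6 : τ6.nums 24 = τ4.nums 24 := by
    rw [F6.nums 24 (by decide), F5.nums 24 (by decide)]
  refine Runs.flat rfl (by decide) ⟨?_, ?_, ?_, ?_⟩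
  · simp [F7.ints 25 (by decide), F7.ints 10 (by decide), hI6, h25, h10]
  · intro j hj
    simp only [Prog.run, Store.putI_nums]
    rw [e7.2 _ (Or.inl (by omega)), hn6, e4.1 j hj]
  · exact e7.1
  · intro j hj
    simp only [Prog.run, Store.putI_nums]
    rw [e7.2 _ (by omega), hn6, e4.2 j (by omega), F3.nums 24 (by decide), F2.nums 24 (by decide),
      F1.nums 24 (by decide)]

/-- The windows of the series `R` divided by the products over the blocks of level `l`. -/
def LevelStored (r : ℕ → ℂ) (R : PowerSeries ℂ) (m l : ℕ) (D : ℕ → ℂ) : Prop :=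
  ∀ β < 2 ^ (m - l), ∀ j < 2 ^ l,
    D (β * 2 ^ l + j) = coeff (2 ^ m - 2 ^ l + j) (R * blockInv r l β)

/-- The inverse over a block is the product of the inverses over its halves; the product over one
half cancels its inverse and leaves the other. -/
theorem mul_blockInv_left (r : ℕ → ℂ) (R : PowerSeries ℂ) (l β : ℕ) :
    R * blockInv r (l + 1) β * blockProd r l (2 * β + 1) = R * blockInv r l (2 * β) := by
  rw [blockInv_succ]
  linear_combination R * blockInv r l (2 * β) * blockProd_mul_blockInv r l (2 * β + 1)

theorem mul_blockInv_right (r : ℕ → ℂ) (R : PowerSeries ℂ) (l β : ℕ) :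
    R * blockInv r (l + 1) β * blockProd r l (2 * β) = R * blockInv r l (2 * β + 1) := by
  rw [blockInv_succ]
  linear_combination R * blockInv r l (2 * β + 1) * blockProd_mul_blockInv r l (2 * β)

/-- All windows end at the coefficient $2^m-1$. The windows of level $l+1$ start at $2^m-2^{l+1}$,
and their upper halves start at $2^m-2^l$, where the windows of level $l$ begin. -/
theorem downLevel_runs {σ : Store} {m l : ℕ} {r : ℕ → ℂ} {R : PowerSeries ℂ} (hl : l < m)
    (h22 : σ.ints 22 0 = 2 ^ m) (h23 : σ.ints 23 0 = 2 ^ (l + 1))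
    (h24 : σ.ints 24 0 = (l + 1) * 2 ^ m)
    (hT : TreeStored r m m (σ.nums 22)) (hD : LevelStored r R m (l + 1) (σ.nums 24)) :
    Runs downLevel σ (3100 * ((m + 1) * 2 ^ m)) (fun τ =>
      τ.ints 23 0 = 2 ^ l ∧ τ.ints 24 0 = l * 2 ^ m ∧ LevelStored r R m l (τ.nums 24)) := by
  obtain ⟨d, rfl⟩ : ∃ d, m = l + 1 + d := ⟨m - (l + 1), by omega⟩
  set m := l + 1 + d with hm
  have hpow : 2 ^ m = 2 ^ d * 2 ^ (l + 1) := by rw [hm]; ring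
  have hpos := Nat.one_le_two_pow (n := l)
  have hl1 : 2 ^ (l + 1) = 2 * 2 ^ l := by ring
  have hlm : 2 ^ (l + 1) ≤ 2 ^ m := Nat.pow_le_pow_right (by omega) (by omega)
  rw [LevelStored, show m - (l + 1) = d by omega] at hD
  refine Runs.pre 30 rfl (by decide) (T' := (2 ^ d * (5 + 3000 * ((l + 2) * 2 ^ (l + 1))) + 5))
    ?_ ?_
  · have h1 : 2 ^ d * (5 + 3000 * ((l + 2) * 2 ^ (l + 1))) = 5 * 2 ^ d + 3000 * ((l + 2) * 2 ^ m) := by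
      rw [hpow]; ring
    have h2 : 2 ^ d ≤ 2 ^ m := Nat.pow_le_pow_right (by omega) (by omega)
    have h3 : (l + 2) * 2 ^ m ≤ (m + 1) * 2 ^ m := Nat.mul_le_mul_right _ (by omega)
    have h4 : 2 ^ m ≤ (m + 1) * 2 ^ m := Nat.le_mul_of_pos_left _ (by omega)
    omega
  set τ0 := (Prog.setI 10 0 (V 23) ;; .setI 23 0 (.half (V 23)) ;; .setI 24 0 (V 24 - V 22) ;;
    .setI 25 0 0).run σ with hτ0
  have a10 : τ0.ints 10 0 = 2 ^ (l + 1) := by simp [hτ0, h23]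
  have a22 : τ0.ints 22 0 = 2 ^ m := by simp [hτ0, h22]
  have a23 : τ0.ints 23 0 = 2 ^ l := by simp [hτ0, h23, hl1]
  have a24 : τ0.ints 24 0 = l * 2 ^ m := by simp [hτ0, h24, h22, add_mul]
  refine (Runs.loop (n := 2 ^ d) (fun _ => 3000 * ((l + 2) * 2 ^ (l + 1)))
    (fun k τ => τ.ints 25 0 = k * 2 ^ (l + 1) ∧
      (∀ j, k * 2 ^ (l + 1) ≤ j → τ.nums 24 j = σ.nums 24 j) ∧
      ∀ β < k, ∀ j < 2 ^ l, 
        τ.nums 24 (2 * β * 2 ^ l + j) =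
          coeff (2 ^ m - 2 ^ l + j) (R * blockInv r l (2 * β)) ∧
        τ.nums 24 ((2 * β + 1) * 2 ^ l + j) =
          coeff (2 ^ m - 2 ^ l + j) (R * blockInv r l (2 * β + 1))) ?_ ?_ ?_).mono ?_
        fun τ1 F1 e1 => ?_
  · simp [hτ0]
  · rintro k hk τ F ⟨i25, iD, iN⟩
    have hk1 : (k + 1) * 2 ^ (l + 1) ≤ 2 ^ m := by
      rw [hpow]; exact Nat.mul_le_mul_right _ hk
    have c22 : τ.ints 22 0 = 2 ^ m := by rw [F.ints 22 (by decide), a22]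
    refine ⟨?_, ?_⟩
    · simp only [Test.holds_lt, IExp.eval, i25, c22]
      rw [add_mul] at hk1; omega
    have hT' : ∀ β < 2 ^ (d + 1), ∀ j < 2 ^ l, τ.nums 22 (l * 2 ^ m + β * 2 ^ l + j) =
        tailCoeff (blockProd r l β) j := by
      intro β hβ j hj
      rw [F.nums 22 (by decide)]
      exact hT l (by omega) β (by rw [hm, show l + 1 + d - l = d + 1 by omega]; exact hβ) j hj
    refine (downBlock_runs (d := 2 ^ m - 2 ^ (l + 1)) (F := R * blockInv r (l + 1) k)
      (Q := blockProd r l (2 * k)) (R := blockProd r l (2 * k + 1))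
      (by rw [F.ints 10 (by decide), a10]) (by rw [F.ints 23 (by decide), a23])
      (by rw [F.ints 24 (by decide), a24]) i25 (coeff_blockProd_zero _ _ _)
      (coeff_blockProd_zero _ _ _) (fun _ => coeff_blockProd_eq_zero _ _ _)
      (fun _ => coeff_blockProd_eq_zero _ _ _) ?_ ?_ ?_).mono le_rfl ?_
    · intro j hj
      rw [show k * 2 ^ (l + 1) = 2 * k * 2 ^ l by ring]
      exact hT' _ (by rw [pow_succ]; omega) j hj
    · intro j hj
      rw [show l * 2 ^ m + k * 2 ^ (l + 1) + 2 ^ l = l * 2 ^ m + (2 * k + 1) * 2 ^ l by ring]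
      exact hT' _ (by rw [pow_succ]; omega) j hj
    · intro j hj
      rw [iD _ (by omega), hD k hk j hj]
    · rintro τ' - ⟨g1, g2, g3, g4⟩
      rw [mul_blockInv_left] at g2
      rw [mul_blockInv_right] at g3
      rw [show 2 ^ m - 2 ^ (l + 1) + 2 ^ l = 2 ^ m - 2 ^ l by omega] at g2 g3
      refine ⟨by rw [g1]; ring, fun j hj => ?_, fun β hβ j hj => ?_⟩
      · rw [add_mul] at hj
        rw [g4 j (Or.inr (by omega)), iD j (by omega)]
      · rcases Nat.lt_succ_iff_lt_or_eq.mp hβ with h | rfl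
        · have h5 : (β + 1) * 2 ^ (l + 1) ≤ k * 2 ^ (l + 1) := Nat.mul_le_mul_right _ h
          have h6 : (2 * β + 1) * 2 ^ l + 2 ^ l = (β + 1) * 2 ^ (l + 1) := by ring
          have h7 : 2 * β * 2 ^ l ≤ (2 * β + 1) * 2 ^ l := Nat.mul_le_mul_right _ (by omega)
          rw [g4 _ (Or.inl (by omega)), g4 _ (Or.inl (by omega))]
          exact iN β h j hj
        · rw [show β * 2 ^ (l + 1) = 2 * β * 2 ^ l by ring] at g2 g3
          rw [show 2 * β * 2 ^ l + 2 ^ l = (2 * β + 1) * 2 ^ l by ring] at g3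
          exact ⟨g2 j hj, g3 j hj⟩
  · rintro τ F ⟨i25, -⟩
    simp [i25, F.ints 22 (by decide), a22, hpow]
  · have : (Test.lt (V 25) (V 22)).cost = 5 := rfl
    simp [this]
  · refine ⟨by rw [F1.ints 23 (by decide), a23], by rw [F1.ints 24 (by decide), a24], ?_⟩
    intro β hβ j hj
    rw [show m - l = d + 1 by omega, pow_succ] at hβ
    have := e1.2.2 (β / 2) (by omega) j hj
    rcases Nat.mod_two_eq_zero_or_one β with h | h
    · rw [show 2 * (β / 2) = β by omega] at this; exact this.1
    · rw [show 2 * (β / 2) + 1 = β by omega] at this; exact this.2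

/-- At the root the window is everything below $X^{2^m}$; at a leaf it has shrunk to the single
coefficient $2^m-1$ of $R/(1-r_iX)$, which is the wanted value. -/
theorem goDown_runs {σ : Store} {m : ℕ} {r : ℕ → ℂ} {R : PowerSeries ℂ}
    (h22 : σ.ints 22 0 = 2 ^ m) (h24 : σ.ints 24 0 = m * 2 ^ m)
    (hT : TreeStored r m m (σ.nums 22))
    (hD : ∀ j < 2 ^ m, σ.nums 24 j = coeff j (R * blockInv r m 0)) :
    Runs goDown σ (3200 * ((m + 1) ^ 2 * 2 ^ m)) (fun τ =>
      ∀ i < 2 ^ m, τ.nums 24 i = coeff (2 ^ m - 1) (R * PowerSeries.mk fun j => r i ^ j)) := by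
  have hposm := Nat.one_le_two_pow (n := m)
  refine Runs.pre 10 rfl (by decide) (T' := m * (4 + 3100 * ((m + 1) * 2 ^ m)) + 4) ?_ ?_
  · nlinarith [Nat.zero_le (m * 2 ^ m), Nat.zero_le (m * m * 2 ^ m)]
  refine (Runs.loop (n := m) (fun _ => 3100 * ((m + 1) * 2 ^ m)) (fun k τ =>
    τ.ints 23 0 = 2 ^ (m - k) ∧ τ.ints 24 0 = (m - k) * 2 ^ m ∧
      LevelStored r R m (m - k) (τ.nums 24)) ?_ ?_ ?_).mono ?_ fun τ _ h => ?_
  · refine ⟨by simp [h22], by simp [h24], ?_⟩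
    intro β hβ j hj
    obtain rfl : β = 0 := by simpa using hβ
    simpa using hD j (by simpa using hj)
  · rintro k hk τ F ⟨i23, i24, iT⟩
    have c22 : τ.ints 22 0 = 2 ^ m := by rw [F.ints 22 (by decide)]; simp [h22]
    rw [show m - k = m - (k + 1) + 1 by omega] at i23 i24 iT
    refine ⟨?_, downLevel_runs (by omega) c22 i23 i24 ?_ iT⟩
    · have := Nat.one_le_two_pow (n := m - (k + 1))
      simp only [Test.holds_lt, IExp.eval, i23, pow_succ]
      omega
    · rw [F.nums 22 (by decide)]; exact hT
  · rintro τ F ⟨i23, -⟩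
    simp [i23]
  · have : (Test.lt 1 (V 23)).cost = 4 := rfl
    simp [this]
  · intro i hi
    have := h.2.2 i (by simpa using hi) 0 (by simp)
    simpa [blockInv] using this

end FTFI

/-! ### Evaluation at all nodes -/

namespace FTFI

open Finset PowerSeries

/-- Set the integer variable `A` to the least power of two that is not below the variable `B`. -/
def ceilPow (A B : ℕ) : Prog :=
  .setI A 0 1 ;; .loop (.lt (V A) (V B)) (.setI A 0 (V A + V A))

theorem ceilPow_runs {A B x : ℕ} {σ : Store} (hAB : B ≠ A) (hx : σ.ints B 0 = x) :
    Runs (ceilPow A B) σ (20 * (Nat.clog 2 x + 1))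
      (fun τ => τ.ints A 0 = 2 ^ Nat.clog 2 x) := by
  refine Runs.pre 3 rfl (show (3 : ℕ) ≤ 3 from le_rfl) (T' := Nat.clog 2 x * (5 + 8) + 5)
    (by omega) ?_
  refine (Runs.loop (n := Nat.clog 2 x) (fun _ => 8) (fun k τ => τ.ints A 0 = 2 ^ k)
    (by simp) ?_ ?_).mono ?_ fun τ _ h => h
  · intro k hk τ F hI
    have hB : τ.ints B 0 = x := by rw [F.ints B (by simp [Prog.wI, hAB])]; simp [hAB, hx]
    refine ⟨?_, Runs.flat rfl (show (7 : ℕ) ≤ 8 by omega) (by simp [hI, pow_succ, mul_two])⟩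
    simpa [hI, hB] using (Nat.lt_clog_iff_pow_lt (by omega)).1 hk
  · intro τ F hI
    have hB : τ.ints B 0 = x := by rw [F.ints B (by simp [Prog.wI, hAB])]; simp [hAB, hx]
    simpa [hI, hB] using Nat.le_pow_clog (by omega) x
  · have : (Test.lt (V A) (V B)).cost = 5 := rfl
    simp [this]

theorem two_pow_clog_le {x : ℕ} (hx : 0 < x) : 2 ^ Nat.clog 2 x ≤ 2 * x := by
  rcases Nat.lt_or_ge 1 x with h | h
  · have h1 := Nat.pow_pred_clog_lt_self (b := 2) (by omega) h
    have h2 : 0 < Nat.clog 2 x := Nat.clog_pos (by omega) h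
    rw [show Nat.clog 2 x = (Nat.clog 2 x).pred + 1 by
      simp only [Nat.pred_eq_sub_one]; omega, pow_succ]
    omega
  · rw [Nat.clog_of_right_le_one h]; simp; omega

def rootVec : Prog :=
  .setI 10 0 (V 22 + V 22) ;;
  loadPad 12 (.lt (V 26) (V 22)) (.get 23 (V 26)) ;;
  loadPad 13 (.lt (V 26) (V 22)) (.get 21 (V 22 - 1 - V 26)) ;;
  conv ;;
  storeS 24 (V 22) 0 (.get 15 (V 26 + 1))

/-- Knowing the inverse modulo $X^{2^m}$ suffices, because only the coefficients below $2^m$ of the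
product are kept; the double length avoids wrapping. -/
theorem rootVec_runs {σ : Store} {m : ℕ} {G : PowerSeries ℂ} {c : ℕ → ℂ}
    (h22 : σ.ints 22 0 = 2 ^ m) (hG : ∀ k < 2 ^ m, σ.nums 23 k = coeff k G)
    (hc : ∀ k < 2 ^ m, σ.nums 21 k = c k) :
    Runs rootVec σ (3000 * ((m + 2) * 2 ^ m)) (fun τ => ∀ j < 2 ^ m, τ.nums 24 j =
      coeff j (PowerSeries.mk (trunc' (2 ^ m) fun j => c (2 ^ m - 1 - j)) * G)) := by
  set n := 2 ^ m with hn
  have hn1 : 1 ≤ n := Nat.one_le_two_pow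
  have e2 : 2 ^ (m + 1) = n + n := by rw [hn]; ring
  have e3 : (m + 1 + 1) * (n + n) = 2 * ((m + 2) * n) := by ring
  have e4 : n ≤ (m + 2) * n := Nat.le_mul_of_pos_left _ (by omega)
  refine Runs.pre 10 rfl (by decide) (T' := (n + n + 1) * 40 + ((n + n + 1) * 40 +
    (1100 * ((m + 1 + 1) * (n + n)) + (n + 1) * 40))) (by omega) ?_
  set τ0 := (Prog.setI 10 0 (V 22 + V 22)).run σ with hτ0
  have a10 : τ0.ints 10 0 = n + n := by simp [hτ0, h22]
  have a22 : τ0.ints 22 0 = n := by simp [hτ0, h22]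
  have an : τ0.nums = σ.nums := rfl
  refine Runs.seq (loadPad_runs (n := n + n) 40 (trunc' n fun k => coeff k G) (by decide) a10 ?_)
    fun τ1 F1 e1 => ?_
  · intro k hk τ hI hS hv
    simp only [Test.holds_lt, IExp.eval, SExp.eval, hv, hI 22 (by simp), a22, trunc']
    split_ifs with h
    · rw [hS 23 (by simp), an, hG k h]
    · rfl
  refine Runs.seq (loadPad_runs (n := n + n) 40 (trunc' n fun j => c (n - 1 - j)) (by decide)
    (by rw [F1.ints 10 (by decide), a10]) ?_) fun τ2 F2 e2' => ?_
  · intro k hk τ hI hS hv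
    simp only [Test.holds_lt, IExp.eval, SExp.eval, hv, hI 22 (by simp), F1.ints 22 (by decide),
      a22, trunc']
    split_ifs with h
    · rw [hS 21 (by simp), F1.nums 21 (by decide), an]
      have he : IExp.eval τ (V 22 - 1 - V 26) = n - 1 - k := by
        simp [hv, hI 22, F1.ints 22 (by decide), a22]
      rw [he]
      exact hc _ (by omega)
    · rfl
  refine Runs.seq ((conv_runs (m := m + 1) ?_).le (by rw [e2])) fun τ3 F3 e3 => ?_
  · rw [F2.ints 10 (by decide), F1.ints 10 (by decide), a10, e2]
  rw [e2] at e3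
  have e1' : ∀ k < n + n, τ2.nums 12 k = trunc' n (fun k => coeff k G) k := fun k hk => by
    rw [F2.nums 12 (by decide), e1 k hk]
  refine (storeS_runs (n := n) (p := 0) 40 _ (by decide) ?_ ?_).mono le_rfl
    fun τ _ h => by simpa using h.1
  · intro τ hI
    simp [hI 22, F3.ints 22 (by decide), F2.ints 22 (by decide), F1.ints 22 (by decide), a22]
  · intro k hk τ hI hS hv _
    simp only [SExp.eval, IExp.eval, hv, hS 15 (by simp)]
    refine (e3.2 k (by omega)).trans ?_
    rw [cyc_congr e1' e2', cyc_eq_coeff (by omega), mul_comm]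
    · refine coeff_mul_congr (fun i _ => rfl) fun i hi => ?_
      rw [coeff_mk, trunc', if_pos (by omega)]
    · intro x _ y _ hxy
      rw [trunc', trunc']
      split_ifs <;> first | omega | simp

def vandCore : Prog :=
  (.ite (.lt (V 20) (V 21)) (.setI 28 0 (V 21)) (.setI 28 0 (V 20))) ;;
  ceilPow 22 28 ;;
  .setI 10 0 (V 22) ;;
  loadPad 20 (.lt (V 26) (V 20)) (.get 20 (V 26)) ;;
  loadPad 21 (.lt (V 26) (V 21)) (.get 21 (V 26)) ;;
  storeS 22 (V 22) 0 (.ofNat 0 - .get 20 (V 26)) ;;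
  productTree ;; newton ;; rootVec ;; goDown

/-- In the coefficient of $X^{n-1}$ the reversed entry $c_k$, at index $n-1-k$, meets $x^k$. Hence
evaluation at $x$ is a coefficient of a product with a geometric series. -/
theorem coeff_mul_geom {n K : ℕ} (hn : 0 < n) (hK : K ≤ n) (c : ℕ → ℂ) (x : ℂ) :
    coeff (n - 1) (PowerSeries.mk (trunc' n fun j => trunc' K c (n - 1 - j)) *
      PowerSeries.mk fun j => x ^ j) = ∑ k ∈ range K, c k * x ^ k := by
  rw [coeff_mul, Finset.Nat.sum_antidiagonal_eq_sum_range_succ_mk, show (n - 1).succ = n by omega]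
  simp only [coeff_mk]
  rw [← sum_range_reflect]
  have : ∑ k ∈ range K, c k * x ^ k = ∑ k ∈ range n, trunc' K c k * x ^ k := by
    rw [← sum_subset (range_subset_range.2 hK)]
    · exact sum_congr rfl fun k hk => by rw [trunc', if_pos (mem_range.1 hk)]
    · intro k _ hk
      rw [trunc', if_neg (by simpa using hk), zero_mul]
  rw [this]
  refine sum_congr rfl fun k hk => ?_
  rw [mem_range] at hk
  rw [trunc', if_pos (by omega), show n - 1 - (n - 1 - k) = k by omega]

/-- A bound for the running time of `vandCore`. -/
def vandCost (a K : ℕ) : ℕ :=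
  30000 * ((Nat.clog 2 (max a K) + 2) ^ 2 * 2 ^ Nat.clog 2 (max a K))

/-- Nodes and coefficients are padded by zeros up to the power of two. A padded node contributes the
factor 1 to the products, and its value is never read. -/
theorem vandCore_runs {σ : Store} {a K : ℕ} {r c : ℕ → ℂ}
    (h20 : σ.ints 20 0 = a) (h21 : σ.ints 21 0 = K)
    (hr : ∀ i < a, σ.nums 20 i = r i) (hc : ∀ k < K, σ.nums 21 k = c k) :
    Runs vandCore σ (vandCost a K) (fun τ => ∀ i < a, τ.nums 24 i = ∑ k ∈ range K, c k * r i ^ k) := by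
  rw [vandCost]
  set m := Nat.clog 2 (max a K) with hm
  have hnle : max a K ≤ 2 ^ m := Nat.le_pow_clog (by omega) _
  have han : a ≤ 2 ^ m := by omega
  have hKn : K ≤ 2 ^ m := by omega
  set n := 2 ^ m with hn
  have hn1 : 1 ≤ n := Nat.one_le_two_pow
  have b0 : (m + 1) * n ≤ (m + 2) ^ 2 * n := Nat.mul_le_mul_right _ (by nlinarith)
  have b1 : (m + 1) ^ 2 * n ≤ (m + 2) ^ 2 * n :=
    Nat.mul_le_mul_right _ (Nat.pow_le_pow_left (by omega) 2)
  have b2 : (m + 2) * n ≤ (m + 2) ^ 2 * n := Nat.mul_le_mul_right _ (by nlinarith)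
  have b3 : n ≤ (m + 1) * n := Nat.le_mul_of_pos_left _ (by omega)
  have b4 : m + 1 ≤ (m + 1) * n := Nat.le_mul_of_pos_right _ (by omega)
  refine Runs.pre 20 rfl (by decide) (T' := 20 * (m + 1) + (10 + ((n + 1) * 40 + ((n + 1) * 40 +
    ((n + 1) * 40 + (2200 * ((m + 1) ^ 2 * n) + (13000 * ((m + 2) ^ 2 * n) +
    (3000 * ((m + 2) * n) + 3200 * ((m + 1) ^ 2 * n))))))))) (by omega) ?_
  set τ0 := (Prog.ite (.lt (V 20) (V 21)) (.setI 28 0 (V 21)) (.setI 28 0 (V 20))).run σ with hτ0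
  have z28 : τ0.ints 28 0 = max a K := by
    simp only [hτ0, Prog.run, Test.holds_lt, IExp.eval, h20, h21]
    split_ifs <;> simp <;> omega
  have zI : ∀ A, A ≠ 28 → τ0.ints A = σ.ints A := by
    intro A hA
    simp only [hτ0, Prog.run]
    split_ifs <;> exact Store.putI_ints_ne _ _ _ hA
  have zS : τ0.nums = σ.nums := by
    simp only [hτ0, Prog.run]
    split_ifs <;> rfl
  refine Runs.seq (ceilPow_runs (by decide) z28) fun τ1 F1 e1 => ?_
  rw [← hm, ← hn] at e1
  refine Runs.pre 10 rfl (by decide) le_rfl ?_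
  set τ2 := (Prog.setI 10 0 (V 22)).run τ1 with hτ2
  have g10 : τ2.ints 10 0 = n := by simp [hτ2, e1]
  have g22 : τ2.ints 22 0 = n := by simp [hτ2, e1]
  have g20 : τ2.ints 20 0 = a := by simp [hτ2, F1.ints 20 (by decide), zI, h20]
  have g21 : τ2.ints 21 0 = K := by simp [hτ2, F1.ints 21 (by decide), zI, h21]
  have gS : ∀ A, τ2.nums A = σ.nums A := fun A => by
    rw [← zS, ← F1.nums A (by simp [ceilPow, Prog.wS])]; rfl
  refine Runs.seq (loadPad_runs_self (n := n) 40 (trunc' a r) (by decide) g10 ?_)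
    fun τ3 F3 e3 => ?_
  · intro k hk τ hI hS hv hj
    simp only [Test.holds_lt, IExp.eval, SExp.eval, hv, hI 20 (by simp), g20, trunc']
    split_ifs with h
    · rw [hj k le_rfl, gS, hr k h]
    · rfl
  refine Runs.seq (loadPad_runs_self (n := n) 40 (trunc' K c) (by decide)
    (by rw [F3.ints 10 (by decide), g10]) ?_) fun τ4 F4 e4 => ?_
  · intro k hk τ hI hS hv hj
    simp only [Test.holds_lt, IExp.eval, SExp.eval, hv, hI 21 (by simp), F3.ints 21 (by decide),
      g21, trunc']
    split_ifs with h
    · rw [hj k le_rfl, F3.nums 21 (by decide), gS, hc k h]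
    · rfl
  have i22 : τ4.ints 22 0 = n := by rw [F4.ints 22 (by decide), F3.ints 22 (by decide), g22]
  -- The leaves of the product tree, in tail form.
  refine Runs.seq (storeS_runs (n := n) (p := 0) 40 (fun i => - trunc' a r i) (by decide) ?_ ?_)
    fun τ5 F5 e5 => ?_
  · intro τ hI
    simp [hI 22, i22]
  · intro k hk τ hI hS hv _
    simp [hv, hS 20, F4.nums 20 (by decide), e3 k hk]
  have j22 : τ5.ints 22 0 = n := by rw [F5.ints 22 (by decide), i22]
  refine Runs.seq (productTree_runs (m := m) (r := trunc' a r) j22 (by simpa using e5.1))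
    fun τ6 F6 e6 => ?_
  have k22 : τ6.ints 22 0 = n := by rw [F6.ints 22 (by decide), j22]
  refine Runs.seq (newton_runs (m := m) k22 e6.1 (coeff_blockProd_zero _ m 0)
    (blockProd_mul_blockInv (trunc' a r) m 0) (by simpa using e6.2 m le_rfl 0 (by positivity)))
    fun τ7 F7 e7 => ?_
  have l22 : τ7.ints 22 0 = n := by rw [F7.ints 22 (by decide), k22]
  refine Runs.seq (rootVec_runs (m := m) (c := trunc' K c) l22 e7 ?_) fun τ8 F8 e8 => ?_
  · intro k hk
    rw [F7.nums 21 (by decide), F6.nums 21 (by decide), F5.nums 21 (by decide), e4 k hk]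
  refine (goDown_runs (m := m) (by rw [F8.ints 22 (by decide), l22]) ?_ ?_ e8).mono le_rfl ?_
  · rw [F8.ints 24 (by decide), F7.ints 24 (by decide), e6.1]
  · rw [F8.nums 22 (by decide), F7.nums 22 (by decide)]; exact e6.2
  · intro τ _ h i hi
    rw [h i (by omega), coeff_mul_geom (by omega) hKn, trunc', if_pos hi]

end FTFI

namespace FTFI

open Finset

/-! ## The factorization -/

/-- The cross term is $2uxy=(2ux/q)\cdot qy$, and $qy$ is the natural number $s$, so its exponential
is a power with a natural exponent. -/
theorem quadExp_add (u v w x y q : ℝ) (s : ℕ) (hq : q ≠ 0) (hy : y * q = s) :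
    quadExp u v w (x + y) = Real.exp w * (Real.exp (u * x ^ 2 + v * x) *
      Real.exp (2 * u * x / q) ^ s * Real.exp (u * y ^ 2 + v * y)) := by
  rw [quadExp, ← Real.exp_nat_mul, ← Real.exp_add, ← Real.exp_add, ← Real.exp_add, ← hy]
  congr 1
  field_simp
  ring

theorem sumMatrix_quadExp (u v w : ℝ) {q a b : ℕ} (x : Fin a → ℝ) (y : Fin b → ℝ) (s : Fin b → ℕ)
    (hq : 0 < q) (hs : ∀ j, y j * (q : ℝ) = (s j : ℝ)) :
    sumMatrix (quadExp u v w) x y =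
      Real.exp w •
        (Matrix.diagonal (fun i => Real.exp (u * x i ^ 2 + v * x i)) *
          genVandermonde (fun i => Real.exp (2 * u * x i / (q : ℝ))) s *
          Matrix.diagonal (fun j => Real.exp (u * y j ^ 2 + v * y j))) := by
  ext i j
  rw [Matrix.smul_apply, Matrix.mul_diagonal, Matrix.diagonal_mul]
  exact quadExp_add u v w (x i) (y j) q (s j) (by positivity) (hs j)

theorem genVandermonde_mulVec {a b : ℕ} (r : Fin a → ℝ) (s : Fin b → ℕ) {K : ℕ}
    (hK : ∀ j, s j < K) (z : Fin b → ℝ) :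
    (genVandermonde r s).mulVec z = (ordVandermonde r K).mulVec (padVector s z K) := by
  funext i
  simp only [Matrix.mulVec, dotProduct, genVandermonde, ordVandermonde, padVector, Matrix.of_apply]
  simp_rw [mul_sum]
  rw [sum_comm]
  refine sum_congr rfl fun j _ => ?_
  rw [sum_eq_single ⟨s j, hK j⟩]
  · simp
  · intro k _ hk
    rw [if_neg, mul_zero]
    rintro h
    exact hk (Fin.ext h.symm)
  · simp

/-! ## Running times -/

/-- From $2^m\le2X$ and $X\ge2$ one gets $m+2\le4\log_2X\le8\log X$; the constant is $8^2\cdot2$. -/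
theorem two_pow_bound {m X : ℕ} (hX : 2 ≤ X) (h : 2 ^ m ≤ 2 * X) :
    (((m + 2) ^ 2 * 2 ^ m : ℕ) : ℝ) ≤ 128 * ((X : ℝ) * Real.log (X : ℝ) ^ 2) := by
  have hX' : (2 : ℝ) ≤ X := by exact_mod_cast hX
  have hl2 := Real.log_two_gt_d9
  have h2X : Real.log 2 ≤ Real.log X := Real.log_le_log (by norm_num) hX'
  have hm : (2 : ℝ) ^ m ≤ 2 * X := by exact_mod_cast h
  have h1 : (m : ℝ) * Real.log 2 ≤ Real.log 2 + Real.log X := by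
    rw [← Real.log_pow, ← Real.log_mul (by norm_num) (by positivity)]
    exact Real.log_le_log (by positivity) hm
  have h3 : (m : ℝ) + 2 ≤ 8 * Real.log X := by nlinarith
  push_cast
  calc ((m : ℝ) + 2) ^ 2 * 2 ^ m ≤ (8 * Real.log X) ^ 2 * (2 * X) :=
        mul_le_mul (pow_le_pow_left₀ (by positivity) h3 2) hm (by positivity) (by positivity)
    _ = _ := by ring

theorem vandCost_le {a K X : ℕ} (ha : 0 < a) (h : a + K ≤ X) (hX : 2 ≤ X) :
    (vandCost a K : ℝ) ≤ 3840000 * ((X : ℝ) * Real.log (X : ℝ) ^ 2) := by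
  have h1 := two_pow_clog_le (x := max a K) (by omega)
  have h2 := two_pow_bound (m := Nat.clog 2 (max a K)) hX (by omega)
  rw [vandCost]
  push_cast at h2 ⊢
  linarith

/-- As $\log2>1/2$, terms linear in the sizes can be absorbed into $X\log^2X$. -/
theorem log_sq_ge {X : ℕ} (hX : 2 ≤ X) : (1 : ℝ) ≤ 4 * Real.log (X : ℝ) ^ 2 := by
  have hX' : (2 : ℝ) ≤ X := by exact_mod_cast hX
  have hl2 := Real.log_two_gt_d9
  have h2X : Real.log 2 ≤ Real.log X := Real.log_le_log (by norm_num) hX'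
  nlinarith

@[simp] theorem arr_apply {α : Type*} [Zero α] {n : ℕ} (g : Fin n → α) (i : Fin n) :
    arr g i = g i := by simp [arr]

/-- Multiplication by an ordinary Vandermonde matrix. -/
def vandProg : Prog :=
  (.setI 20 0 (.get 0 0) ;; .setI 21 0 (.get 0 1)) ;;
  storeS 20 (V 20) 0 (.get 0 (V 26)) ;;
  storeS 21 (V 21) 0 (.get 1 (V 26)) ;;
  vandCore ;;
  storeS 2 (V 20) 0 (.get 24 (V 26))

theorem vandProg_runs {a K : ℕ} (r : Fin a → ℝ) (c : Fin K → ℝ) (ha : 0 < a) (hK : 0 < K) :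
    RunsWithin vandProg (vandInput r c)
      (5000000 * (((a + K : ℕ) : ℝ) * Real.log ((a + K : ℕ) : ℝ) ^ 2))
      (fun τ => ∀ i : Fin a,
        τ.nums 2 i = (((ordVandermonde r K).mulVec c i : ℝ) : ℂ)) := by
  set σ := vandInput r c with hσ
  have hX : 2 ≤ a + K := by omega
  refine Runs.within (T := 10 + ((a + 1) * 40 + ((K + 1) * 40 + (vandCost a K + (a + 1) * 40)))) ?_
    ?_
  · refine Runs.pre 10 rfl (by decide) le_rfl ?_
    set τ0 := (Prog.setI 20 0 (.get 0 0) ;; .setI 21 0 (.get 0 1)).run σ with hτ0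
    have a20 : τ0.ints 20 0 = a := by simp [hτ0, hσ, vandInput, arr]
    have a21 : τ0.ints 21 0 = K := by simp [hτ0, hσ, vandInput, arr]
    refine Runs.seq (storeS_runs (n := a) (p := 0) 40 (arr fun i => (r i : ℂ)) (by decide)
      (fun τ hI => by simp [hI, a20]) ?_) fun τ1 F1 e1 => ?_
    · intro k hk τ hI hS hv _
      simp [hv, hS 0]; rfl
    refine Runs.seq (storeS_runs (n := K) (p := 0) 40 (arr fun k => (c k : ℂ)) (by decide)
      (fun τ hI => by simp [hI, F1.ints 21 (by decide), a21]) ?_) fun τ2 F2 e2 => ?_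
    · intro k hk τ hI hS hv _
      simp [hv, hS 1, F1.nums 1 (by decide)]; rfl
    have b20 : τ2.ints 20 0 = a := by rw [F2.ints 20 (by decide), F1.ints 20 (by decide), a20]
    refine Runs.seq (vandCore_runs (a := a) (K := K) (r := arr fun i => (r i : ℂ))
      (c := arr fun k => (c k : ℂ)) b20 ?_ ?_ (by simpa using e2.1))
      fun τ3 F3 e3 => ?_
    · rw [F2.ints 21 (by decide), F1.ints 21 (by decide), a21]
    · rw [F2.nums 20 (by decide)]; simpa using e1.1
    refine (storeS_runs (n := a) (p := 0) 40 (τ3.nums 24) (by decide)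
      (fun τ hI => by simp [hI, F3.ints 20 (by decide), b20])
      (fun k hk τ hI hS hv _ => by simp [hv, hS 24])).mono le_rfl fun τ _ h i => ?_
    have h' := h.1 i i.2
    rw [zero_add] at h'
    rw [h', e3 i i.2, Finset.sum_range]
    simp [Matrix.mulVec, dotProduct, ordVandermonde, mul_comm]
  · have h1 := vandCost_le (a := a) (K := K) (by omega) le_rfl hX
    have h2 := log_sq_ge hX
    have h3 : (0 : ℝ) ≤ ((a + K : ℕ) : ℝ) := by positivity
    have h4 : ((a + K : ℕ) : ℝ) ≤ 4 * (((a + K : ℕ) : ℝ) * Real.log ((a + K : ℕ) : ℝ) ^ 2) := by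
      nlinarith
    have h5 : (2 : ℝ) ≤ ((a + K : ℕ) : ℝ) := by exact_mod_cast hX
    push_cast at h1 h4 h5 ⊢
    nlinarith

end FTFI

/-! ### Multiplication by the matrix of the values $f(x_i+s_j/q)$ -/

namespace FTFI

open Finset

/-- Multiplication by the matrix `[f (x i + s j / q)]`. -/
def sumProg : Prog :=
  (.setI 20 0 (.get 0 0) ;; .setI 21 0 0) ;;
  forUp 30 (.get 0 1) (.ite (.lt (V 21) (.get 1 (V 30) + 1))
    (.setI 21 0 (.get 1 (V 30) + 1)) .skip) ;;
  storeS 21 (V 21) 0 (.ofNat 0) ;;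
  forUp 30 (.get 0 1) (.setS 21 (.get 1 (V 30)) (.get 21 (.get 1 (V 30)) + .get 2 (V 30) *
    .exp (.ofNat (.get 1 (V 30)) / .ofNat (.get 0 2) *
      (.get 0 0 * (.ofNat (.get 1 (V 30)) / .ofNat (.get 0 2)) + .get 0 1)))) ;;
  storeS 20 (V 20) 0 (.exp ((.get 0 0 + .get 0 0) * .get 1 (V 26) / .ofNat (.get 0 2))) ;;
  vandCore ;;
  storeS 3 (V 20) 0 (.exp (.get 1 (V 26) * (.get 0 0 * .get 1 (V 26) + .get 0 1) + .get 0 2) *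
    .get 24 (V 26))

/-- `K` is not part of the input. The program determines `K'`, the maximum of the `s j` plus one,
which is at most every admissible `K`, and the cost bound is monotone. -/
theorem sumProg_runs (u v w : ℝ) {q a b K : ℕ} (x : Fin a → ℝ) (y : Fin b → ℝ) (s : Fin b → ℕ)
    (z : Fin b → ℝ) (hq : 0 < q) (ha : 0 < a) (hb : 0 < b)
    (hy : ∀ j, y j * (q : ℝ) = (s j : ℝ)) (hs : ∀ j, s j < K) :
    RunsWithin sumProg (sumMatrixInput u v w q x s z)
      (10000000 * (((a + b + K : ℕ) : ℝ) * Real.log ((a + b + K : ℕ) : ℝ) ^ 2))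
      (fun τ => ∀ i : Fin a,
        τ.nums 3 i = (((sumMatrix (quadExp u v w) x y).mulVec z i : ℝ) : ℂ)) := by
  set σ := sumMatrixInput u v w q x s z with hσ
  have hX : 2 ≤ a + b + K := by omega
  have i0 : σ.ints 0 = arr ![a, b, q] := rfl
  have i1 : σ.ints 1 = arr s := rfl
  have n0 : σ.nums 0 = arr ![(u : ℂ), (v : ℂ), (w : ℂ)] := rfl
  have n1 : σ.nums 1 = arr fun i => (x i : ℂ) := rfl
  have n2 : σ.nums 2 = arr fun j => (z j : ℂ) := rfl
  have arr0 : ∀ {α : Type} [Zero α] (p q r : α), arr ![p, q, r] 0 = p := fun p q r => by simp [arr]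
  have arr1 : ∀ {α : Type} [Zero α] (p q r : α), arr ![p, q, r] 1 = q := fun p q r => by simp [arr]
  have arr2 : ∀ {α : Type} [Zero α] (p q r : α), arr ![p, q, r] 2 = r := fun p q r => by simp [arr]
  -- The vector after multiplication by the right diagonal matrix, with the exponent in Horner form.
  set E : ℕ → ℂ := fun j => arr (fun j => (z j : ℂ)) j *
    Complex.exp (((arr s j : ℕ) : ℂ) / q * (u * (((arr s j : ℕ) : ℂ) / q) + v)) with hE
  set r : ℕ → ℂ := fun i => Complex.exp (((u : ℂ) + u) * arr (fun i => (x i : ℂ)) i / q) with hr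
  have hsK : ∀ j < b, arr s j < K := fun j hj => by
    have := arr_apply s ⟨j, hj⟩
    simp only at this
    rw [this]; exact hs _
  refine Runs.within (T := 10 + ((b + 1) * 60 + ((K + 1) * 60 + ((b + 1) * 100 + ((a + 1) * 60 +
    (30000 * ((Nat.clog 2 (a + K) + 2) ^ 2 * 2 ^ Nat.clog 2 (a + K)) + (a + 1) * 60)))))) ?_ ?_
  · refine Runs.pre 10 rfl (by decide) le_rfl ?_
    set τ0 := (Prog.setI 20 0 (.get 0 0) ;; .setI 21 0 0).run σ with hτ0
    have a0 : τ0.ints 0 = σ.ints 0 := by funext j; simp [hτ0]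
    have a1 : τ0.ints 1 = σ.ints 1 := by funext j; simp [hτ0]
    have a20 : τ0.ints 20 0 = a := by simp [hτ0, i0, arr0]
    have aS : τ0.nums = σ.nums := rfl
    refine Runs.seq ((Runs.forUp_const (n := b) 40 (fun k τ => τ.ints 21 0 ≤ K ∧
      ∀ j < k, arr s j < τ.ints 21 0) (by decide) ?_ ?_ ?_).le (Nat.mul_le_mul_left _ (by decide)))
      fun τ1 F1 e1 => ?_
    · simp [hτ0]
    · intro τ hF
      simp [hF.ints 0 (by decide), a0, i0, arr1]
    · rintro k hk τ hF hv ⟨h1, h2⟩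
      have t1 : τ.ints 1 k = arr s k := by rw [hF.ints 1 (by decide), a1, i1]
      have hkK := hsK k hk
      refine Runs.flat rfl (by decide) ?_
      by_cases hc : τ.ints 21 0 < arr s k + 1
      · simp only [Prog.run, Test.holds_lt, IExp.eval, hv, t1,
          if_pos hc]
        refine ⟨by simp; omega, fun j hj => ?_⟩
        rcases Nat.lt_succ_iff_lt_or_eq.mp hj with h | rfl
        · have := h2 j h; simp; omega
        · simp
      · simp only [Prog.run, Test.holds_lt, IExp.eval, hv, t1,
          if_neg hc]
        refine ⟨by simpa using h1, fun j hj => ?_⟩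
        rcases Nat.lt_succ_iff_lt_or_eq.mp hj with h | rfl
        · simpa using h2 j h
        · simp; omega
    obtain ⟨⟨hK1, hK2⟩, -⟩ := e1
    set K' := τ1.ints 21 0 with hK'
    have b0 : τ1.ints 0 = σ.ints 0 := by rw [F1.ints 0 (by decide), a0]
    have b1 : τ1.ints 1 = σ.ints 1 := by rw [F1.ints 1 (by decide), a1]
    have b20 : τ1.ints 20 0 = a := by rw [F1.ints 20 (by decide), a20]
    have bS : ∀ A, τ1.nums A = σ.nums A := fun A => by
      rw [F1.nums A (by simp [forUp, Prog.wS]), aS]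
    refine Runs.seq ((storeS_runs (n := K') (p := 0) 40 (fun _ => 0) (by decide)
      (fun τ hI => by simp [hI, hK']) (fun _ _ _ _ _ _ _ => by simp)).le (T' := (K + 1) * 60)
      (Nat.mul_le_mul (by omega) (by omega))) fun τ2 F2 e2 => ?_
    have c0 : τ2.ints 0 = σ.ints 0 := by rw [F2.ints 0 (by decide), b0]
    have c1 : τ2.ints 1 = σ.ints 1 := by rw [F2.ints 1 (by decide), b1]
    have cS : ∀ A, A ≠ 21 → τ2.nums A = σ.nums A := fun A hA => by
      rw [F2.nums A (by simp [storeS, forUp, Prog.wS, hA]), bS]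
    -- Entries with equal exponents are added up in the same cell, which is the padding of the
    -- vector.
    refine Runs.seq ((Runs.forUp_const (n := b) 80 (fun i τ => ∀ k < K', τ.nums 21 k =
      ∑ j ∈ range i, if arr s j = k then E j else 0) (by decide) ?_ ?_ ?_).le
      (Nat.mul_le_mul_left _ (by decide))) fun τ3 F3 e3 => ?_
    · intro k hk
      simpa using e2.1 k hk
    · intro τ hF
      simp [hF.ints 0 (by decide), c0, i0, arr1]
    · intro j hj τ hF hv hI
      refine Runs.flat rfl (by decide) ?_
      intro k hk
      have f0 : τ.ints 0 = arr ![a, b, q] := by rw [hF.ints 0 (by decide), c0, i0]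
      have f1 : τ.ints 1 = arr s := by rw [hF.ints 1 (by decide), c1, i1]
      have g0 : τ.nums 0 = arr ![(u : ℂ), (v : ℂ), (w : ℂ)] := by
        rw [hF.nums 0 (by decide), cS 0 (by decide), n0]
      have g2 : τ.nums 2 = arr fun j => (z j : ℂ) := by
        rw [hF.nums 2 (by decide), cS 2 (by decide), n2]
      rw [sum_range_succ, ← hI k hk]
      simp only [Prog.run, Store.putI_nums, Store.putS_nums, IExp.eval, hv, f1, true_and, SExp.eval,
        g2, f0, arr0, arr1, arr2, g0,
        SExp.eval_div']
      by_cases h : arr s j = k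
      · subst h
        simp only [if_true, hE]
      · rw [if_neg (Ne.symm h), if_neg h, add_zero]
    have d0 : τ3.ints 0 = σ.ints 0 := by rw [F3.ints 0 (by decide), c0]
    have dS : ∀ A, A ≠ 21 → τ3.nums A = σ.nums A := fun A hA => by
      rw [F3.nums A (by simp [forUp, Prog.wS, hA]), cS A hA]
    have d20 : τ3.ints 20 0 = a := by rw [F3.ints 20 (by decide), F2.ints 20 (by decide), b20]
    have d21 : τ3.ints 21 0 = K' := by rw [F3.ints 21 (by decide), F2.ints 21 (by decide)]
    refine Runs.seq ((storeS_runs (n := a) (p := 0) 60 r (by decide)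
      (fun τ hI => by simp [hI, d20]) ?_)) fun τ4 F4 e4 => ?_
    · intro k hk τ hI hS hv _
      have f0 : τ.ints 0 = arr ![a, b, q] := by rw [hI 0 (by decide), d0, i0]
      have g0 : τ.nums 0 = arr ![(u : ℂ), (v : ℂ), (w : ℂ)] := by
        rw [hS 0 (by decide), dS 0 (by decide), n0]
      have g1 : τ.nums 1 = arr fun i => (x i : ℂ) := by
        rw [hS 1 (by decide), dS 1 (by decide), n1]
      simp only [SExp.eval, SExp.eval_div', IExp.eval, hv, f0, g0, g1, arr0, arr2, hr]
    have k20 : τ4.ints 20 0 = a := by rw [F4.ints 20 (by decide), d20]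
    refine Runs.seq ((vandCore_runs (a := a) (K := K') (r := r)
      (c := fun k => ∑ j ∈ range b, if arr s j = k then E j else 0) k20
      (by rw [F4.ints 21 (by decide), d21]) (by simpa using e4.1)
      (by rw [F4.nums 21 (by decide)]; exact e3.1)).le ?_) fun τ5 F5 e5 => ?_
    · have hcl : Nat.clog 2 (max a K') ≤ Nat.clog 2 (a + K) := Nat.clog_mono_right 2 (by omega)
      exact Nat.mul_le_mul_left _ (Nat.mul_le_mul (Nat.pow_le_pow_left (by omega) 2)
        (Nat.pow_le_pow_right (by omega) hcl))
    have l20 : τ5.ints 20 0 = a := by rw [F5.ints 20 (by decide), k20]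
    have l0 : τ5.nums 0 = arr ![(u : ℂ), (v : ℂ), (w : ℂ)] := by
      rw [F5.nums 0 (by decide), F4.nums 0 (by decide), dS 0 (by decide), n0]
    have l1 : τ5.nums 1 = arr fun i => (x i : ℂ) := by
      rw [F5.nums 1 (by decide), F4.nums 1 (by decide), dS 1 (by decide), n1]
    refine (storeS_runs (n := a) (p := 0) 60 (fun i => Complex.exp (arr (fun i => (x i : ℂ)) i *
      (u * arr (fun i => (x i : ℂ)) i + v) + w) * τ5.nums 24 i) (by decide)
      (fun τ hI => by simp [hI, l20]) ?_).mono le_rfl fun τ _ h i => ?_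
    · intro k hk τ hI hS hv _
      simp only [SExp.eval, IExp.eval, hv, hS 0 (by decide), hS 1 (by decide),
        hS 24 (by decide), l0, l1, arr0, arr1, arr2]
    · have h' := h.1 i i.2
      rw [zero_add] at h'
      rw [h', e5 i i.2]
      simp_rw [sum_mul]
      rw [sum_comm, Matrix.mulVec, dotProduct, Complex.ofReal_sum, mul_sum, Finset.sum_range]
      refine sum_congr rfl fun j _ => ?_
      rw [sum_eq_single_of_mem (s j) (mem_range.2 (by simpa using hK2 j j.2))]
      · have hqq : (q : ℝ) ≠ 0 := by positivity
        have hyj : y j = s j / q := by rw [← hy j]; field_simp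
        have hqc : (q : ℂ) ≠ 0 := by exact_mod_cast hqq
        rw [sumMatrix, Matrix.of_apply, quadExp, hyj]
        simp only [hE, hr, arr_apply, if_true, ← Complex.exp_nat_mul]
        push_cast
        rw [mul_left_comm, mul_assoc, mul_left_comm, ← Complex.exp_add, mul_left_comm,
          ← Complex.exp_add, mul_comm]
        congr 2
        field_simp
        ring
      · intro k _ hk
        rw [if_neg, zero_mul]
        simpa using hk.symm
  · have h1 := two_pow_clog_le (x := a + K) (by omega)
    have h2 := two_pow_bound (m := Nat.clog 2 (a + K)) hX (by omega)
    have h3 := log_sq_ge hX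
    have h4 : (0 : ℝ) ≤ ((a + b + K : ℕ) : ℝ) := by positivity
    have h5 : ((a + b + K : ℕ) : ℝ) ≤
      4 * (((a + b + K : ℕ) : ℝ) * Real.log ((a + b + K : ℕ) : ℝ) ^ 2) := by nlinarith
    have h6 : (2 : ℝ) ≤ ((a + b + K : ℕ) : ℝ) := by exact_mod_cast hX
    push_cast at h1 h2 h5 h6 ⊢
    nlinarith

end FTFI

namespace FTFI

open Finset

/-! ## Rooted trees with vertices `0, …, N - 1`, given by the array of the parents -/

/-- The distance in the tree in which the vertex `k > 0` has the parent `par k < k`, at the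
distance `wt k`. -/
def tdist (par wt : ℕ → ℕ) (i j : ℕ) : ℕ :=
  if i = j then 0
  else if j < i then (if par i < i then wt i + tdist par wt (par i) j else 0)
  else (if par j < j then wt j + tdist par wt i (par j) else 0)
termination_by i + j

/-- The topmost vertex that is reached from `k` through edges which are not cut. -/
def top (par cut : ℕ → ℕ) (k : ℕ) : ℕ :=
  if cut k = 0 ∧ par k < k then top par cut (par k) else k
termination_by k
decreasing_by omega

/-- `v` is `x` or an ancestor of `x`, and no edge between them is cut. -/
inductive Under (par cut : ℕ → ℕ) (v : ℕ) : ℕ → Prop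
  | refl : Under par cut v v
  | step {x : ℕ} : cut x = 0 → Under par cut v (par x) → Under par cut v x

section

variable {N : ℕ} {par wt cut : ℕ → ℕ}

@[simp] theorem tdist_self (par wt : ℕ → ℕ) (i : ℕ) : tdist par wt i i = 0 := by
  rw [tdist, if_pos rfl]

/-- Parents have smaller numbers than their children, so the larger of two vertices is not an
ancestor of the other, and the path between them leaves it through its parent. -/
theorem tdist_of_gt (hp : ∀ k, 0 < k → k < N → par k < k) {i j : ℕ} (hi : i < N) (h : j < i) :
    tdist par wt i j = wt i + tdist par wt (par i) j := by
  rw [tdist, if_neg h.ne', if_pos h, if_pos (hp i (by omega) hi)]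

theorem tdist_of_lt (hp : ∀ k, 0 < k → k < N → par k < k) {i j : ℕ} (hj : j < N) (h : i < j) :
    tdist par wt i j = wt j + tdist par wt i (par j) := by
  rw [tdist, if_neg h.ne, if_neg (by omega), if_pos (hp j (by omega) hj)]

theorem tdist_comm (par wt : ℕ → ℕ) (i j : ℕ) : tdist par wt i j = tdist par wt j i := by
  induction h : i + j using Nat.strong_induction_on generalizing i j with
  | _ n ih =>
    rcases lt_trichotomy i j with hij | rfl | hij
    · rw [tdist.eq_def par wt i j, tdist.eq_def par wt j i, if_neg hij.ne, if_neg (by omega),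
        if_neg hij.ne', if_pos hij]
      split_ifs with h'
      · rw [ih (i + par j) (by omega) i (par j) rfl]
      · rfl
    · rfl
    · rw [tdist.eq_def par wt i j, tdist.eq_def par wt j i, if_neg hij.ne', if_pos hij, if_neg hij.ne,
        if_neg (show ¬ i < j by omega)]
      split_ifs with h'
      · rw [ih (par i + j) (by omega) (par i) j rfl]
      · rfl

theorem top_of_cut {k : ℕ} (h : cut k ≠ 0) : top par cut k = k := by
  rw [top, if_neg (by tauto)]

theorem pos_of_uncut (h0 : cut 0 ≠ 0) {k : ℕ} (h : cut k = 0) : 0 < k := by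
  rcases Nat.eq_zero_or_pos k with rfl | h'
  · exact absurd h h0
  · exact h'

theorem top_of_uncut (hp : ∀ k, 0 < k → k < N → par k < k) (h0 : cut 0 ≠ 0) {k : ℕ} (hk : k < N)
    (h : cut k = 0) : top par cut k = top par cut (par k) := by
  rw [top, if_pos ⟨h, hp k (pos_of_uncut h0 h) hk⟩]

theorem top_le (par cut : ℕ → ℕ) (k : ℕ) : top par cut k ≤ k := by
  induction k using Nat.strong_induction_on with
  | _ k ih =>
    rw [top]
    split_ifs with h
    · exact (ih _ h.2).trans h.2.le
    · rfl

theorem cut_top (hp : ∀ k, 0 < k → k < N → par k < k) (h0 : cut 0 ≠ 0) {k : ℕ} (hk : k < N) :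
    cut (top par cut k) ≠ 0 := by
  induction k using Nat.strong_induction_on with
  | _ k ih =>
    by_cases h : cut k = 0
    · have := hp k (pos_of_uncut h0 h) hk
      rw [top_of_uncut hp h0 hk h]
      exact ih _ this (by omega)
    · rwa [top_of_cut h]

theorem uncut_of_top_lt {k : ℕ} (h : top par cut k < k) : cut k = 0 := by
  by_contra h'
  rw [top_of_cut h'] at h
  omega

theorem Under.le (hp : ∀ k, 0 < k → k < N → par k < k) (h0 : cut 0 ≠ 0) {v x : ℕ} (hx : x < N)
    (h : Under par cut v x) : v ≤ x := by
  induction h with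
  | refl => rfl
  | step hc _ ih =>
    have := hp _ (pos_of_uncut h0 hc) hx
    exact (ih (by omega)).trans this.le

theorem Under.top_eq (hp : ∀ k, 0 < k → k < N → par k < k) (h0 : cut 0 ≠ 0) {v x : ℕ} (hx : x < N)
    (h : Under par cut v x) : top par cut v = top par cut x := by
  induction h with
  | refl => rfl
  | step hc _ ih =>
    have := hp _ (pos_of_uncut h0 hc) hx
    rw [ih (by omega), ← top_of_uncut hp h0 hx hc]

theorem Under.trans {v x y : ℕ} (h : Under par cut v x) (h' : Under par cut x y) :
    Under par cut v y := by
  induction h' with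
  | refl => exact h
  | step hc _ ih => exact .step hc ih

theorem under_top (hp : ∀ k, 0 < k → k < N → par k < k) (h0 : cut 0 ≠ 0) {x : ℕ} (hx : x < N) :
    Under par cut (top par cut x) x := by
  induction x using Nat.strong_induction_on with
  | _ x ih =>
    by_cases h : cut x = 0
    · have := hp x (pos_of_uncut h0 h) hx
      rw [top_of_uncut hp h0 hx h]
      exact .step h (ih _ this (by omega))
    · rw [top_of_cut h]; exact .refl

/-- A proper descendant lies under a child. -/
theorem Under.exists_child {v x : ℕ} (h : Under par cut v x) (hne : x ≠ v) :
    ∃ k, par k = v ∧ cut k = 0 ∧ Under par cut k x := by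
  induction h with
  | refl => exact absurd rfl hne
  | @step x hc h' ih =>
    by_cases hv : par x = v
    · exact ⟨x, hv, hc, .refl⟩
    · obtain ⟨k, h1, h2, h3⟩ := ih hv
      exact ⟨k, h1, h2, .step hc h3⟩

/-- The edge from `k` to its parent separates the vertices under `k` from the rest of the component:
from inside, the parent is farther by `wt k`, from outside, `k` is. Moving `j` to its parent changes
neither the side nor the difference until `j ≤ k`. -/
theorem tdist_dichotomy (hp : ∀ k, 0 < k → k < N → par k < k) (h0 : cut 0 ≠ 0) {k j : ℕ}
    (hk : k < N) (hj : j < N) (hc : cut k = 0) (ht : top par cut k = top par cut j) :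
    (Under par cut k j ∧ tdist par wt (par k) j = wt k + tdist par wt k j) ∨
      (¬ Under par cut k j ∧ tdist par wt k j = wt k + tdist par wt (par k) j) := by
  have hpk := hp k (pos_of_uncut h0 hc) hk
  induction j using Nat.strong_induction_on with
  | _ j ih =>
    rcases lt_trichotomy j k with h | rfl | h
    · exact Or.inr ⟨fun hu => absurd (hu.le hp h0 hj) (by omega), tdist_of_gt hp hk h⟩
    · refine Or.inl ⟨.refl, ?_⟩
      rw [tdist_of_lt hp hj hpk, tdist_self, tdist_self]
    · have hcj : cut j = 0 := uncut_of_top_lt (by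
        rw [← ht]; exact (top_le par cut k).trans_lt h)
      have hpj := hp j (by omega) hj
      have hu : Under par cut k j ↔ Under par cut k (par j) := by
        refine ⟨fun hu => ?_, .step hcj⟩
        cases hu with
        | refl => omega
        | step _ h' => exact h'
      rw [hu, tdist_of_lt hp hj (by omega : par k < j), tdist_of_lt hp hj h]
      have := ih (par j) hpj (by omega) (by rw [ht, top_of_uncut hp h0 hj hcj])
      rcases this with ⟨h1, h2⟩ | ⟨h1, h2⟩
      · exact Or.inl ⟨h1, by omega⟩
      · exact Or.inr ⟨h1, by omega⟩

theorem tdist_par (hp : ∀ k, 0 < k → k < N → par k < k) {k j : ℕ} (h0 : 0 < k) (hk : k < N)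
    (hj : j < N) :
    tdist par wt (par k) j = wt k + tdist par wt k j ∨
      tdist par wt k j = wt k + tdist par wt (par k) j := by
  -- With only the root cut, the whole tree is one component and the dichotomy applies to every
  -- pair.
  let cut : ℕ → ℕ := fun k => if k = 0 then 1 else 0
  have hc0 : cut 0 ≠ 0 := by simp [cut]
  have ht : ∀ x < N, top par cut x = 0 := fun x hx => by
    have := cut_top hp hc0 hx
    by_contra h
    exact this (if_neg h)
  have := tdist_dichotomy (wt := wt) hp hc0 hk hj (if_neg (by omega)) ((ht k hk).trans (ht j hj).symm)
  tauto

/-- Induction moves the larger of `i` and `k` to its parent. By `tdist_par`, the distance to `j`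
changes by at most the weight of that edge. -/
theorem tdist_triangle (hp : ∀ k, 0 < k → k < N → par k < k) {i j k : ℕ} (hi : i < N) (hj : j < N)
    (hk : k < N) : tdist par wt i j ≤ tdist par wt i k + tdist par wt k j := by
  induction h : i + k using Nat.strong_induction_on generalizing i k with
  | _ n ih =>
    rcases lt_trichotomy i k with hik | rfl | hik
    · have h1 := hp k (by omega) hk
      have h2 := ih (i + par k) (by omega) hi (by omega : par k < N) rfl
      have h3 := tdist_par (wt := wt) hp (by omega : 0 < k) hk hj
      rw [tdist_of_lt hp hk hik]
      omega
    · simp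
    · have h1 := hp i (by omega) hi
      have h2 := ih (par i + k) (by omega) (by omega : par i < N) hk rfl
      have h3 := tdist_par (wt := wt) hp (by omega : 0 < i) hi hj
      rw [tdist_of_gt hp hi hik]
      omega

/-- The first edge of the path from `i` to `o`. -/
theorem exists_toward (hp : ∀ k, 0 < k → k < N → par k < k) (hw : ∀ k, 0 < k → k < N → 1 ≤ wt k)
    (h0 : cut 0 ≠ 0) {o i : ℕ} (ho : o < N) (hi : i < N) (hne : i ≠ o)
    (ht : top par cut o = top par cut i) :
    ∃ k i', 0 < k ∧ k < N ∧ cut k = 0 ∧ i' < N ∧ ((i = k ∧ i' = par k) ∨ (i = par k ∧ i' = k)) ∧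
      tdist par wt o i = wt k + tdist par wt o i' := by
  induction o using Nat.strong_induction_on with
  | _ o ih =>
    rcases lt_or_gt_of_ne hne with h | h
    · have hc : cut o = 0 := uncut_of_top_lt (by
        rw [ht]; exact (top_le par cut i).trans_lt h)
      have hpo := hp o (by omega) ho
      by_cases hpi : par o = i
      · refine ⟨o, o, by omega, ho, hc, ho, Or.inr ⟨hpi.symm, rfl⟩, ?_⟩
        rw [tdist_of_gt hp ho h, hpi, tdist_self, tdist_self]
      · obtain ⟨k, i', h1, h2, h3, h4, h5, h6⟩ := ih (par o) hpo (by omega) (Ne.symm hpi)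
          (by rw [← ht, top_of_uncut hp h0 ho hc])
        refine ⟨k, i', h1, h2, h3, h4, h5, ?_⟩
        -- The edge found for `par o` also serves `o`. Otherwise `o` would be closer to `i'` than
        -- `par o` is, hence by `h10` closer to `i` as well, against `h8`.
        have h7 := tdist_par (wt := wt) hp (by omega : 0 < o) ho h4
        have h8 := tdist_of_gt (wt := wt) hp ho h
        have h9 := hw o (by omega) ho
        have h10 : tdist par wt o i ≤ wt k + tdist par wt o i' := by
          have := tdist_par (wt := wt) hp h1 h2 ho
          rw [tdist_comm par wt o i, tdist_comm par wt o i']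
          rcases h5 with ⟨rfl, rfl⟩ | ⟨rfl, rfl⟩ <;> omega
        omega
    · have hc : cut i = 0 := uncut_of_top_lt (by
        rw [← ht]; exact (top_le par cut o).trans_lt h)
      have hpi := hp i (by omega) hi
      exact ⟨i, par i, by omega, hi, hc, by omega, Or.inl ⟨rfl, rfl⟩, tdist_of_lt hp hi h⟩

/-! ### Cutting at one vertex of each component -/

/-- Cut all edges at the vertices `c t`, where `t` is the topmost vertex of a component. -/
def cutAt (par cut c : ℕ → ℕ) (k : ℕ) : ℕ :=
  if c (top par cut k) = k ∨ c (top par cut (par k)) = par k then 1 else cut k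

theorem cutAt_eq_zero {c : ℕ → ℕ} {k : ℕ} :
    cutAt par cut c k = 0 ↔ cut k = 0 ∧ c (top par cut k) ≠ k ∧
      c (top par cut (par k)) ≠ par k := by
  rw [cutAt]
  split_ifs with h <;> tauto

theorem Under.of_cutAt {c : ℕ → ℕ} {v x : ℕ} (h : Under par (cutAt par cut c) v x) :
    Under par cut v x := by
  induction h with
  | refl => exact .refl
  | step hc _ ih => exact .step (cutAt_eq_zero.1 hc).1 ih

theorem cutAt_zero (h0 : cut 0 ≠ 0) (c : ℕ → ℕ) : cutAt par cut c 0 ≠ 0 :=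
  fun h => h0 (cutAt_eq_zero.1 h).1

/-- Cutting more edges only refines the partition into components. -/
theorem top_eq_of_cutAt (hp : ∀ k, 0 < k → k < N → par k < k) (h0 : cut 0 ≠ 0) {c : ℕ → ℕ}
    {i j : ℕ} (hi : i < N) (hj : j < N)
    (h : top par (cutAt par cut c) i = top par (cutAt par cut c) j) :
    top par cut i = top par cut j := by
  have h1 := (under_top hp (cutAt_zero h0 c) hi).of_cutAt.top_eq hp h0 hi
  have h2 := (under_top hp (cutAt_zero h0 c) hj).of_cutAt.top_eq hp h0 hj
  rw [← h1, ← h2, h]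

/-- Vertices of one component that fall into different parts are joined by a path through the
centroid. The proof moves the larger vertex `i` towards the root; as long as neither end of its edge
is the centroid, the edge is not cut and the part stays the same. -/
theorem tdist_separated (hp : ∀ k, 0 < k → k < N → par k < k)
    (hw : ∀ k, 0 < k → k < N → 1 ≤ wt k) (h0 : cut 0 ≠ 0) {c : ℕ → ℕ}
    (hcN : ∀ x < N, c (top par cut x) < N)
    {i j : ℕ} (hi : i < N) (hj : j < N) (ht : top par cut i = top par cut j)
    (ht' : top par (cutAt par cut c) i ≠ top par (cutAt par cut c) j) :
    tdist par wt i j =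
      tdist par wt (c (top par cut i)) i + tdist par wt (c (top par cut j)) j := by
  induction h : i + j using Nat.strong_induction_on generalizing i j with
  | _ n ih =>
    wlog hij : j < i generalizing i j with H
    · have hne : i ≠ j := fun h => ht' (by rw [h])
      rw [tdist_comm, H hj hi ht.symm (Ne.symm ht') (by omega) (by omega), add_comm]
    have hN := hcN i hi
    rw [← ht]
    set z := c (top par cut i) with hz
    by_cases hiz : i = z
    · rw [← hiz, tdist_self, zero_add]
    have hc : cut i = 0 := uncut_of_top_lt (by
      rw [ht]; exact (top_le par cut j).trans_lt hij)
    have hpi := hp i (by omega) hi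
    have htp := top_of_uncut hp h0 hi hc
    rw [tdist_of_gt hp hi hij]
    by_cases hpz : par i = z
    · rw [hpz, tdist_of_lt (i := z) hp hi (by omega), hpz, tdist_self, add_zero]
    have hc' : cutAt par cut c i = 0 :=
      cutAt_eq_zero.2 ⟨hc, Ne.symm hiz, by rw [← htp]; exact Ne.symm hpz⟩
    have h1 := ih (par i + j) (by omega) (i := par i) (j := j) (by omega) hj (by rw [← htp, ht])
      (by rw [← top_of_uncut hp (cutAt_zero h0 c) hi hc']; exact ht') rfl
    rw [← ht, ← htp, ← hz] at h1
    -- If `par i` were farther from `z` than `i`, the distance from `i` to `j` would exceed the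
    -- detour through `z` by twice a positive weight, against the triangle inequality.
    have h2 := tdist_par (wt := wt) hp (by omega : 0 < i) hi hN
    have h3 := tdist_triangle (wt := wt) hp hi hj hN
    have h4 := hw i (by omega) hi
    rw [tdist_comm par wt (par i) z] at h2
    rw [tdist_comm par wt i z] at h2 h3
    have h5 := tdist_of_gt (wt := wt) hp hi hij
    omega

end

end FTFI

/-! ### Bounds for distances, halving by centroids, and numberings of weighted trees -/

namespace FTFI

open Finset

/-- Each value lies within `p` of zero or of a smaller value, so every distinct value up to `n`
accounts for at most `p` of the height `n`. -/
theorem le_mul_card_image_of_gaps {ι : Type*} {S : Finset ι} {d : ι → ℕ} {p : ℕ}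
    (h : ∀ v ∈ S, d v ≤ p ∨ ∃ v' ∈ S, d v' < d v ∧ d v ≤ d v' + p) {v : ι} (hv : v ∈ S) :
    d v ≤ p * (S.image d).card := by
  suffices key : ∀ n, ∀ v ∈ S, d v = n → n ≤ p * ((S.image d).filter (· ≤ n)).card from
    (key _ v hv rfl).trans (Nat.mul_le_mul_left _ (card_filter_le _ _))
  intro n
  induction n using Nat.strong_induction_on with
  | _ n ih =>
    rintro v hv rfl
    rcases h v hv with h1 | ⟨v', hv', h1, h2⟩
    · refine h1.trans (Nat.le_mul_of_pos_right _ (card_pos.2 ⟨d v, ?_⟩))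
      exact mem_filter.2 ⟨mem_image_of_mem _ hv, le_rfl⟩
    · have h3 := ih _ h1 v' hv' rfl
      have h4 : ((S.image d).filter (· ≤ d v')).card + 1 ≤ ((S.image d).filter (· ≤ d v)).card := by
        rw [← card_insert_of_notMem (a := d v) (by simp [h1])]
        refine card_le_card (insert_subset (mem_filter.2 ⟨mem_image_of_mem _ hv, le_rfl⟩) ?_)
        exact monotone_filter_right _ fun a _ ha => le_trans ha h1.le
      calc d v ≤ p * ((S.image d).filter (· ≤ d v')).card + p := by omega
        _ = p * (((S.image d).filter (· ≤ d v')).card + 1) := by ring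
        _ ≤ _ := Nat.mul_le_mul_left _ h4

section

variable {N : ℕ} {par wt cut : ℕ → ℕ}

open Classical in
/-- The number of the vertices under `v`. -/
noncomputable def underSize (N : ℕ) (par cut : ℕ → ℕ) (v : ℕ) : ℕ :=
  ((range N).filter (Under par cut v)).card

theorem Under.eq_of_par_eq (hp : ∀ k, 0 < k → k < N → par k < k) (h0 : cut 0 ≠ 0) {u u' x : ℕ}
    (hu : cut u = 0) (hu' : cut u' = 0) (huN : u < N) (huN' : u' < N) (hpar : par u = par u')
    (h : Under par cut u x) (h' : Under par cut u' x) : u = u' := by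
  have l1 := hp u (pos_of_uncut h0 hu) huN
  have l2 := hp u' (pos_of_uncut h0 hu') huN'
  induction h with
  | refl =>
    cases h' with
    | refl => rfl
    | step _ h' =>
      have := h'.le hp h0 (by omega)
      omega
  | step _ h ih =>
    cases h' with
    | refl =>
      have := h.le hp h0 (by omega)
      omega
    | step _ h' => exact ih h'

/-- The sets under the uncut children partition what lies properly under `v`. This recursion lets
the sizes be accumulated from children to parents. -/
theorem underSize_eq (hp : ∀ k, 0 < k → k < N → par k < k) (h0 : cut 0 ≠ 0) {v : ℕ} (hv : v < N) :
    underSize N par cut v =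
      1 + ∑ u ∈ (range N).filter (fun u => cut u = 0 ∧ par u = v), underSize N par cut u := by
  classical
  have hE : (range N).filter (Under par cut v) =
      insert v (((range N).filter (fun u => cut u = 0 ∧ par u = v)).biUnion
        fun u => (range N).filter (Under par cut u)) := by
    ext x
    simp only [mem_filter, mem_range, mem_insert, mem_biUnion]
    constructor
    · rintro ⟨hx, h⟩
      by_cases hxv : x = v
      · exact Or.inl hxv
      · obtain ⟨k, h1, h2, h3⟩ := h.exists_child hxv
        exact Or.inr ⟨k, ⟨(h3.le hp h0 hx).trans_lt hx, h2, h1⟩, hx, h3⟩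
    · rintro (rfl | ⟨u, ⟨_, h1, h2⟩, hx, h3⟩)
      · exact ⟨hv, .refl⟩
      · exact ⟨hx, Under.trans (.step h1 (by rw [h2]; exact .refl)) h3⟩
  rw [underSize, hE, card_insert_of_notMem, card_biUnion, add_comm]
  · rfl
  · intro u hu u' hu' hne
    simp only [mem_coe, mem_filter, mem_range] at hu hu'
    rw [Function.onFun, Finset.disjoint_left]
    intro x hx hx'
    simp only [mem_filter, mem_range] at hx hx'
    exact hne (hx.2.eq_of_par_eq hp h0 hu.2.1 hu'.2.1 hu.1 hu'.1 (hu.2.2.trans hu'.2.2.symm) hx'.2)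
  · simp only [mem_biUnion, mem_filter, mem_range, not_exists, not_and]
    rintro u ⟨hu, h1, h2⟩ _ h3
    have := h3.le hp h0 hv
    have := hp u (pos_of_uncut h0 h1) hu
    omega

theorem top_eq_iff_under (hp : ∀ k, 0 < k → k < N → par k < k) (h0 : cut 0 ≠ 0) {t x : ℕ}
    (ht : cut t ≠ 0) (hx : x < N) : top par cut x = t ↔ Under par cut t x := by
  constructor
  · rintro rfl
    exact under_top hp h0 hx
  · intro h
    rw [← h.top_eq hp h0 hx, top_of_cut ht]

theorem underSize_of_cut (hp : ∀ k, 0 < k → k < N → par k < k) (h0 : cut 0 ≠ 0) {t : ℕ}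
    (ht : cut t ≠ 0) :
    underSize N par cut t = ((range N).filter (fun x => top par cut x = t)).card := by
  classical
  rw [underSize]
  congr 1
  ext x
  simp only [mem_filter, mem_range, and_congr_right_iff]
  exact fun hx => (top_eq_iff_under hp h0 ht hx).symm

/-- `c t` is the lowest vertex above more than half of the component with the topmost vertex `t`. -/
structure IsCentroids (N : ℕ) (par cut c : ℕ → ℕ) : Prop where
  lt : ∀ t < N, cut t ≠ 0 → c t < N
  top_eq : ∀ t < N, cut t ≠ 0 → top par cut (c t) = t
  half : ∀ t < N, cut t ≠ 0 → underSize N par cut t < 2 * underSize N par cut (c t)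
  max : ∀ k < N, underSize N par cut (top par cut k) < 2 * underSize N par cut k →
    k ≤ c (top par cut k)

/-- A part is the centroid alone, or it hangs below the centroid, or it contains the old topmost
vertex. In the second case maximality of the centroid bounds it by half of the component, in the
third it misses more than half, namely everything under the centroid. -/
theorem card_cutAt_le (hp : ∀ k, 0 < k → k < N → par k < k) (h0 : cut 0 ≠ 0) {c : ℕ → ℕ}
    (hc : IsCentroids N par cut c) {v : ℕ} (hv : v < N) :
    ((range N).filter fun x => top par (cutAt par cut c) x = top par (cutAt par cut c) v).card ≤
      max 1 (((range N).filter fun x => top par cut x = top par cut v).card / 2) := by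
  classical
  set cut' := cutAt par cut c with hcut'
  have h0' : cut' 0 ≠ 0 := cutAt_zero h0 c
  set s := top par cut' v with hs
  set t := top par cut v with ht
  have hsc : cut' s ≠ 0 := cut_top hp h0' hv
  have htc : cut t ≠ 0 := cut_top hp h0 hv
  have hsN : s < N := (top_le _ _ v).trans_lt hv
  have htN : t < N := (top_le _ _ v).trans_lt hv
  have hst : top par cut s = t := (under_top hp h0' hv).of_cutAt.top_eq hp h0 hv
  have hzN := hc.lt t htN htc
  have hzt := hc.top_eq t htN htc
  have hzh := hc.half t htN htc
  rw [← underSize_of_cut hp h0 htc, ← underSize_of_cut hp h0' hsc]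
  set z := c t with hz
  -- The edges from the centroid to its children are cut, so nothing else remains under it.
  by_cases hsz : s = z
  · refine le_max_of_le_left ?_
    rw [underSize, card_le_one_iff_subset_singleton]
    refine ⟨s, fun x hx => ?_⟩
    simp only [mem_filter, mem_range, mem_singleton] at hx ⊢
    by_contra hne
    obtain ⟨k, h1, h2, h3⟩ := hx.2.exists_child hne
    apply (cutAt_eq_zero.1 h2).2.2
    rw [h1, hst, hsz]
  refine le_max_of_le_right ?_
  -- A newly cut edge above `s` other than the edge above the centroid must have the centroid as its
  -- upper end. So `s` is a child of `z`, has a larger number, and cannot lie above more than half.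
  by_cases hcs : cut s = 0
  · have hts := top_of_uncut hp h0 hsN hcs
    have hps : z = par s := by
      by_contra hne
      exact hsc (cutAt_eq_zero.2 ⟨hcs, by rw [hst]; exact Ne.symm hsz, by rw [← hts, hst]; exact hne⟩)
    have hlt := hp s (pos_of_uncut h0 hcs) hsN
    have h1 : ¬ underSize N par cut t < 2 * underSize N par cut s := fun h => by
      have := hc.max s hsN (by rwa [hst])
      rw [hst] at this
      omega
    have h2 : underSize N par cut' s ≤ underSize N par cut s :=
      card_le_card (monotone_filter_right _ fun x _ hx => hx.of_cutAt)
    omega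
  · have hst' : s = t := by rw [← hst, top_of_cut hcs]
    have hcz : cut' z ≠ 0 := fun h => (cutAt_eq_zero.1 h).2.1 (by rw [hzt])
    -- Going up from a vertex under `z`, one meets a cut edge at `z` at the latest.
    have key : ∀ x < N, Under par cut z x → z ≤ top par cut' x := by
      intro x hx h
      induction h with
      | refl => rw [top_of_cut hcz]
      | @step y hy h ih =>
        have hlt := hp y (pos_of_uncut h0 hy) hx
        by_cases hy' : cut' y = 0
        · rw [top_of_uncut hp h0' hx hy']
          exact ih (by omega)
        · rw [top_of_cut hy']
          exact (h.le hp h0 (by omega)).trans hlt.le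
    have hdis : Disjoint ((range N).filter (Under par cut' s)) ((range N).filter (Under par cut z)) := by
      rw [Finset.disjoint_left]
      intro x hx hx'
      simp only [mem_filter, mem_range] at hx hx'
      have h1 := key x hx.1 hx'.2
      rw [(top_eq_iff_under hp h0' hsc hx.1).2 hx.2] at h1
      have h2 := top_le par cut z
      omega
    have hcard : underSize N par cut' s + underSize N par cut z ≤ underSize N par cut t := by
      rw [underSize, underSize, ← card_union_of_disjoint hdis]
      refine card_le_card (union_subset ?_ ?_)
      · rw [← hst']
        exact monotone_filter_right _ fun x _ hx => hx.of_cutAt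
      · intro x hx
        simp only [mem_filter, mem_range] at hx ⊢
        exact ⟨hx.1, (top_eq_iff_under hp h0 htc hx.1).1 ((hx.2.top_eq hp h0 hx.1).symm.trans hzt)⟩
    omega

/-- Distances from the centroids are bounded by the sizes of the components. -/
theorem tdist_le_card_top (hp : ∀ k, 0 < k → k < N → par k < k)
    (hw : ∀ k, 0 < k → k < N → 1 ≤ wt k) {p : ℕ} (hwp : ∀ k, 0 < k → k < N → wt k ≤ p)
    (h0 : cut 0 ≠ 0) {c : ℕ → ℕ} (hc : IsCentroids N par cut c) {v : ℕ} (hv : v < N) :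
    tdist par wt (c (top par cut v)) v ≤
      p * ((range N).filter fun x => top par cut x = top par cut v).card := by
  refine (le_mul_card_image_of_gaps (d := fun x => tdist par wt (c (top par cut x)) x)
    (S := (range N).filter fun x => top par cut x = top par cut v)
    (fun x hx => ?_) (mem_filter.2 ⟨mem_range.2 hv, rfl⟩)).trans
    (Nat.mul_le_mul_left _ card_image_le)
  simp only [mem_filter, mem_range] at hx ⊢
  have htc := cut_top hp h0 hx.1
  have htN := (top_le par cut x).trans_lt hx.1
  have hzN := hc.lt _ htN htc
  have hzt := hc.top_eq _ htN htc
  by_cases hxz : x = c (top par cut x)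
  · left
    rw [← hxz, tdist_self]
    exact Nat.zero_le _
  · obtain ⟨k, i', h1, h2, h3, h4, h5, h6⟩ := exists_toward hp hw h0 hzN hx.1 hxz hzt
    have hti : top par cut i' = top par cut x := by
      have := top_of_uncut hp h0 h2 h3
      rcases h5 with ⟨rfl, rfl⟩ | ⟨rfl, rfl⟩ <;> simp [this]
    have h7 := hw k h1 h2
    have h8 := hwp k h1 h2
    refine Or.inr ⟨i', ⟨h4, hti.trans hx.2⟩, ?_⟩
    rw [hti, h6]
    omega

/-- Distances are still measured from the centroid of the old component, but bounded by the size of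
the new part. The gap argument works inside a part because the path to the centroid leaves it only
in its last edge, of weight at most `p`. -/
theorem tdist_le_card_top_cutAt (hp : ∀ k, 0 < k → k < N → par k < k)
    (hw : ∀ k, 0 < k → k < N → 1 ≤ wt k) {p : ℕ} (hwp : ∀ k, 0 < k → k < N → wt k ≤ p)
    (h0 : cut 0 ≠ 0) {c : ℕ → ℕ} (hc : IsCentroids N par cut c) {v : ℕ} (hv : v < N) :
    tdist par wt (c (top par cut v)) v ≤ p * ((range N).filter fun x =>
      top par (cutAt par cut c) x = top par (cutAt par cut c) v).card := by
  refine (le_mul_card_image_of_gaps (d := fun x => tdist par wt (c (top par cut x)) x)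
    (S := (range N).filter fun x => top par (cutAt par cut c) x = top par (cutAt par cut c) v)
    (fun x hx => ?_) (mem_filter.2 ⟨mem_range.2 hv, rfl⟩)).trans
    (Nat.mul_le_mul_left _ card_image_le)
  simp only [mem_filter, mem_range] at hx ⊢
  have htc := cut_top hp h0 hx.1
  have htN := (top_le par cut x).trans_lt hx.1
  have hzN := hc.lt _ htN htc
  have hzt := hc.top_eq _ htN htc
  by_cases hxz : x = c (top par cut x)
  · left
    rw [← hxz, tdist_self]
    exact Nat.zero_le _
  · obtain ⟨k, i', h1, h2, h3, h4, h5, h6⟩ := exists_toward hp hw h0 hzN hx.1 hxz hzt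
    have hti := top_of_uncut hp h0 h2 h3
    have hti' : top par cut i' = top par cut x := by
      rcases h5 with ⟨rfl, rfl⟩ | ⟨rfl, rfl⟩ <;> simp [hti]
    have h7 := hw k h1 h2
    have h8 := hwp k h1 h2
    -- If the first edge towards the centroid is not cut, the next vertex is in the same part; if it
    -- is cut, the next vertex is the centroid.
    by_cases hk : cutAt par cut c k = 0
    · have hti'' : top par (cutAt par cut c) i' = top par (cutAt par cut c) x := by
        have := top_of_uncut hp (cutAt_zero h0 c) h2 hk
        rcases h5 with ⟨rfl, rfl⟩ | ⟨rfl, rfl⟩ <;> simp [this]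
      refine Or.inr ⟨i', ⟨h4, hti''.trans hx.2⟩, ?_⟩
      rw [hti', h6]
      omega
    · left
      have : i' = c (top par cut x) := by
        by_contra hne
        apply hk
        refine cutAt_eq_zero.2 ⟨h3, ?_, ?_⟩ <;>
        rcases h5 with ⟨rfl, rfl⟩ | ⟨rfl, rfl⟩
        · exact Ne.symm hxz
        · rw [hti']; exact Ne.symm hne
        · rw [hti']; exact Ne.symm hne
        · exact Ne.symm hxz
      rw [h6, this, tdist_self]
      omega

end

/-! ### Weighted trees as arrays of parents -/

/-- The tree `G` with the edge weights `e` is given by the arrays `par` and `wt`, where the vertex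
`i` has the number `pos i`. -/
structure Layout {N : ℕ} (G : SimpleGraph (Fin N)) (e : Sym2 (Fin N) → ℕ) (pos : Fin N → ℕ)
    (par wt : ℕ → ℕ) : Prop where
  lt : ∀ i, pos i < N
  inj : Function.Injective pos
  par_lt : ∀ k, 0 < k → k < N → par k < k
  adj : ∀ i j, G.Adj i j ↔ (0 < pos i ∧ par (pos i) = pos j) ∨ (0 < pos j ∧ par (pos j) = pos i)
  wt_eq : ∀ i j, 0 < pos i → par (pos i) = pos j → wt (pos i) = e s(i, j)

namespace Layout

variable {N : ℕ} {G : SimpleGraph (Fin N)} {e : Sym2 (Fin N) → ℕ} {pos : Fin N → ℕ}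
  {par wt : ℕ → ℕ}

theorem exists_pos_eq (h : Layout G e pos par wt) {k : ℕ} (hk : k < N) : ∃ i, pos i = k := by
  have hs : Function.Surjective fun i => (⟨pos i, h.lt i⟩ : Fin N) :=
    Finite.surjective_of_injective fun i j hij => h.inj (by simpa using hij)
  obtain ⟨i, hi⟩ := hs ⟨k, hk⟩
  exact ⟨i, by simpa using hi⟩

theorem exists_edge (h : Layout G e pos par wt) {k : ℕ} (h0 : 0 < k) (hk : k < N) :
    ∃ ε ∈ G.edgeSet, wt k = e ε := by
  obtain ⟨i, rfl⟩ := h.exists_pos_eq hk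
  obtain ⟨j, hj⟩ := h.exists_pos_eq ((h.par_lt _ h0 hk).trans hk)
  exact ⟨s(i, j), (h.adj i j).2 (Or.inl ⟨h0, hj.symm⟩), h.wt_eq i j h0 hj.symm⟩

theorem exists_walk (h : Layout G e pos par wt) (q : ℕ) (i j : Fin N) :
    ∃ γ : G.Walk i j, (γ.edges.map (ratWeight e q)).sum = (tdist par wt (pos i) (pos j) : ℝ) / q := by
  induction hn : pos i + pos j using Nat.strong_induction_on generalizing i j with
  | _ n ih =>
    rcases lt_trichotomy (pos i) (pos j) with hij | hij | hij
    · have hlt := h.par_lt _ (by omega) (h.lt j)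
      obtain ⟨k, hk⟩ := h.exists_pos_eq (hlt.trans (h.lt j))
      obtain ⟨γ, hγ⟩ := ih (pos i + pos k) (by omega) i k rfl
      have hadj : G.Adj k j := (h.adj k j).2 (Or.inr ⟨by omega, hk.symm⟩)
      refine ⟨γ.concat hadj, ?_⟩
      rw [SimpleGraph.Walk.edges_concat, List.concat_eq_append, List.map_append, List.sum_append, hγ,
        tdist_of_lt h.par_lt (h.lt j) hij, h.wt_eq j k (by omega) hk.symm, hk]
      simp only [List.map_cons, List.map_nil, List.sum_cons, List.sum_nil, ratWeight, Sym2.eq_swap]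
      push_cast
      ring
    · obtain rfl := h.inj hij
      exact ⟨.nil, by simp⟩
    · have hlt := h.par_lt _ (by omega) (h.lt i)
      obtain ⟨k, hk⟩ := h.exists_pos_eq (hlt.trans (h.lt i))
      obtain ⟨γ, hγ⟩ := ih (pos k + pos j) (by omega) k j rfl
      have hadj : G.Adj i k := (h.adj i k).2 (Or.inl ⟨by omega, hk.symm⟩)
      refine ⟨.cons hadj γ, ?_⟩
      rw [SimpleGraph.Walk.edges_cons, List.map_cons, List.sum_cons, hγ,
        tdist_of_gt h.par_lt (h.lt i) hij, h.wt_eq i k (by omega) hk.symm, hk]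
      simp only [ratWeight]
      push_cast
      ring

theorem tdist_le_walk (h : Layout G e pos par wt) (q : ℕ) {i j : Fin N} (γ : G.Walk i j) :
    (tdist par wt (pos i) (pos j) : ℝ) / q ≤ (γ.edges.map (ratWeight e q)).sum := by
  induction γ with
  | nil => simp
  | @cons i k j hadj γ ih =>
    rw [SimpleGraph.Walk.edges_cons, List.map_cons, List.sum_cons]
    refine le_trans ?_ (add_le_add_right ih _)
    rw [ratWeight, ← add_div]
    refine div_le_div_of_nonneg_right ?_ (Nat.cast_nonneg q)
    norm_cast
    rcases (h.adj i k).1 hadj with ⟨h1, h2⟩ | ⟨h1, h2⟩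
    · rw [← h.wt_eq i k h1 h2]
      have := tdist_par (wt := wt) h.par_lt h1 (h.lt i) (h.lt j)
      rw [h2] at this
      omega
    · rw [Sym2.eq_swap, ← h.wt_eq k i h1 h2]
      have := tdist_par (wt := wt) h.par_lt h1 (h.lt k) (h.lt j)
      rw [h2] at this
      omega

/-- Some walk attains the value, and along any walk the distance to its end drops by at most the
weight of each edge. -/
theorem wdist_eq (h : Layout G e pos par wt) (q : ℕ) (i j : Fin N) :
    wdist G (ratWeight e q) i j = (tdist par wt (pos i) (pos j) : ℝ) / q := by
  obtain ⟨γ, hγ⟩ := h.exists_walk q i j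
  have : Nonempty (G.Walk i j) := ⟨γ⟩
  refine le_antisymm ?_ (le_ciInf fun γ => h.tdist_le_walk q γ)
  rw [← hγ]
  exact ciInf_le ⟨_, by rintro _ ⟨γ, rfl⟩; exact h.tdist_le_walk q γ⟩ γ

/-- The distances from a vertex are less than `p` times the number of their values. -/
theorem exists_dist (h : Layout G e pos par wt) {p q : ℕ} (hpp : 0 < p) (hq : 0 < q)
    (hT : IsWeightedTree G e p) (o : Fin N) :
    ∃ s : Fin N → ℕ, (∀ i, wdist G (ratWeight e q) o i * (q : ℝ) = (s i : ℝ)) ∧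
      ∀ i, s i < p * (Finset.univ.image s).card := by
  have hw : ∀ k, 0 < k → k < N → 1 ≤ wt k ∧ wt k ≤ p := fun k h0 hk => by
    obtain ⟨ε, h1, h2⟩ := h.exists_edge h0 hk
    rw [h2]
    exact ⟨hT.one_le ε h1, hT.le_bound ε h1⟩
  refine ⟨fun i => tdist par wt (pos o) (pos i), fun i => ?_, fun i => ?_⟩
  · rw [h.wdist_eq]
    field_simp
  -- Applied to the distances plus one, which turns the bound into a strict inequality without
  -- changing the number of values; the vertex `o` itself then has the value `1 ≤ p`.
  · have key := le_mul_card_image_of_gaps (S := univ) (p := p)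
      (d := fun i => tdist par wt (pos o) (pos i) + 1) (fun i _ => ?_) (mem_univ i)
    · have himg : univ.image (fun i => tdist par wt (pos o) (pos i) + 1) =
          (univ.image fun i => tdist par wt (pos o) (pos i)).image (· + 1) := by
        rw [image_image]; rfl
      rw [himg, card_image_of_injective _ (add_left_injective 1)] at key
      exact key
    · by_cases hio : pos i = pos o
      · left; simp [hio]; omega
      right
      let cut : ℕ → ℕ := fun k => if k = 0 then 1 else 0
      have hc0 : cut 0 ≠ 0 := by simp [cut]
      have ht : ∀ x < N, top par cut x = 0 := fun x hx => by
        have := cut_top h.par_lt hc0 hx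
        by_contra h
        exact this (if_neg h)
      obtain ⟨k, i', h1, h2, _, h4, _, h6⟩ := exists_toward h.par_lt (fun k h0 hk => (hw k h0 hk).1)
        hc0 (h.lt o) (h.lt i) hio ((ht _ (h.lt o)).trans (ht _ (h.lt i)).symm)
      obtain ⟨j, rfl⟩ := h.exists_pos_eq h4
      refine ⟨j, mem_univ _, ?_⟩
      have := hw k h1 h2
      omega

end Layout

/-- The parent is a neighbour closer to the root. The edges from the vertices other than `r` to
their parents are distinct, as two vertices cannot be each other's parent, and there are $N-1$ of
them; so they are all the edges of the tree. -/
theorem exists_parent {N : ℕ} {G : SimpleGraph (Fin N)} (hG : G.IsTree) (r : Fin N) :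
    ∃ (π : Fin N → Fin N) (h : Fin N → ℕ), (∀ v, v ≠ r → h (π v) < h v) ∧
      ∀ v w, G.Adj v w ↔ (v ≠ r ∧ w = π v) ∨ (w ≠ r ∧ v = π w) := by
  classical
  have key : ∀ v, ∃ w, v ≠ r → G.Adj v w ∧ G.dist r w < G.dist r v := by
    intro v
    by_cases hv : v = r
    · exact ⟨v, fun h => absurd hv h⟩
    obtain ⟨γ, hγ⟩ := hG.connected.exists_walk_length_eq_dist v r
    cases γ with
    | nil => exact absurd rfl hv
    | @cons _ w _ hadj γ =>
      refine ⟨w, fun _ => ⟨hadj, ?_⟩⟩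
      rw [SimpleGraph.Walk.length_cons] at hγ
      have := SimpleGraph.dist_le γ
      rw [SimpleGraph.dist_comm, SimpleGraph.dist_comm (u := r) (v := v)]
      omega
  choose π hπ using key
  refine ⟨π, G.dist r, fun v hv => (hπ v hv).2, fun v w => ⟨fun hadj => ?_, ?_⟩⟩
  · have hinj : Set.InjOn (fun v => s(v, π v)) ((univ.erase r : Finset (Fin N)) : Set (Fin N)) := by
      intro v hv w hw hvw
      have hv' := (hπ v (by simpa using hv)).2
      have hw' := (hπ w (by simpa using hw)).2
      simp only [Sym2.eq_iff] at hvw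
      rcases hvw with h | ⟨h1, h2⟩
      · exact h.1
      · rw [h2] at hv'
        rw [← h1] at hw'
        omega
    have hsub : (univ.erase r).image (fun v => s(v, π v)) ⊆ G.edgeFinset := by
      intro ε hε
      obtain ⟨v, hv, rfl⟩ := mem_image.1 hε
      rw [SimpleGraph.mem_edgeFinset]
      exact (hπ v (by simpa using hv)).1
    have heq := eq_of_subset_of_card_le hsub (by
      rw [card_image_of_injOn hinj, card_erase_of_mem (mem_univ _)]
      have := hG.card_edgeFinset
      rw [card_univ]
      omega)
    have hmem : s(v, w) ∈ G.edgeFinset := SimpleGraph.mem_edgeFinset.2 hadj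
    rw [← heq] at hmem
    obtain ⟨x, hx, hxe⟩ := mem_image.1 hmem
    have hx' : x ≠ r := by simpa using hx
    rcases Sym2.eq_iff.1 hxe with ⟨rfl, h⟩ | ⟨rfl, h⟩
    · exact Or.inl ⟨hx', h.symm⟩
    · exact Or.inr ⟨hx', h.symm⟩
  · rintro (⟨h, rfl⟩ | ⟨h, rfl⟩)
    · exact (hπ v h).1
    · exact (hπ w h).1.symm

end FTFI

namespace FTFI

open Finset

/-! ## Sums over groups of vertices -/

/-- The value of the integrated function at `k / q`. -/
noncomputable def quadVal (u v w : ℂ) (q k : ℕ) : ℂ :=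
  Complex.exp ((k : ℂ) / q * (u * ((k : ℂ) / q) + v) + w)

/-- Multiplication of a block of the array `34` by a Hankel matrix. -/
def hankelBlock : Prog :=
  (.setI 71 0 (.get 67 (V 70)) ;; .setI 72 0 (V 71 + V 71) ;; .setI 73 0 (.get 68 (V 70))) ;;
  ceilPow 10 72 ;;
  loadPad 12 (.lt (V 26) (V 71)) (.get 34 (V 73 + (V 71 - 1 - V 26))) ;;
  loadPad 13 (.lt (V 26) (V 72)) (.exp (.ofNat (V 26) / .ofNat (V 56) *
    (.get 0 0 * (.ofNat (V 26) / .ofNat (V 56)) + .get 0 1) + .get 0 2)) ;;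
  conv ;;
  storeS 34 (V 71) (V 73) (.get 15 (V 71 + V 26))

/-- Reversing `z` turns the Hankel matrix $[F(i+j)]$ into a convolution, read from position `K - 1`
on. -/
theorem sum_antidiagonal_hankel (K i : ℕ) (hi : i < K) (z F : ℕ → ℂ) :
    ∑ p ∈ antidiagonal (K - 1 + i), (if p.1 < K then z (K - 1 - p.1) else 0) *
      (if p.2 < K + K then F p.2 else 0) = ∑ j ∈ range K, z j * F (i + j) := by
  rw [Finset.Nat.sum_antidiagonal_eq_sum_range_succ_mk]
  rw [← sum_subset (s₁ := range K) (by intro x hx; simp at hx ⊢; omega)]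
  · rw [← sum_range_reflect (fun j => z j * F (i + j))]
    refine sum_congr rfl fun x hx => ?_
    rw [mem_range] at hx
    simp only
    rw [if_pos hx, if_pos (by omega), show K - 1 + i - x = i + (K - 1 - x) by omega]
  · intro x _ hx
    rw [mem_range] at hx
    simp [hx]

/-- The two factors end at `K` and `2 * K`, so indices reach at most `3 * K - 2`, while wrapping
onto `K - 1 + i` would need at least `3 * K - 1`. Because of the shift in the array `15`, position
`K - 1 + i` is read from the cell `K + i`. -/
theorem hankelBlock_runs {σ : Store} {t K off q : ℕ} {u v w : ℂ} (h70 : σ.ints 70 0 = t)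
    (h67 : σ.ints 67 t = K) (h68 : σ.ints 68 t = off) (h56 : σ.ints 56 0 = q)
    (hu : σ.nums 0 0 = u) (hv : σ.nums 0 1 = v) (hw : σ.nums 0 2 = w) :
    Runs hankelBlock σ (1500 * ((Nat.clog 2 (K + K) + 1) * 2 ^ Nat.clog 2 (K + K)))
      (fun τ => (∀ i < K, τ.nums 34 (off + i) =
        ∑ j ∈ range K, σ.nums 34 (off + j) * quadVal u v w q (i + j)) ∧
        ∀ j, j < off ∨ off + K ≤ j → τ.nums 34 j = σ.nums 34 j) := by
  set m := Nat.clog 2 (K + K) with hm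
  have hn : K + K ≤ 2 ^ m := Nat.le_pow_clog (by omega) _
  have hn1 : 1 ≤ 2 ^ m := Nat.one_le_two_pow
  set n := 2 ^ m with hn'
  refine Runs.le (T := 20 + (20 * (m + 1) + ((n + 1) * 40 + ((n + 1) * 60 +
    (1100 * ((m + 1) * n) + (K + 1) * 40))))) ?_ ?_
  · refine Runs.pre 20 rfl (by decide) le_rfl ?_
    set τ0 := (Prog.setI 71 0 (.get 67 (V 70)) ;; .setI 72 0 (V 71 + V 71) ;;
      .setI 73 0 (.get 68 (V 70))).run σ with hτ0
    have a71 : τ0.ints 71 0 = K := by simp [hτ0, h70, h67]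
    have a72 : τ0.ints 72 0 = K + K := by simp [hτ0, h70, h67]
    have a73 : τ0.ints 73 0 = off := by simp [hτ0, h70, h68]
    have a56 : τ0.ints 56 0 = q := by simp [hτ0, h56]
    have aS : τ0.nums = σ.nums := rfl
    refine Runs.seq (ceilPow_runs (by decide) a72) fun τ1 F1 e1 => ?_
    have b71 : τ1.ints 71 0 = K := by rw [F1.ints 71 (by decide), a71]
    have b72 : τ1.ints 72 0 = K + K := by rw [F1.ints 72 (by decide), a72]
    have b73 : τ1.ints 73 0 = off := by rw [F1.ints 73 (by decide), a73]
    have b56 : τ1.ints 56 0 = q := by rw [F1.ints 56 (by decide), a56]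
    have bS : ∀ A, τ1.nums A = σ.nums A := fun A => by
      rw [F1.nums A (by simp [ceilPow, Prog.wS]), aS]
    refine Runs.seq (loadPad_runs (n := n) 40
      (fun k => if k < K then σ.nums 34 (off + (K - 1 - k)) else 0) (by decide) e1 ?_)
      fun τ2 F2 e2 => ?_
    · intro k hk τ hI hS hv
      simp [hv, hI 71, hI 73, b71, b73, hS 34, bS]
    refine Runs.seq (loadPad_runs (n := n) 60
      (fun k => if k < K + K then quadVal u v w q k else 0) (by decide) ?_ ?_)
      fun τ3 F3 e3 => ?_
    · rw [F2.ints 10 (by decide), e1]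
    · intro k hk τ hI hS hv
      simp only [Test.holds_lt, IExp.eval, SExp.eval, hv, hI 72 (by decide), hI 56 (by decide),
        F2.ints 72 (by decide), F2.ints 56 (by decide), b72, b56, hS 0 (by decide),
        F2.nums 0 (by decide), bS, SExp.eval_div', quadVal, hu, hw]
      simp only [‹σ.nums 0 1 = v›]
    refine Runs.seq (conv_runs (m := m) (by
      rw [F3.ints 10 (by decide), F2.ints 10 (by decide), e1])) fun τ4 F4 e4 => ?_
    have c71 : τ4.ints 71 0 = K := by
      rw [F4.ints 71 (by decide), F3.ints 71 (by decide), F2.ints 71 (by decide), b71]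
    have c73 : τ4.ints 73 0 = off := by
      rw [F4.ints 73 (by decide), F3.ints 73 (by decide), F2.ints 73 (by decide), b73]
    have c34 : τ4.nums 34 = σ.nums 34 := by
      rw [F4.nums 34 (by decide), F3.nums 34 (by decide), F2.nums 34 (by decide), bS]
    refine (storeS_runs (n := K) (p := off) 40 (fun i =>
      ∑ j ∈ range K, σ.nums 34 (off + j) * quadVal u v w q (i + j)) (by decide)
      (fun τ hI => by simp [hI, c71, c73]) ?_).mono le_rfl fun τ _ h => ?_
    · intro i hi τ hI hS hv _
      simp only [SExp.eval, IExp.eval, hv, hI 71 (by decide), c71,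
        hS 15 (by decide)]
      rw [show K + i = K - 1 + i + 1 by omega, e4.2 _ (by omega), F3.nums 12 (by decide),
        cyc_congr e2 e3, cyc_eq_antidiagonal (by omega)]
      · exact sum_antidiagonal_hankel K i hi (fun j => σ.nums 34 (off + j)) (quadVal u v w q)
      · intro x hx y hy hxy
        by_cases h1 : x < K
        · rw [if_neg (c := y < K + K) (by omega), mul_zero]
        · rw [if_neg h1, zero_mul]
    · rw [c34] at h
      exact h
  · have : n ≤ (m + 1) * n := Nat.le_mul_of_pos_left _ (by omega)
    have : m + 1 ≤ (m + 1) * n := Nat.le_mul_of_pos_right _ (by omega)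
    omega

/-- The number of the cells for the group `t`. -/
def width (N : ℕ) (lab d : ℕ → ℕ) (t : ℕ) : ℕ :=
  ((range N).filter (fun x => lab x = t)).sup fun x => d x + 1

/-- The first cell for the group `t`. -/
def offset (N : ℕ) (lab d : ℕ → ℕ) (t : ℕ) : ℕ := ∑ s ∈ range t, width N lab d s

theorem width_succ (k : ℕ) (lab d : ℕ → ℕ) (t : ℕ) :
    width (k + 1) lab d t = if lab k = t then max (d k + 1) (width k lab d t) else width k lab d t := by
  rw [width, range_add_one, filter_insert]
  split_ifs with h
  · rw [sup_insert]; rfl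
  · rfl

theorem lt_width {N : ℕ} {lab d : ℕ → ℕ} {x : ℕ} (hx : x < N) : d x < width N lab d (lab x) :=
  Nat.lt_of_succ_le (le_sup (f := fun x => d x + 1) (mem_filter.2 ⟨mem_range.2 hx, rfl⟩))

theorem offset_add_width_le {N : ℕ} {lab d : ℕ → ℕ} {s t : ℕ} (h : s < t) :
    offset N lab d s + width N lab d s ≤ offset N lab d t := by
  rw [offset, ← sum_range_succ]
  exact sum_le_sum_of_subset (range_subset_range.2 h)

theorem offset_inj {N : ℕ} {lab d : ℕ → ℕ} {s t i j : ℕ} (hi : i < width N lab d s)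
    (hj : j < width N lab d t) (h : offset N lab d s + i = offset N lab d t + j) : s = t ∧ i = j := by
  rcases lt_trichotomy s t with hst | rfl | hst
  · have := offset_add_width_le (N := N) (lab := lab) (d := d) hst
    omega
  · exact ⟨rfl, by omega⟩
  · have := offset_add_width_le (N := N) (lab := lab) (d := d) hst
    omega

/-- A nonempty group of size $n_t$ has width at most $pn_t+1\le2pn_t$, an empty one has width 0, and
the sizes add up to $N$. -/
theorem offset_le {N p : ℕ} {lab d : ℕ → ℕ} (hp : 0 < p) (hlab : ∀ x < N, lab x < N)
    (hd : ∀ x < N, d x ≤ p * ((range N).filter fun y => lab y = lab x).card) :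
    offset N lab d N ≤ 2 * (p * N) := by
  have h1 : ∀ t, width N lab d t ≤ 2 * p * ((range N).filter fun y => lab y = t).card := by
    intro t
    refine Finset.sup_le fun x hx => ?_
    simp only [mem_filter, mem_range] at hx
    have h2 := hd x hx.1
    rw [hx.2] at h2
    have h3 : 0 < ((range N).filter fun y => lab y = t).card :=
      card_pos.2 ⟨x, by simpa using hx⟩
    nlinarith
  calc offset N lab d N ≤ ∑ t ∈ range N, 2 * p * ((range N).filter fun y => lab y = t).card :=
        sum_le_sum fun t _ => h1 t
    _ = 2 * p * N := by
        rw [← mul_sum, ← card_eq_sum_card_fiberwise (f := lab) (s := range N) (t := range N)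
          (fun x hx => by simpa using hlab x (by simpa using hx)), card_range]
    _ = _ := by ring

def groupOffsets : Prog :=
  forUp 70 (V 40) (.setI 67 (V 70) 0) ;;
  forUp 70 (V 40) (.ite (.lt (.get 67 (.get 58 (V 70))) (.get 62 (V 70) + 1))
    (.setI 67 (.get 58 (V 70)) (.get 62 (V 70) + 1)) .skip) ;;
  .setI 69 0 0 ;;
  forUp 70 (V 40) (.setI 68 (V 70) (V 69) ;; .setI 69 0 (V 69 + .get 67 (V 70)))

theorem groupOffsets_runs {σ : Store} {N : ℕ} {lab d : ℕ → ℕ} (h40 : σ.ints 40 0 = N)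
    (hlab : ∀ x < N, lab x < N) (h58 : ∀ x < N, σ.ints 58 x = lab x)
    (h62 : ∀ x < N, σ.ints 62 x = d x) :
    Runs groupOffsets σ (200 * (N + 1)) (fun τ => (∀ t < N, τ.ints 67 t = width N lab d t) ∧
      (∀ t < N, τ.ints 68 t = offset N lab d t) ∧ τ.ints 69 0 = offset N lab d N) := by
  refine Runs.le (T := (N + 1) * 30 + ((N + 1) * 60 + ((N + 1) * 60 + 5))) ?_ (by omega)
  refine Runs.seq (Runs.fillI_zero (n := N) 30 67 (fun _ => 0) (by decide) (by decide) rfl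
    (by decide) (fun τ hF => by simp [hF.ints 40 (by decide), h40])
    (fun k hk τ hF hv _ _ => by simp [hv])) fun τ1 F1 e1 => ?_
  refine Runs.seq (mid := fun τ => ∀ t < N, τ.ints 67 t = width N lab d t)
    ((Runs.forUp_const (n := N) 40 (fun k τ => ∀ t < N, τ.ints 67 t = width k lab d t)
    (by decide) ?_ ?_ ?_).mono (Nat.mul_le_mul_left _ (by decide)) fun τ _ h => h.1)
    fun τ2 F2 e2 => ?_
  · intro t ht
    simpa [width] using e1 t ht
  · intro τ hF
    simp [hF.ints 40 (by decide), F1.ints 40 (by decide), h40]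
  · intro k hk τ hF hv hI
    refine Runs.flat rfl (by decide) fun t ht => ?_
    have f58 : τ.ints 58 k = lab k := by rw [hF.ints 58 (by decide), F1.ints 58 (by decide), h58 k hk]
    have f62 : τ.ints 62 k = d k := by rw [hF.ints 62 (by decide), F1.ints 62 (by decide), h62 k hk]
    have := hI _ (hlab k hk)
    rw [width_succ, ← hI t ht]
    simp only [Prog.run, Test.holds_lt, IExp.eval, hv, f58, f62]
    by_cases hlt : lab k = t
    · subst hlt
      rw [if_pos rfl]
      split_ifs with h
      · simp; omega
      · simp; omega
    · rw [if_neg hlt]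
      split_ifs with h <;> simp [Ne.symm hlt]
  · refine Runs.pre 5 rfl (by decide) (T' := (N + 1) * 60) (by omega) ?_
    set τ3 := (Prog.setI 69 0 0).run τ2 with hτ3
    have a67 : τ3.ints 67 = τ2.ints 67 := by funext j; simp [hτ3]
    have a40 : τ3.ints 40 0 = N := by
      simp [hτ3, F2.ints 40 (by decide), F1.ints 40 (by decide), h40]
    refine (Runs.forUp_const (n := N) 40 (fun k τ => (∀ t < k, τ.ints 68 t = offset N lab d t) ∧
      τ.ints 69 0 = offset N lab d k) (by decide) ?_ ?_ ?_).mono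
      (Nat.mul_le_mul_left _ (by decide)) fun τ F h => ⟨fun t ht => ?_, h.1.1, h.1.2⟩
    · simp [hτ3, offset]
    · intro τ hF
      simp [hF.ints 40 (by decide), a40]
    · rintro k hk τ hF hv ⟨h1, h2⟩
      refine Runs.flat rfl (by decide) ⟨fun t ht => ?_, ?_⟩
      · rcases Nat.lt_succ_iff_lt_or_eq.mp ht with h | rfl
        · simp [hv, h2, h1 t h, h.ne]
        · simp [hv, h2]
      · simp [hv, h2, hF.ints 67 (by decide), a67, e2 k hk, offset, sum_range_succ]
    · rw [F.ints 67 (by decide), a67, e2 t ht]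

/-- Add the sums over the groups, multiplied by the sign, to the array `31`. -/
def groupSum : Prog :=
  groupOffsets ;;
  forUp 70 (V 69) (.setS 34 (V 70) (.ofNat 0)) ;;
  forUp 70 (V 40) (.setS 34 (.get 68 (.get 58 (V 70)) + .get 62 (V 70))
    (.get 34 (.get 68 (.get 58 (V 70)) + .get 62 (V 70)) + .get 30 (V 70))) ;;
  forUp 70 (V 40) hankelBlock ;;
  forUp 70 (V 40) (.setS 31 (V 70) (.get 31 (V 70) +
    .get 32 0 * .get 34 (.get 68 (.get 58 (V 70)) + .get 62 (V 70))))

/-- Inside a group the kernel depends only on `d x + d y`. So the field is first added up by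
distance, then multiplied by a Hankel matrix, and the result is read back at `d x`. -/
theorem groupSum_runs {σ : Store} {N p q : ℕ} {lab d : ℕ → ℕ} {u v w : ℂ} (hN : 0 < N) (hp : 0 < p)
    (h40 : σ.ints 40 0 = N) (h56 : σ.ints 56 0 = q) (hlab : ∀ x < N, lab x < N)
    (h58 : ∀ x < N, σ.ints 58 x = lab x) (h62 : ∀ x < N, σ.ints 62 x = d x)
    (hd : ∀ x < N, d x ≤ p * ((range N).filter fun y => lab y = lab x).card)
    (hu : σ.nums 0 0 = u) (hv : σ.nums 0 1 = v) (hw : σ.nums 0 2 = w) :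
    Runs groupSum σ (20000 * ((Nat.clog 2 (4 * (p * N)) + 1) * (p * N))) (fun τ => ∀ x < N,
      τ.nums 31 x = σ.nums 31 x + σ.nums 32 0 * ∑ y ∈ (range N).filter (fun y => lab y = lab x),
        quadVal u v w q (d x + d y) * σ.nums 30 y) := by
  set M := Nat.clog 2 (4 * (p * N)) with hM
  set K := width N lab d with hK
  set off := offset N lab d with hoff
  have hoffN : off N ≤ 2 * (p * N) := offset_le hp hlab hd
  have hpN : N ≤ p * N := Nat.le_mul_of_pos_left _ hp
  -- The summand 1 pays for empty groups, whose transform has length one.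
  have hcost : ∀ t < N, 1500 * ((Nat.clog 2 (K t + K t) + 1) * 2 ^ Nat.clog 2 (K t + K t)) ≤
      1500 * ((M + 1) * (4 * K t + 1)) := by
    intro t ht
    have h1 : off t + K t ≤ off N := offset_add_width_le ht
    have h2 : Nat.clog 2 (K t + K t) ≤ M := Nat.clog_mono_right 2 (by omega)
    refine Nat.mul_le_mul_left _ (Nat.mul_le_mul (by omega) ?_)
    rcases Nat.eq_zero_or_pos (K t) with h | h
    · rw [h]; simp
    · exact (two_pow_clog_le (by omega)).trans (by omega)
  refine Runs.le (T := 200 * (N + 1) + ((off N + 1) * 30 + ((N + 1) * 40 +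
    ((1500 * ((M + 1) * (4 * off N + N)) + N * 20 + 20) + (N + 1) * 50)))) ?_ ?_
  · refine Runs.seq (groupOffsets_runs h40 hlab h58 h62) fun τ1 F1 e1 => ?_
    obtain ⟨e67, e68, e69⟩ := e1
    have nums1 : ∀ A, τ1.nums A = σ.nums A := fun A => F1.nums A (by simp [groupOffsets, forUp, Prog.wS])
    have a58 : ∀ x < N, τ1.ints 58 x = lab x := fun x hx => by rw [F1.ints 58 (by decide), h58 x hx]
    have a62 : ∀ x < N, τ1.ints 62 x = d x := fun x hx => by rw [F1.ints 62 (by decide), h62 x hx]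
    have a40 : τ1.ints 40 0 = N := by rw [F1.ints 40 (by decide), h40]
    have a56 : τ1.ints 56 0 = q := by rw [F1.ints 56 (by decide), h56]
    refine Runs.seq (Runs.fillS_zero (n := off N) 30 34 (fun _ => 0) (by decide) rfl
      (by decide) (fun τ hF => by simp [hF.ints 69 (by decide), e69, hoff])
      (fun k hk τ hF hv _ => by simp [hv])) fun τ2 F2 e2 => ?_
    have hlt : ∀ t < N, ∀ i < K t, off t + i < off N := fun t ht i hi => by
      have : off t + K t ≤ off N := offset_add_width_le ht
      omega
    refine Runs.seq (mid := fun τ => ∀ t < N, ∀ i < K t, τ.nums 34 (off t + i) =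
        ∑ y ∈ range N, if lab y = t ∧ d y = i then σ.nums 30 y else 0)
      ((Runs.forUp_const (n := N) 25 (fun k τ => ∀ t < N, ∀ i < K t,
      τ.nums 34 (off t + i) = ∑ y ∈ range k, if lab y = t ∧ d y = i then σ.nums 30 y else 0)
      (by decide) ?_ ?_ ?_).mono (Nat.mul_le_mul_left _ (by decide)) fun τ _ h => h.1)
      fun τ3 F3 e3 => ?_
    · intro t ht i hi
      simpa using e2 _ (hlt t ht i hi)
    · intro τ hF
      simp [hF.ints 40 (by decide), F2.ints 40 (by decide), a40]
    · intro k hk τ hF hv hI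
      refine Runs.flat rfl (by decide) fun t ht i hi => ?_
      have f58 : τ.ints 58 k = lab k := by
        rw [hF.ints 58 (by decide), F2.ints 58 (by decide), a58 k hk]
      have f62 : τ.ints 62 k = d k := by
        rw [hF.ints 62 (by decide), F2.ints 62 (by decide), a62 k hk]
      have f68 : τ.ints 68 (lab k) = off (lab k) := by
        rw [hF.ints 68 (by decide), F2.ints 68 (by decide), e68 _ (hlab k hk)]
      have f30 : τ.nums 30 = σ.nums 30 := by
        rw [hF.nums 30 (by decide), F2.nums 30 (by decide), nums1]
      have hw' := lt_width (N := N) (lab := lab) (d := d) hk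
      rw [sum_range_succ, ← hI t ht i hi]
      simp only [Prog.run, Store.putI_nums, Store.putS_nums, IExp.eval, hv, f58, f62,
        f68, true_and, SExp.eval, f30]
      by_cases h : lab k = t ∧ d k = i
      · rw [if_pos h, ← h.1, ← h.2, if_pos rfl]
      · rw [if_neg h, add_zero, if_neg]
        exact fun h' => h ((offset_inj hi hw' h').imp Eq.symm Eq.symm)
    -- The field of the group `t` collected by distance. Blocks are transformed in place, and those
    -- not yet reached still hold `Z`.
    set Z : ℕ → ℕ → ℂ := fun t i =>
      ∑ y ∈ range N, if lab y = t ∧ d y = i then σ.nums 30 y else 0 with hZ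
    refine Runs.seq (mid := fun τ => ∀ t < N, ∀ i < K t, τ.nums 34 (off t + i) =
        ∑ j ∈ range (K t), Z t j * quadVal u v w q (i + j))
      ((Runs.forUp (n := N) (fun t => 1500 * ((M + 1) * (4 * K t + 1)))
      (fun k τ => ∀ t < N, ∀ i < K t, τ.nums 34 (off t + i) =
        if t < k then ∑ j ∈ range (K t), Z t j * quadVal u v w q (i + j) else Z t i)
      (by decide) ?_ ?_ ?_).mono ?_ fun τ _ h t ht i hi => ?_)
      fun τ4 F4 e4 => ?_
    · intro t ht i hi
      simpa using e3 t ht i hi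
    · intro τ hF
      simp [hF.ints 40 (by decide), F3.ints 40 (by decide), F2.ints 40 (by decide), a40]
    · intro k hk τ hF hvk hI
      refine (hankelBlock_runs (t := k) (K := K k) (off := off k) (q := q) (u := u) (v := v) (w := w)
        hvk ?_ ?_ ?_ ?_ ?_ ?_).mono (hcost k hk) fun τ' F' h t ht i hi => ?_
      · rw [hF.ints 67 (by decide), F3.ints 67 (by decide), F2.ints 67 (by decide), e67 k hk]
      · rw [hF.ints 68 (by decide), F3.ints 68 (by decide), F2.ints 68 (by decide), e68 k hk]
      · rw [hF.ints 56 (by decide), F3.ints 56 (by decide), F2.ints 56 (by decide), a56]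
      · rw [hF.nums 0 (by decide), F3.nums 0 (by decide), F2.nums 0 (by decide), nums1, hu]
      · rw [hF.nums 0 (by decide), F3.nums 0 (by decide), F2.nums 0 (by decide), nums1, hv]
      · rw [hF.nums 0 (by decide), F3.nums 0 (by decide), F2.nums 0 (by decide), nums1, hw]
      · rw [Store.putI_nums]
        by_cases htk : t = k
        · subst htk
          rw [h.1 i hi, if_pos (by omega)]
          refine sum_congr rfl fun j hj => ?_
          rw [hI t ht j (mem_range.1 hj), if_neg (by omega)]
        · rw [h.2, hI t ht i hi]
          · exact if_congr (by omega) rfl rfl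
          · rcases lt_or_gt_of_ne htk with h' | h'
            · have : off t + K t ≤ off k := offset_add_width_le h'
              omega
            · have : off k + K k ≤ off t := offset_add_width_le h'
              omega
    · have : ∑ k ∈ range N, (4 * K k + 1) = 4 * off N + N := by
        rw [sum_add_distrib, ← mul_sum]; simp [hoff, offset, hK]
      rw [← mul_sum, ← mul_sum, this]
      have : (V 40).cost + 10 ≤ 20 := by decide
      exact add_le_add (add_le_add le_rfl (Nat.mul_le_mul_left _ this)) this
    · rw [h.1 t ht i hi, if_pos ht]
    refine (Runs.fillS_zero (n := N) 50 31 (fun x => σ.nums 31 x + σ.nums 32 0 *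
      ∑ y ∈ (range N).filter (fun y => lab y = lab x), quadVal u v w q (d x + d y) * σ.nums 30 y)
      (by decide) rfl (by decide) (fun τ hF => ?_) (fun k hk τ hF hvk hj => ?_))
    · simp [hF.ints 40 (by decide), F4.ints 40 (by decide), F3.ints 40 (by decide),
        F2.ints 40 (by decide), a40]
    · have f58 : τ.ints 58 k = lab k := by
        rw [hF.ints 58 (by decide), F4.ints 58 (by decide), F3.ints 58 (by decide),
          F2.ints 58 (by decide), a58 k hk]
      have f62 : τ.ints 62 k = d k := by
        rw [hF.ints 62 (by decide), F4.ints 62 (by decide), F3.ints 62 (by decide),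
          F2.ints 62 (by decide), a62 k hk]
      have f68 : τ.ints 68 (lab k) = off (lab k) := by
        rw [hF.ints 68 (by decide), F4.ints 68 (by decide), F3.ints 68 (by decide),
          F2.ints 68 (by decide), e68 _ (hlab k hk)]
      have f32 : τ.nums 32 = σ.nums 32 := by
        rw [hF.nums 32 (by decide), F4.nums 32 (by decide), F3.nums 32 (by decide),
          F2.nums 32 (by decide), nums1]
      have f31 : τ.nums 31 k = σ.nums 31 k := by
        rw [hj k le_rfl, F4.nums 31 (by decide), F3.nums 31 (by decide),
          F2.nums 31 (by decide), nums1]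
      have f34 : τ.nums 34 (off (lab k) + d k) =
          ∑ y ∈ (range N).filter (fun y => lab y = lab k),
            quadVal u v w q (d k + d y) * σ.nums 30 y := by
        rw [hF.nums 34 (by decide), e4 _ (hlab k hk) _ (lt_width hk), sum_filter]
        simp only [hZ, sum_mul]
        rw [sum_comm]
        refine sum_congr rfl fun y hy => ?_
        rw [mem_range] at hy
        by_cases h : lab y = lab k
        · rw [if_pos h, sum_eq_single_of_mem (d y)]
          · rw [if_pos ⟨h, rfl⟩, mul_comm]
          · rw [mem_range, ← h]; exact lt_width hy
          · intro j _ hj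
            rw [if_neg (fun h' => hj h'.2.symm), zero_mul]
        · rw [if_neg h]
          exact sum_eq_zero fun j _ => by rw [if_neg (fun h' => h h'.1), zero_mul]
      funext j
      simp only [Prog.run, Store.putS_nums, IExp.eval, hvk, f58, f62, f68,
        SExp.eval, f31, f32, f34]
  · have h1 : (M + 1) * (4 * off N + N) ≤ (M + 1) * (9 * (p * N)) :=
      Nat.mul_le_mul_left _ (by omega)
    have h2 : (M + 1) * (9 * (p * N)) = 9 * ((M + 1) * (p * N)) := by ring
    have h3 : p * N ≤ (M + 1) * (p * N) := Nat.le_mul_of_pos_left _ (by omega)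
    omega

end FTFI

namespace FTFI

open Finset

/-! ## Centroids -/

/-- The memory holds a rooted tree and its components. -/
structure Comps (N : ℕ) (par wt cut : ℕ → ℕ) (σ : Store) : Prop where
  size : σ.ints 40 0 = N
  parents : ∀ k < N, σ.ints 54 k = par k
  weights : ∀ k < N, σ.ints 55 k = wt k
  cuts : ∀ k < N, σ.ints 57 k = cut k
  tops : ∀ k < N, σ.ints 58 k = top par cut k

/-- The arrays `par` and `wt` describe a rooted tree with edge weights at most `p`. -/
structure IsParents (N p : ℕ) (par wt : ℕ → ℕ) : Prop where
  zero : par 0 = 0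
  lt : ∀ k, 0 < k → k < N → par k < k
  pos : ∀ k, 0 < k → k < N → 1 ≤ wt k
  le : ∀ k, 0 < k → k < N → wt k ≤ p

theorem Comps.of_frame {N : ℕ} {par wt cut : ℕ → ℕ} {σ τ : Store} (h : Comps N par wt cut σ)
    (h40 : τ.ints 40 = σ.ints 40) (h54 : τ.ints 54 = σ.ints 54) (h55 : τ.ints 55 = σ.ints 55)
    (h57 : τ.ints 57 = σ.ints 57) (h58 : τ.ints 58 = σ.ints 58) : Comps N par wt cut τ :=
  ⟨by rw [h40, h.size], fun k hk => by rw [h54, h.parents k hk], fun k hk => by rw [h55, h.weights k hk],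
    fun k hk => by rw [h57, h.cuts k hk], fun k hk => by rw [h58, h.tops k hk]⟩

theorem IsParents.par_lt {N p : ℕ} {par wt : ℕ → ℕ} (h : IsParents N p par wt) {k : ℕ} (hk : k < N) :
    par k < N := by
  rcases Nat.eq_zero_or_pos k with rfl | h0
  · rwa [h.zero]
  · exact (h.lt k h0 hk).trans hk

def computeTop : Prog :=
  forUp 64 (V 40) (.ite (.eq (.get 57 (V 64)) 0)
    (.setI 58 (V 64) (.get 58 (.get 54 (V 64)))) (.setI 58 (V 64) (V 64)))

theorem computeTop_runs {σ : Store} {N p : ℕ} {par wt cut : ℕ → ℕ} (hP : IsParents N p par wt)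
    (h0 : cut 0 ≠ 0) (h40 : σ.ints 40 0 = N) (h54 : ∀ k < N, σ.ints 54 k = par k)
    (h57 : ∀ k < N, σ.ints 57 k = cut k) :
    Runs computeTop σ ((N + 1) * 50) (fun τ => ∀ k < N, τ.ints 58 k = top par cut k) := by
  refine Runs.fillI_zero (n := N) 50 58 (top par cut) (by decide) (by decide) rfl
    (by decide) (fun τ hF => by simp [hF.ints 40 (by decide), h40])
    (fun k hk τ hF hv _ hprev => ?_)
  have f57 : τ.ints 57 k = cut k := by rw [hF.ints 57 (by decide), h57 k hk]
  have f54 : τ.ints 54 k = par k := by rw [hF.ints 54 (by decide), h54 k hk]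
  simp only [Prog.run, Test.holds_eq, IExp.eval, hv, f57, f54]
  by_cases h : cut k = 0
  · rw [if_pos h, top_of_uncut hP.lt h0 hk h, hprev _ (hP.lt k (pos_of_uncut h0 h) hk)]
  · rw [if_neg h, top_of_cut h]

def computeSize : Prog :=
  forUp 64 (V 40) (.setI 59 (V 64) 1) ;;
  forUp 64 (V 40) (.setI 65 0 (V 40 - 1 - V 64) ;; .ite (.eq (.get 57 (V 65)) 0)
    (.setI 59 (.get 54 (V 65)) (.get 59 (.get 54 (V 65)) + .get 59 (V 65))) .skip)

/-- Vertices are treated in decreasing order, so that the size of a vertex is complete when it is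
added to its parent. -/
theorem computeSize_runs {σ : Store} {N p : ℕ} {par wt cut : ℕ → ℕ} (hP : IsParents N p par wt)
    (h0 : cut 0 ≠ 0) (hC : Comps N par wt cut σ) :
    Runs computeSize σ ((N + 1) * 100) (fun τ => ∀ k < N, τ.ints 59 k = underSize N par cut k) := by
  refine Runs.le (T := (N + 1) * 30 + (N + 1) * 70) ?_ (by omega)
  refine Runs.seq (Runs.fillI_zero (n := N) 30 59 (fun _ => 1) (by decide) (by decide) rfl
    (by decide) (fun τ hF => by simp [hF.ints 40 (by decide), hC.size])
    (fun k hk τ hF hv _ _ => by simp [hv])) fun τ1 F1 e1 => ?_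
  refine (Runs.forUp_const (n := N) 57 (fun i τ => ∀ v < N, τ.ints 59 v =
    1 + ∑ u ∈ (range N).filter (fun u => (cut u = 0 ∧ par u = v) ∧ N - i ≤ u), underSize N par cut u)
    (by decide) ?_ ?_ ?_).mono (Nat.mul_le_mul_left _ (by decide)) fun τ _ h k hk => ?_
  · intro v hv
    rw [filter_false_of_mem, sum_empty]
    · simpa using e1 v hv
    · intro u hu
      rw [mem_range] at hu
      omega
  · intro τ hF
    simp [hF.ints 40 (by decide), F1.ints 40 (by decide), hC.size]
  · intro i hi τ hF hv hI
    set k := N - 1 - i with hk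
    have hkN : k < N := by omega
    have f40 : τ.ints 40 0 = N := by rw [hF.ints 40 (by decide), F1.ints 40 (by decide), hC.size]
    have f57 : τ.ints 57 k = cut k := by rw [hF.ints 57 (by decide), F1.ints 57 (by decide), hC.cuts k hkN]
    have f54 : τ.ints 54 k = par k := by rw [hF.ints 54 (by decide), F1.ints 54 (by decide), hC.parents k hkN]
    -- All uncut children of `k` have larger numbers, hence have been treated already.
    have f59 : τ.ints 59 k = underSize N par cut k := by
      rw [hI k hkN, underSize_eq hP.lt h0 hkN]
      congr 1
      refine sum_congr (filter_congr fun u hu => ?_) fun _ _ => rfl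
      rw [mem_range] at hu
      refine ⟨fun h => h.1, fun h => ⟨h, ?_⟩⟩
      have := hP.lt u (pos_of_uncut h0 h.1) hu
      omega
    have hset : ∀ v, (range N).filter (fun u => (cut u = 0 ∧ par u = v) ∧ N - (i + 1) ≤ u) =
        if cut k = 0 ∧ par k = v then
          insert k ((range N).filter (fun u => (cut u = 0 ∧ par u = v) ∧ N - i ≤ u))
        else (range N).filter (fun u => (cut u = 0 ∧ par u = v) ∧ N - i ≤ u) := by
      intro v
      have hor : ∀ u, N - (i + 1) ≤ u ↔ u = k ∨ N - i ≤ u := fun u => by omega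
      ext u
      split_ifs with h <;> simp only [mem_filter, mem_insert, mem_range, hor]
      · constructor
        · tauto
        · rintro (rfl | h')
          · exact ⟨hkN, h, Or.inl rfl⟩
          · tauto
      · constructor
        · rintro ⟨h1, h2, rfl | h3⟩
          · exact absurd h2 h
          · exact ⟨h1, h2, h3⟩
        · tauto
    refine Runs.flat rfl (by decide) fun v hvN => ?_
    rw [hset v]
    have hIv := hI v hvN
    have hIp := hI _ (hP.par_lt hkN)
    have g57 : (τ.putI 65 0 k).ints 57 k = cut k := by simp [f57]
    have g54 : (τ.putI 65 0 k).ints 54 k = par k := by simp [f54]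
    simp only [Prog.run, IExp.eval, hv, f40, IExp.eval_sub', ← hk, Test.holds_eq,
      Store.putI_ints, and_self, if_true, Nat.reduceEqDiff,
      false_and, if_false, f57, f54]
    by_cases hc : cut k = 0
    · rw [if_pos hc]
      by_cases hpv : par k = v
      · subst hpv
        rw [if_pos ⟨hc, rfl⟩, sum_insert (by simp; omega)]
        simp [f59, hIp]
        omega
      · rw [if_neg (fun h => hpv h.2)]
        simp [Ne.symm hpv, hIv]
    · rw [if_neg hc, if_neg (fun h => hc h.1)]
      simp [hIv]
  · rw [h.1 k hk, underSize_eq hP.lt h0 hk]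
    simp

def computeCent : Prog :=
  forUp 64 (V 40) (.ite (.lt (.get 59 (.get 58 (V 64))) (.get 59 (V 64) + .get 59 (V 64)))
    (.setI 60 (.get 58 (V 64)) (V 64)) .skip)

/-- Candidates appear in increasing order and the last write wins, so the largest one remains. The
topmost vertex of a component is itself a candidate, which initializes its entry before any other is
considered. -/
theorem computeCent_runs {σ : Store} {N p : ℕ} {par wt cut : ℕ → ℕ} (hP : IsParents N p par wt)
    (h0 : cut 0 ≠ 0) (hC : Comps N par wt cut σ)
    (h59 : ∀ k < N, σ.ints 59 k = underSize N par cut k) :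
    Runs computeCent σ ((N + 1) * 50) (fun τ => IsCentroids N par cut (τ.ints 60)) := by
  refine (Runs.forUp_const (n := N) 37 (fun i τ =>
    (∀ t < N, cut t ≠ 0 → t < i → τ.ints 60 t < i ∧ top par cut (τ.ints 60 t) = t ∧
      underSize N par cut t < 2 * underSize N par cut (τ.ints 60 t)) ∧
    ∀ k < i, underSize N par cut (top par cut k) < 2 * underSize N par cut k →
      k ≤ τ.ints 60 (top par cut k)) (by decide) (by simp) ?_ ?_).mono
      (Nat.mul_le_mul_left _ (by decide)) fun τ _ h => ?_
  · intro τ hF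
    simp [hF.ints 40 (by decide), hC.size]
  · rintro k hk τ hF hv ⟨h1, h2⟩
    have htN := (top_le par cut k).trans_lt hk
    have f58 : τ.ints 58 k = top par cut k := by rw [hF.ints 58 (by decide), hC.tops k hk]
    have f59 : τ.ints 59 k = underSize N par cut k := by rw [hF.ints 59 (by decide), h59 k hk]
    have f59' : τ.ints 59 (top par cut k) = underSize N par cut (top par cut k) := by
      rw [hF.ints 59 (by decide), h59 _ htN]
    have hpos : 0 < underSize N par cut k := by rw [underSize_eq hP.lt h0 hk]; omega
    refine Runs.flat rfl (by decide) ?_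
    simp only [Prog.run, Test.holds_lt, IExp.eval, hv, f58, f59, f59']
    split_ifs with hlt
    · refine ⟨fun t ht htc htk => ?_, fun k' hk' hlt' => ?_⟩
      · by_cases htt : t = top par cut k
        · subst htt
          simp; omega
        · have := top_of_cut (par := par) htc
          have htk' : t ≠ k := by rintro rfl; exact htt this.symm
          obtain ⟨h3, h4, h5⟩ := h1 t ht htc (by omega)
          simpa [htt] using ⟨by omega, h4, h5⟩
      · by_cases htt : top par cut k' = top par cut k
        · simp [htt]; omega
        · have hne : k' ≠ k := by rintro rfl; exact htt rfl
          simpa [htt] using h2 k' (by omega) hlt'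
    · have htk : ∀ t, cut t ≠ 0 → t < k + 1 → t < k := by
        intro t htc ht
        rcases Nat.lt_succ_iff_lt_or_eq.mp ht with h | rfl
        · exact h
        · rw [top_of_cut htc] at hlt
          omega
      refine ⟨fun t ht htc htk' => ?_, fun k' hk' hlt' => ?_⟩
      · obtain ⟨h3, h4, h5⟩ := h1 t ht htc (htk t htc htk')
        simpa using ⟨by omega, h4, h5⟩
      · have hne : k' ≠ k := by rintro rfl; exact hlt (by omega)
        simpa using h2 k' (by omega) hlt'
  · exact ⟨fun t ht hc => (h.1.1 t ht hc ht).1, fun t ht hc => (h.1.1 t ht hc ht).2.1,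
      fun t ht hc => (h.1.1 t ht hc ht).2.2, h.1.2⟩

/-- Mark the vertices above the centroids, and compute the distances of all vertices from the
centroids of their components. -/
def computeDist : Prog :=
  forUp 64 (V 40) (.setI 62 (V 64) 0 ;; .ite (.eq (.get 60 (.get 58 (V 64))) (V 64))
    (.setI 61 (V 64) 1) (.setI 61 (V 64) 0)) ;;
  forUp 64 (V 40) (.setI 65 0 (V 40 - 1 - V 64) ;; .ite (.eq (.get 57 (V 65)) 0)
    (.ite (.eq (.get 61 (V 65)) 0) .skip (.setI 61 (.get 54 (V 65)) 1 ;;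
      .setI 62 (.get 54 (V 65)) (.get 55 (V 65) + .get 62 (V 65)))) .skip) ;;
  forUp 64 (V 40) (.ite (.eq (.get 61 (V 64)) 0)
    (.setI 62 (V 64) (.get 55 (V 64) + .get 62 (.get 54 (V 64)))) .skip)

/-- The upward pass marks the vertices above the centroid and finds their distances from it. For any
other vertex the path to the centroid starts with the edge to its parent, so a downward pass in
increasing order completes the table. -/
theorem computeDist_runs {σ : Store} {N p : ℕ} {par wt cut c : ℕ → ℕ} (hP : IsParents N p par wt)
    (h0 : cut 0 ≠ 0) (hC : Comps N par wt cut σ) (h60 : σ.ints 60 = c)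
    (hc : IsCentroids N par cut c) :
    Runs computeDist σ ((N + 1) * 250)
      (fun τ => ∀ k < N, τ.ints 62 k = tdist par wt (c (top par cut k)) k) := by
  refine Runs.le (T := (N + 1) * 60 + ((N + 1) * 100 + (N + 1) * 60)) ?_ (by omega)
  refine Runs.seq (mid := fun τ => ∀ k < N, τ.ints 62 k = 0 ∧
      (τ.ints 61 k ≠ 0 ↔ c (top par cut k) = k))
    ((Runs.forUp_const (n := N) 40 (fun i τ => ∀ k < i, τ.ints 62 k = 0 ∧
      (τ.ints 61 k ≠ 0 ↔ c (top par cut k) = k)) (by decide) (by simp) ?_ ?_).mono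
      (Nat.mul_le_mul_left _ (by decide)) fun τ _ h => h.1) fun τ1 F1 e1 => ?_
  · intro τ hF
    simp [hF.ints 40 (by decide), hC.size]
  · intro k hk τ hF hv hI
    have f58 : τ.ints 58 k = top par cut k := by rw [hF.ints 58 (by decide), hC.tops k hk]
    have f60 : τ.ints 60 = c := by rw [hF.ints 60 (by decide), h60]
    refine Runs.flat rfl (by decide) fun k' hk' => ?_
    simp only [Prog.run, Test.holds_eq, IExp.eval, Store.putI_ints, hv, f58, f60,
      Nat.reduceEqDiff, false_and, if_false]
    rcases Nat.lt_succ_iff_lt_or_eq.mp hk' with h | rfl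
    · have := hI k' h
      split_ifs <;> simpa [hv, h.ne] using this
    · split_ifs with h <;> simp [h]
  have a40 : τ1.ints 40 0 = N := by rw [F1.ints 40 (by decide), hC.size]
  have a54 : ∀ k < N, τ1.ints 54 k = par k := fun k hk => by rw [F1.ints 54 (by decide), hC.parents k hk]
  have a55 : ∀ k < N, τ1.ints 55 k = wt k := fun k hk => by rw [F1.ints 55 (by decide), hC.weights k hk]
  have a57 : ∀ k < N, τ1.ints 57 k = cut k := fun k hk => by rw [F1.ints 57 (by decide), hC.cuts k hk]
  have hzN : ∀ k < N, c (top par cut k) < N := fun k hk =>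
    hc.lt _ ((top_le _ _ k).trans_lt hk) (cut_top hP.lt h0 hk)
  have hzt : ∀ k < N, top par cut (c (top par cut k)) = top par cut k := fun k hk =>
    hc.top_eq _ ((top_le _ _ k).trans_lt hk) (cut_top hP.lt h0 hk)
  refine Runs.seq (mid := fun τ => ∀ k < N, (τ.ints 61 k ≠ 0 ↔
      Under par cut k (c (top par cut k))) ∧
      (τ.ints 61 k ≠ 0 → τ.ints 62 k = tdist par wt k (c (top par cut k))))
    ((Runs.forUp_const (n := N) 80 (fun i τ => (∀ k < N, τ.ints 61 k ≠ 0 →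
      Under par cut k (c (top par cut k)) ∧ τ.ints 62 k = tdist par wt k (c (top par cut k))) ∧
      (∀ k < N, c (top par cut k) = k → τ.ints 61 k ≠ 0) ∧
      ∀ k < N, N - i ≤ k → cut k = 0 → τ.ints 61 k ≠ 0 → τ.ints 61 (par k) ≠ 0)
      (by decide) ?_ ?_ ?_).mono
      (Nat.mul_le_mul_left _ (by decide)) fun τ _ h => ?_) fun τ2 F2 e2 => ?_
  · refine ⟨fun k hk h => ?_, fun k hk h => ?_, fun k hk h => by omega⟩
    · have h' := (e1 k hk).2.1 (by simpa using h)
      rw [h', tdist_self]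
      exact ⟨.refl, by simpa using (e1 k hk).1⟩
    · simpa using (e1 k hk).2.2 h
  · intro τ hF
    simp [hF.ints 40 (by decide), a40]
  · rintro i hi τ hF hv ⟨h1, h2, h3⟩
    set k := N - 1 - i with hk
    have hkN : k < N := by omega
    have f40 : τ.ints 40 0 = N := by rw [hF.ints 40 (by decide), a40]
    have f57 : τ.ints 57 k = cut k := by rw [hF.ints 57 (by decide), a57 k hkN]
    have f54 : τ.ints 54 k = par k := by rw [hF.ints 54 (by decide), a54 k hkN]
    have f55 : τ.ints 55 k = wt k := by rw [hF.ints 55 (by decide), a55 k hkN]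
    refine Runs.flat rfl (by decide) ?_
    simp only [Prog.run, IExp.eval, hv, f40, IExp.eval_sub', ← hk, Test.holds_eq,
      Store.putI_ints, and_self, if_true, Nat.reduceEqDiff, false_and, if_false, f57, f54]
    by_cases hck : cut k = 0
    · rw [if_pos hck]
      by_cases hm : τ.ints 61 k = 0
      · rw [if_pos hm]
        refine ⟨by simpa using h1, by simpa using h2, fun k' hk' hi' hc' => ?_⟩
        have : k' = k ∨ N - i ≤ k' := by omega
        rcases this with rfl | h
        · simp [hm]
        · simpa using h3 k' hk' h hc'
      · rw [if_neg hm]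
        obtain ⟨hu, hd⟩ := h1 k hkN hm
        have hpk := hP.lt k (pos_of_uncut h0 hck) hkN
        have htp := top_of_uncut hP.lt h0 hkN hck
        have hdist : tdist par wt (par k) (c (top par cut k)) =
            wt k + tdist par wt k (c (top par cut k)) := by
          have := tdist_dichotomy (wt := wt) hP.lt h0 hkN (hzN k hkN) hck (hzt k hkN).symm
          tauto
        refine ⟨fun k' hk' => ?_, fun k' hk' hz => ?_, fun k' hk' hi' hc' => ?_⟩
        · by_cases hkp : k' = par k
          · subst hkp
            rw [← htp]
            simp only [Store.putI_ints, f55, hd, hdist]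
            simp only [Nat.reduceEqDiff, false_and, and_self, if_true, if_false]
            intro _
            exact ⟨Under.trans (.step hck .refl) hu, trivial⟩
          · simpa [hkp, f54] using h1 k' hk'
        · by_cases hkp : k' = par k
          · simp [hkp]
          · simpa [hkp, f54] using h2 k' hk' hz
        · have hne : k' ≠ par k := by omega
          have : k' = k ∨ N - i ≤ k' := by omega
          rcases this with rfl | h
          · simp
          · have := h3 k' hk' h hc'
            simp only [Store.putI_ints, hne]
            by_cases hpp : par k' = par k
            · simp [hpp]
            · simpa [hpp, hne, f54] using this
    · rw [if_neg hck]
      refine ⟨by simpa using h1, by simpa using h2, fun k' hk' hi' hc' => ?_⟩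
      have : k' = k ∨ N - i ≤ k' := by omega
      rcases this with rfl | h
      · exact absurd hc' hck
      · simpa using h3 k' hk' h hc'
  · obtain ⟨⟨h1, h2, h3⟩, -⟩ := h
    intro k hk
    refine ⟨⟨fun h => (h1 k hk h).1, fun h => ?_⟩, fun h => (h1 k hk h).2⟩
    -- The invariant says that marks pass from a vertex to its parent along uncut edges; following
    -- them up from the centroid reaches `k`.
    have key : ∀ x < N, Under par cut k x → τ.ints 61 x ≠ 0 → τ.ints 61 k ≠ 0 := by
      intro x hx hu
      induction hu with
      | refl => exact id
      | step hc' _ ih =>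
        intro hm
        exact ih (hP.par_lt hx) (h3 _ hx (by omega) hc' hm)
    exact key _ (hzN k hk) h (h2 _ (hzN k hk) (by rw [hzt k hk]))
  · refine (Runs.forUp_const (n := N) 40 (fun i τ => (∀ k < i, τ.ints 62 k =
        tdist par wt k (c (top par cut k))) ∧ ∀ k < N, τ2.ints 61 k ≠ 0 → τ.ints 62 k =
        tdist par wt k (c (top par cut k)))
      (by decide) ⟨by simp, fun k hk h => by simpa using (e2 k hk).2 h⟩ ?_ ?_).mono
      (Nat.mul_le_mul_left _ (by decide)) fun τ _ h k hk => ?_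
    · intro τ hF
      simp [hF.ints 40 (by decide), F2.ints 40 (by decide), a40]
    · rintro k hk τ hF hv ⟨h1, h2⟩
      have f54 : τ.ints 54 k = par k := by
        rw [hF.ints 54 (by decide), F2.ints 54 (by decide), a54 k hk]
      have f55 : τ.ints 55 k = wt k := by
        rw [hF.ints 55 (by decide), F2.ints 55 (by decide), a55 k hk]
      have f61 : τ.ints 61 = τ2.ints 61 := hF.ints 61 (by decide)
      refine Runs.flat rfl (by decide) ?_
      simp only [Prog.run, Test.holds_eq, IExp.eval, hv, f54, f55, f61]
      by_cases hm : τ2.ints 61 k = 0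
      · rw [if_pos hm]
        -- Without a mark, `k` is not above the centroid; in particular it is not the topmost
        -- vertex, and its parent lies in the same component.
        have hu : ¬ Under par cut k (c (top par cut k)) := fun h => (e2 k hk).1.2 h hm
        have hck : cut k = 0 := by
          by_contra hck
          refine hu ((top_eq_iff_under hP.lt h0 hck (hzN k hk)).1 ?_)
          rw [hzt k hk, top_of_cut hck]
        have hpk := hP.lt k (pos_of_uncut h0 hck) hk
        have hdist : tdist par wt k (c (top par cut k)) =
            wt k + tdist par wt (par k) (c (top par cut k)) := by
          have := tdist_dichotomy (wt := wt) hP.lt h0 hk (hzN k hk) hck (hzt k hk).symm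
          tauto
        have hval := h1 _ hpk
        rw [← top_of_uncut hP.lt h0 hk hck] at hval
        refine ⟨fun k' hk' => ?_, fun k' hk' hm' => ?_⟩
        · rcases Nat.lt_succ_iff_lt_or_eq.mp hk' with h | rfl
          · simpa [h.ne] using h1 k' h
          · simp [hval, hdist]
        · have hne : k' ≠ k := by rintro rfl; exact hm' hm
          simpa [hne] using h2 k' hk' hm'
      · rw [if_neg hm]
        refine ⟨fun k' hk' => ?_, by simpa using h2⟩
        rcases Nat.lt_succ_iff_lt_or_eq.mp hk' with h | rfl
        · simpa using h1 k' h
        · simpa using h2 k' hk hm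
    · rw [h.1.1 k hk, tdist_comm]

def computeCut : Prog :=
  forUp 64 (V 40) (.ite (.eq (.get 60 (.get 58 (V 64))) (V 64)) (.setI 57 (V 64) 1)
    (.ite (.eq (.get 60 (.get 58 (.get 54 (V 64)))) (.get 54 (V 64))) (.setI 57 (V 64) 1) .skip))

theorem computeCut_runs {σ : Store} {N p : ℕ} {par wt cut c : ℕ → ℕ} (hP : IsParents N p par wt)
    (hC : Comps N par wt cut σ) (h60 : σ.ints 60 = c) :
    Runs computeCut σ ((N + 1) * 60) (fun τ => ∀ k < N, τ.ints 57 k = cutAt par cut c k) := by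
  refine Runs.fillI_zero (n := N) 60 57 (cutAt par cut c) (by decide) (by decide) rfl
    (by decide) (fun τ hF => by simp [hF.ints 40 (by decide), hC.size])
    (fun k hk τ hF hv hj _ => ?_)
  have f54 : τ.ints 54 k = par k := by rw [hF.ints 54 (by decide), hC.parents k hk]
  have f57 : τ.ints 57 k = cut k := by rw [hj k le_rfl, hC.cuts k hk]
  have f58 : τ.ints 58 k = top par cut k := by rw [hF.ints 58 (by decide), hC.tops k hk]
  have f58' : τ.ints 58 (par k) = top par cut (par k) := by
    rw [hF.ints 58 (by decide), hC.tops _ (hP.par_lt hk)]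
  have f60 : τ.ints 60 = c := by rw [hF.ints 60 (by decide), h60]
  simp only [Prog.run, Test.holds_eq, IExp.eval, hv, f54, f58, f58', f60, cutAt]
  by_cases h1 : c (top par cut k) = k
  · rw [if_pos h1, if_pos (Or.inl h1)]
  · rw [if_neg h1]
    by_cases h2 : c (top par cut (par k)) = par k
    · rw [if_pos h2, if_pos (Or.inr h2)]
    · rw [if_neg h2, if_neg (by tauto)]
      funext j
      by_cases hjk : j = k <;> simp [hjk, f57]

end FTFI

namespace FTFI

open Finset

/-! ## Centroid decomposition -/

/-- Add the contributions of the pairs of vertices that are separated by the centroids of their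
component, and cut the components at the centroids. -/
def centroidRound : Prog :=
  computeSize ;; computeCent ;; computeDist ;;
  .setS 32 0 (.ofNat 1) ;; groupSum ;;
  computeCut ;; computeTop ;;
  .setS 32 0 (.ofNat 0 - .ofNat 1) ;; groupSum

/-- The cost of adding the sums over all groups. -/
def sumCost (N p : ℕ) : ℕ := (Nat.clog 2 (4 * (p * N)) + 1) * (p * N)

theorem le_sumCost {N p : ℕ} (hp : 0 < p) : N ≤ sumCost N p :=
  (Nat.le_mul_of_pos_left _ hp).trans (Nat.le_mul_of_pos_left _ (by omega))

/-- The sum over the vertices that are separated from `x`. -/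
noncomputable def sepSum (N : ℕ) (F : ℕ → ℂ) (par wt cut : ℕ → ℕ) (X : ℕ → ℂ) (x : ℕ) : ℂ :=
  ∑ y ∈ (range N).filter (fun y => top par cut y ≠ top par cut x), F (tdist par wt x y) * X y

/-- Pairs that stay together cancel in the difference of the last two sums. Pairs that are separated
now contribute the true distance, by `tdist_separated`; pairs separated earlier occur only in the
first sum. -/
theorem sepSum_cutAt {N p : ℕ} {par wt cut c : ℕ → ℕ} (hP : IsParents N p par wt) (h0 : cut 0 ≠ 0)
    (hc : IsCentroids N par cut c) (F : ℕ → ℂ) (X : ℕ → ℂ) {x : ℕ} (hx : x < N) :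
    sepSum N F par wt cut X x +
      ∑ y ∈ (range N).filter (fun y => top par cut y = top par cut x),
        F (tdist par wt (c (top par cut x)) x + tdist par wt (c (top par cut y)) y) * X y -
      ∑ y ∈ (range N).filter (fun y => top par (cutAt par cut c) y = top par (cutAt par cut c) x),
        F (tdist par wt (c (top par cut x)) x + tdist par wt (c (top par cut y)) y) * X y =
      sepSum N F par wt (cutAt par cut c) X x := by
  rw [sepSum, sepSum, sum_filter, sum_filter, sum_filter, sum_filter, ← sum_add_distrib,
    ← sum_sub_distrib]
  refine sum_congr rfl fun y hy => ?_
  rw [mem_range] at hy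
  by_cases h' : top par (cutAt par cut c) y = top par (cutAt par cut c) x
  · have h := top_eq_of_cutAt hP.lt h0 hy hx h'
    simp [h, h']
  · by_cases h : top par cut y = top par cut x
    · have := tdist_separated hP.lt hP.pos h0 (c := c) (fun v hv =>
        hc.lt _ ((top_le _ _ v).trans_lt hv) (cut_top hP.lt h0 hv)) hx hy h.symm (Ne.symm h')
      rw [this]
      simp [h, h']
    · simp [h, h']

/-- The distances from the centroids are computed once and used for both sums, with the old
components as groups and sign 1, then with the new parts and sign $-1$. -/
theorem centroidRound_runs {σ : Store} {N p q : ℕ} {par wt cut : ℕ → ℕ} {u v w : ℂ} {X : ℕ → ℂ}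
    (hN : 0 < N) (hp : 0 < p) (hP : IsParents N p par wt) (h0 : cut 0 ≠ 0)
    (hC : Comps N par wt cut σ) (h56 : σ.ints 56 0 = q) (hu : σ.nums 0 0 = u) (hv : σ.nums 0 1 = v)
    (hw : σ.nums 0 2 = w) (hX : ∀ y < N, σ.nums 30 y = X y)
    (hout : ∀ x < N, σ.nums 31 x = sepSum N (quadVal u v w q) par wt cut X x) :
    Runs centroidRound σ (42000 * sumCost N p) (fun τ => ∃ c, IsCentroids N par cut c ∧
      Comps N par wt (cutAt par cut c) τ ∧
      ∀ x < N, τ.nums 31 x = sepSum N (quadVal u v w q) par wt (cutAt par cut c) X x) := by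
  refine Runs.le (T := (N + 1) * 100 + ((N + 1) * 50 + ((N + 1) * 250 + (10 + (20000 * sumCost N p +
    ((N + 1) * 60 + ((N + 1) * 50 + (10 + 20000 * sumCost N p)))))))) ?_
    (by have := le_sumCost (N := N) hp; omega)
  refine Runs.seq (computeSize_runs hP h0 hC) fun τ1 F1 e1 => ?_
  have hC1 : Comps N par wt cut τ1 := hC.of_frame (F1.ints 40 (by decide)) (F1.ints 54 (by decide))
    (F1.ints 55 (by decide)) (F1.ints 57 (by decide)) (F1.ints 58 (by decide))
  refine Runs.seq (computeCent_runs hP h0 hC1 e1) fun τ2 F2 hc => ?_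
  have hC2 : Comps N par wt cut τ2 := hC1.of_frame (F2.ints 40 (by decide)) (F2.ints 54 (by decide))
    (F2.ints 55 (by decide)) (F2.ints 57 (by decide)) (F2.ints 58 (by decide))
  set c := τ2.ints 60 with hcdef
  refine Runs.seq (computeDist_runs hP h0 hC2 rfl hc) fun τ3 F3 e3 => ?_
  have hC3 : Comps N par wt cut τ3 := hC2.of_frame (F3.ints 40 (by decide)) (F3.ints 54 (by decide))
    (F3.ints 55 (by decide)) (F3.ints 57 (by decide)) (F3.ints 58 (by decide))
  have a56 : τ3.ints 56 0 = q := by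
    rw [F3.ints 56 (by decide), F2.ints 56 (by decide), F1.ints 56 (by decide), h56]
  have a60 : τ3.ints 60 = c := by rw [F3.ints 60 (by decide)]
  have aS : ∀ A, τ3.nums A = σ.nums A := fun A => by
    rw [F3.nums A (by simp [computeDist, forUp, Prog.wS]),
      F2.nums A (by simp [computeCent, forUp, Prog.wS]),
      F1.nums A (by simp [computeSize, forUp, Prog.wS])]
  refine Runs.pre 10 rfl (by decide) le_rfl ?_
  set τ4 := (Prog.setS 32 0 (.ofNat 1)).run τ3 with hτ4
  have b4 : τ4.ints = τ3.ints := rfl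
  have bS : ∀ A, A ≠ 32 → τ4.nums A = σ.nums A := fun A hA => by
    funext j; simp [hτ4, hA, aS]
  have b32 : τ4.nums 32 0 = 1 := by simp [hτ4]
  set d : ℕ → ℕ := fun x => tdist par wt (c (top par cut x)) x with hd
  refine Runs.seq (groupSum_runs (lab := top par cut) (d := d) (u := u) (v := v) (w := w) (q := q)
    hN hp (by rw [b4, hC3.size]) (by rw [b4, a56]) (fun x hx => (top_le _ _ x).trans_lt hx)
    (fun x hx => by rw [b4, hC3.tops x hx]) (fun x hx => by rw [b4, e3 x hx])
    (fun x hx => tdist_le_card_top hP.lt hP.pos hP.le h0 hc hx)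
    (by rw [bS 0 (by decide), hu]) (by rw [bS 0 (by decide), hv]) (by rw [bS 0 (by decide), hw]))
    fun τ5 F5 e5 => ?_
  have hC5 : Comps N par wt cut τ5 := hC3.of_frame (F5.ints 40 (by decide)) (F5.ints 54 (by decide))
    (F5.ints 55 (by decide)) (F5.ints 57 (by decide)) (F5.ints 58 (by decide))
  refine Runs.seq (computeCut_runs (c := c) hP hC5 (by rw [F5.ints 60 (by decide), b4, a60]))
    fun τ6 F6 e6 => ?_
  refine Runs.seq (computeTop_runs hP (cutAt_zero h0 c)
    (by rw [F6.ints 40 (by decide), hC5.size])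
    (fun k hk => by rw [F6.ints 54 (by decide), hC5.parents k hk]) e6) fun τ7 F7 e7 => ?_
  have hC7 : Comps N par wt (cutAt par cut c) τ7 :=
    ⟨by rw [F7.ints 40 (by decide), F6.ints 40 (by decide), hC5.size],
      fun k hk => by rw [F7.ints 54 (by decide), F6.ints 54 (by decide), hC5.parents k hk],
      fun k hk => by rw [F7.ints 55 (by decide), F6.ints 55 (by decide), hC5.weights k hk],
      fun k hk => by rw [F7.ints 57 (by decide), e6 k hk], e7⟩
  have d56 : τ7.ints 56 0 = q := by
    rw [F7.ints 56 (by decide), F6.ints 56 (by decide), F5.ints 56 (by decide), b4, a56]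
  have d62 : ∀ x < N, τ7.ints 62 x = d x := fun x hx => by
    rw [F7.ints 62 (by decide), F6.ints 62 (by decide), F5.ints 62 (by decide), b4, e3 x hx]
  have dS : ∀ A, τ7.nums A = τ5.nums A := fun A => by
    rw [F7.nums A (by simp [computeTop, forUp, Prog.wS]),
      F6.nums A (by simp [computeCut, forUp, Prog.wS])]
  refine Runs.pre 10 rfl (by decide) le_rfl ?_
  set τ8 := (Prog.setS 32 0 (.ofNat 0 - .ofNat 1)).run τ7 with hτ8
  have g8 : τ8.ints = τ7.ints := rfl
  have gS : ∀ A, A ≠ 32 → τ8.nums A = τ5.nums A := fun A hA => by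
    funext j; simp [hτ8, hA, dS]
  have g32 : τ8.nums 32 0 = -1 := by simp [hτ8]
  have g0 : τ8.nums 0 = σ.nums 0 := by
    rw [gS 0 (by decide), F5.nums 0 (by decide), bS 0 (by decide)]
  have g30 : τ8.nums 30 = σ.nums 30 := by
    rw [gS 30 (by decide), F5.nums 30 (by decide), bS 30 (by decide)]
  refine (groupSum_runs (lab := top par (cutAt par cut c)) (d := d) (u := u) (v := v) (w := w)
    (q := q) hN hp (by rw [g8, hC7.size]) (by rw [g8, d56]) (fun x hx => (top_le _ _ x).trans_lt hx)
    (fun x hx => by rw [g8, e7 x hx]) (fun x hx => by rw [g8, d62 x hx])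
    (fun x hx => tdist_le_card_top_cutAt hP.lt hP.pos hP.le h0 hc hx)
    (by rw [g0, hu]) (by rw [g0, hv]) (by rw [g0, hw])).mono le_rfl fun τ F e => ⟨c, hc, ?_, ?_⟩
  · exact hC7.of_frame (F.ints 40 (by decide)) (F.ints 54 (by decide))
      (F.ints 55 (by decide)) (F.ints 57 (by decide)) (F.ints 58 (by decide))
  · intro x hx
    rw [e x hx, gS 31 (by decide), e5 x hx, bS 31 (by decide), hout x hx, b32, g32, g30,
      bS 30 (by decide), ← sepSum_cutAt hP h0 hc (quadVal u v w q) X hx, one_mul, neg_one_mul,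
      ← sub_eq_add_neg]
    congr 1
    · congr 1
      exact sum_congr rfl fun y hy => by rw [hX y (mem_range.1 (mem_filter.1 hy).1)]
    · exact sum_congr rfl fun y hy => by rw [hX y (mem_range.1 (mem_filter.1 hy).1)]

/-- Integration of the field in the array `30`. -/
def treeSum : Prog :=
  forUp 64 (V 40) (.setI 57 (V 64) 0) ;;
  .setI 57 0 1 ;;
  computeTop ;;
  forUp 64 (V 40) (.setS 31 (V 64) (.ofNat 0)) ;;
  .setI 63 0 (V 40) ;;
  .loop (.lt 1 (V 63)) (centroidRound ;; .setI 63 0 (.half (V 63))) ;;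
  forUp 64 (V 40) (.setS 31 (V 64) (.get 31 (V 64) + .exp (.get 0 2) * .get 30 (V 64)))

/-- After $k$ rounds the components have at most $\max(1,\lfloor N/2^k\rfloor)$ vertices. After
$\lfloor\log_2N\rfloor$ rounds they are singletons, so all pairs of different vertices have been
counted and only the diagonal is missing. -/
theorem treeSum_runs {σ : Store} {N p q : ℕ} {par wt : ℕ → ℕ} {u v w : ℂ} {X : ℕ → ℂ}
    (hN : 0 < N) (hp : 0 < p) (hP : IsParents N p par wt)
    (h40 : σ.ints 40 0 = N) (h54 : ∀ k < N, σ.ints 54 k = par k) (h55 : ∀ k < N, σ.ints 55 k = wt k)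
    (h56 : σ.ints 56 0 = q) (hu : σ.nums 0 0 = u) (hv : σ.nums 0 1 = v)
    (hw : σ.nums 0 2 = w) (hX : ∀ y < N, σ.nums 30 y = X y) :
    Runs treeSum σ (43000 * ((Nat.log 2 N + 1) * sumCost N p)) (fun τ => ∀ x < N, τ.nums 31 x =
      ∑ y ∈ range N, quadVal u v w q (tdist par wt x y) * X y) := by
  set F := quadVal u v w q with hF
  refine Runs.le (T := (N + 1) * 30 + (10 + ((N + 1) * 50 + ((N + 1) * 30 + (10 +
    (((Nat.log 2 N) * (20 + 42000 * sumCost N p) + 20) + (N + 1) * 50)))))) ?_ ?_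
  · refine Runs.seq (Runs.fillI_zero (n := N) 30 57 (fun _ => 0) (by decide) (by decide) rfl
      (by decide) (fun τ hF => by simp [hF.ints 40 (by decide), h40])
      (fun k hk τ hF hv _ _ => by simp [hv])) fun τ1 F1 e1 => ?_
    refine Runs.pre 10 rfl (by decide) le_rfl ?_
    set τ2 := (Prog.setI 57 0 1).run τ1 with hτ2
    let cut0 : ℕ → ℕ := fun k => if k = 0 then 1 else 0
    have hc0 : cut0 0 ≠ 0 := by simp [cut0]
    have a57 : ∀ k < N, τ2.ints 57 k = cut0 k := fun k hk => by
      by_cases h : k = 0 <;> simp [hτ2, cut0, h, e1 k hk]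
    have aI : ∀ A, A ≠ 57 → A ≠ 64 → τ2.ints A = σ.ints A := fun A h h' => by
      rw [← F1.ints A (by simp [forUp, Prog.wI, h, h'])]; funext j; simp [hτ2, h]
    refine Runs.seq (computeTop_runs hP hc0 (by rw [aI 40 (by decide) (by decide), h40])
      (fun k hk => by rw [aI 54 (by decide) (by decide), h54 k hk]) a57) fun τ3 F3 e3 => ?_
    have hC3 : Comps N par wt cut0 τ3 :=
      ⟨by rw [F3.ints 40 (by decide), aI 40 (by decide) (by decide), h40],
        fun k hk => by rw [F3.ints 54 (by decide), aI 54 (by decide) (by decide), h54 k hk],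
        fun k hk => by rw [F3.ints 55 (by decide), aI 55 (by decide) (by decide), h55 k hk],
        fun k hk => by rw [F3.ints 57 (by decide), a57 k hk], e3⟩
    refine Runs.seq (Runs.fillS_zero (n := N) 30 31 (fun _ => 0) (by decide) rfl
      (by decide) (fun τ hF => by simp [hF.ints 40 (by decide), hC3.size])
      (fun k hk τ hF hv _ => by simp [hv])) fun τ4 F4 e4 => ?_
    have hC4 : Comps N par wt cut0 τ4 := hC3.of_frame (F4.ints 40 (by decide))
      (F4.ints 54 (by decide)) (F4.ints 55 (by decide)) (F4.ints 57 (by decide))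
      (F4.ints 58 (by decide))
    have b56 : τ4.ints 56 0 = q := by
      rw [F4.ints 56 (by decide), F3.ints 56 (by decide), aI 56 (by decide) (by decide), h56]
    have bS : ∀ A, A ≠ 31 → τ4.nums A = σ.nums A := fun A hA => by
      rw [F4.nums A (by simp [forUp, Prog.wS, hA]), F3.nums A (by simp [computeTop, forUp, Prog.wS]),
        show τ2.nums A = τ1.nums A from rfl, F1.nums A (by simp [forUp, Prog.wS])]
    refine Runs.pre 10 rfl (by decide) le_rfl ?_
    set τ5 := (Prog.setI 63 0 (V 40)).run τ4 with hτ5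
    have cI : ∀ A, A ≠ 63 → τ5.ints A = τ4.ints A := fun A h => by
      funext j; simp [hτ5, h]
    have hC5 : Comps N par wt cut0 τ5 := hC4.of_frame (cI 40 (by decide))
      (cI 54 (by decide)) (cI 55 (by decide)) (cI 57 (by decide)) (cI 58 (by decide))
    have hroot : ∀ x < N, top par cut0 x = 0 := fun x hx => by
      have := cut_top hP.lt hc0 hx
      by_contra h
      exact this (if_neg h)
    refine Runs.seq (mid := fun τ => τ.ints 40 0 = N ∧ ∀ x < N, τ.nums 31 x =
        ∑ y ∈ (range N).filter (fun y => y ≠ x), F (tdist par wt x y) * X y)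
      ((Runs.loop (n := Nat.log 2 N) (fun _ => 42000 * sumCost N p + 10) (fun k τ =>
      ∃ cut, cut 0 ≠ 0 ∧ Comps N par wt cut τ ∧ τ.ints 63 0 = N / 2 ^ k ∧
        (∀ x < N, ((range N).filter fun y => top par cut y = top par cut x).card ≤
          max 1 (N / 2 ^ k)) ∧
        ∀ x < N, τ.nums 31 x = sepSum N F par wt cut X x) ?_ ?_ ?_).mono ?_ ?_) fun τ6 F6 e6 => ?_
    -- With only the root cut there is one component and no separated pair.
    · refine ⟨cut0, hc0, hC5, ?_, fun x hx => ?_, fun x hx => ?_⟩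
      · simp [hτ5, hC4.size]
      · refine (card_filter_le _ _).trans ?_
        simp
      · rw [show τ5.nums 31 x = 0 from e4 x hx, sepSum, filter_false_of_mem, sum_empty]
        intro y hy
        rw [hroot y (mem_range.1 hy), hroot x hx]
        simp
    · rintro k hk τ hF ⟨cut, h0, hC, hL, hcard, hout⟩
      have hlog : 2 ^ (k + 1) ≤ N := Nat.pow_le_of_le_log (by omega) (by omega)
      have hL2 : 1 < N / 2 ^ k := by
        have : 2 ≤ N / 2 ^ k := by
          rw [Nat.le_div_iff_mul_le (by positivity)]
          rw [pow_succ] at hlog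
          omega
        omega
      refine ⟨by simpa [hL] using hL2, ?_⟩
      refine Runs.seq (centroidRound_runs (u := u) (v := v) (w := w) (q := q) (X := X) hN hp hP h0
        hC ?_ ?_ ?_ ?_ ?_ hout) fun τ' F' h' => ?_
      · rw [hF.ints 56 (by decide), cI 56 (by decide), b56]
      · rw [hF.nums 0 (by decide), show τ5.nums 0 = τ4.nums 0 from rfl, bS 0 (by decide), hu]
      · rw [hF.nums 0 (by decide), show τ5.nums 0 = τ4.nums 0 from rfl, bS 0 (by decide), hv]
      · rw [hF.nums 0 (by decide), show τ5.nums 0 = τ4.nums 0 from rfl, bS 0 (by decide), hw]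
      · intro y hy
        rw [hF.nums 30 (by decide), show τ5.nums 30 = τ4.nums 30 from rfl, bS 30 (by decide), hX y hy]
      · obtain ⟨c, hc, hC', hout'⟩ := h'
        refine Runs.flat rfl (by decide) ⟨cutAt par cut c, cutAt_zero h0 c, ?_, ?_, ?_, hout'⟩
        · exact hC'.of_frame (by funext j; simp) (by funext j; simp) (by funext j; simp)
            (by funext j; simp) (by funext j; simp)
        · simp [F'.ints 63 (by decide), hL, Nat.div_div_eq_div_mul, pow_succ]
        · intro x hx
          have h1 := card_cutAt_le hP.lt h0 hc hx
          have h2 := hcard x hx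
          rw [pow_succ, ← Nat.div_div_eq_div_mul]
          omega
    · rintro τ hF ⟨cut, h0, hC, hL, hcard, hout⟩
      have := Nat.lt_pow_succ_log_self (b := 2) (by omega) N
      have : N / 2 ^ Nat.log 2 N < 2 := by
        rw [Nat.div_lt_iff_lt_mul (by positivity)]
        rw [pow_succ] at this
        omega
      simp [hL]
      omega
    · have e : (Test.lt 1 (V 63)).cost = 4 := rfl
      simp only [e, sum_const, card_range, smul_eq_mul]
      have : Nat.log 2 N * (4 + (42000 * sumCost N p + 10)) ≤
        Nat.log 2 N * (20 + 42000 * sumCost N p) := Nat.mul_le_mul_left _ (by omega)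
      omega
    · rintro τ hF ⟨cut, h0, hC, hL, hcard, hout⟩
      refine ⟨hC.size, fun x hx => ?_⟩
      rw [hout x hx, sepSum]
      refine sum_congr (filter_congr fun y hy => not_congr ⟨fun h => ?_, fun h => by rw [h]⟩)
        fun _ _ => rfl
      have := Nat.lt_pow_succ_log_self (b := 2) (by omega) N
      have hlt : N / 2 ^ Nat.log 2 N < 2 := by
        rw [Nat.div_lt_iff_lt_mul (by positivity)]
        rw [pow_succ] at this
        omega
      have h1 : ((range N).filter fun y => top par cut y = top par cut x).card ≤ 1 :=
        (hcard x hx).trans (by omega)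
      exact card_le_one.1 h1 y (mem_filter.2 ⟨hy, h⟩) x (mem_filter.2 ⟨mem_range.2 hx, rfl⟩)
    · refine Runs.fillS_zero (n := N) 50 31 (fun x => ∑ y ∈ range N, F (tdist par wt x y) * X y)
        (by decide) rfl (by decide) (fun τ hF => by simp [hF.ints 40 (by decide), e6.1])
        (fun k hk τ hF' hv hj => ?_)
      have f31 : τ.nums 31 k = _ := (hj k le_rfl).trans (e6.2 k hk)
      have f0 : τ.nums 0 2 = w := by
        rw [hF'.nums 0 (by decide), F6.nums 0 (by decide), show τ5.nums 0 = τ4.nums 0 from rfl,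
          bS 0 (by decide), hw]
      have f30 : τ.nums 30 k = X k := by
        rw [hF'.nums 30 (by decide), F6.nums 30 (by decide), show τ5.nums 30 = τ4.nums 30 from rfl,
          bS 30 (by decide), hX k hk]
      -- The diagonal term $f(0)=e^w$, added by the last loop.
      have hF0 : F (tdist par wt k k) = Complex.exp w := by simp [hF, quadVal]
      rw [← add_sum_erase _ _ (mem_range.2 hk), hF0, add_comm, ← filter_ne']
      funext j
      simp only [Prog.run, Store.putS_nums, IExp.eval, hv, SExp.eval,
        f31, f0, f30]
  · have h1 := le_sumCost (N := N) hp
    have h2 : (Nat.log 2 N + 1) * sumCost N p = Nat.log 2 N * sumCost N p + sumCost N p := by ring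
    have h3 : Nat.log 2 N * (20 + 42000 * sumCost N p) =
      20 * Nat.log 2 N + 42000 * (Nat.log 2 N * sumCost N p) := by ring
    have h4 : Nat.log 2 N ≤ Nat.log 2 N * sumCost N p := Nat.le_mul_of_pos_right _ (by omega)
    omega

end FTFI

namespace FTFI

open Finset

/-! ## Rooting the tree by removing the leaves one by one -/

/-- Degrees, sums of the neighbours, and sums of the weights of the edges. -/
def edgeSums : Prog :=
  forUp 46 (V 40 - 1) (
    .setI 47 0 (.get 1 (V 46)) ;; .setI 48 0 (.get 2 (V 46)) ;; .setI 49 0 (.get 3 (V 46)) ;;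
    .setI 41 (V 47) (.get 41 (V 47) + 1) ;; .setI 41 (V 48) (.get 41 (V 48) + 1) ;;
    .setI 42 (V 47) (.get 42 (V 47) + V 48) ;; .setI 42 (V 48) (.get 42 (V 48) + V 47) ;;
    .setI 43 (V 47) (.get 43 (V 47) + V 49) ;; .setI 43 (V 48) (.get 43 (V 48) + V 49))

/-- Append the vertex `x` to the queue if it is a leaf and not the root. -/
def pushLeaf (x : IExp) : Prog :=
  .ite (.eq (.get 41 x) 1) (.ite (.eq x 0) .skip
    (.setI 44 (V 45) x ;; .setI 45 0 (V 45 + 1))) .skip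

def peelStep : Prog :=
  (.setI 47 0 (.get 44 (V 46)) ;; .setI 48 0 (.get 42 (V 47)) ;; .setI 49 0 (.get 43 (V 47)) ;;
    .setI 50 (V 47) (V 48) ;; .setI 51 (V 47) (V 49) ;;
    .setI 41 (V 48) (.get 41 (V 48) - 1) ;; .setI 42 (V 48) (.get 42 (V 48) - V 47) ;;
    .setI 43 (V 48) (.get 43 (V 48) - V 49)) ;;
  pushLeaf (V 48)

def peel : Prog :=
  edgeSums ;;
  .setI 45 0 0 ;;
  forUp 46 (V 40) (pushLeaf (V 46)) ;;
  forUp 46 (V 40 - 1) peelStep ;;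
  .setI 44 (V 40 - 1) 0 ;;
  forUp 46 (V 40) (.setI 52 (.get 44 (V 46)) (V 40 - 1 - V 46)) ;;
  forUp 46 (V 40) (.setI 53 (V 46) (.get 44 (V 40 - 1 - V 46)) ;;
    .setI 54 (V 46) (.get 52 (.get 50 (.get 53 (V 46)))) ;;
    .setI 55 (V 46) (.get 51 (.get 53 (V 46))))

section

variable {N : ℕ} {G : SimpleGraph (Fin N)} {e : Sym2 (Fin N) → ℕ}

open Classical in
/-- The neighbours of `v` in `R`. -/
noncomputable def nbr (G : SimpleGraph (Fin N)) (R : Finset (Fin N)) (v : Fin N) : Finset (Fin N) :=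
  R.filter (G.Adj v)

theorem mem_nbr {R : Finset (Fin N)} {v w : Fin N} : w ∈ nbr G R v ↔ w ∈ R ∧ G.Adj v w := by
  classical
  rw [nbr, mem_filter]

/-- The list has $N-1$ entries and covers the $N-1$ edges of the tree, so no edge is listed twice
and the degrees are counted correctly. -/
theorem edgeList_injective (hG : G.IsTree) {E : Fin (N - 1) → Fin N × Fin N}
    (hE : IsEdgeList G E) : Function.Injective fun k => s((E k).1, (E k).2) := by
  classical
  have himg : univ.image (fun k => s((E k).1, (E k).2)) = G.edgeFinset := by
    ext ε
    induction ε with | _ i j => ?_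
    rw [SimpleGraph.mem_edgeFinset, SimpleGraph.mem_edgeSet, hE i j]
    simp only [mem_image, mem_univ, true_and, Sym2.eq_iff, Prod.ext_iff]
  have hcard : (univ.image fun k => s((E k).1, (E k).2)).card = (univ : Finset (Fin (N - 1))).card := by
    rw [himg, card_univ, Fintype.card_fin]
    have := hG.card_edgeFinset
    rw [Fintype.card_fin] at this
    omega
  have := card_image_iff.1 hcard
  rwa [coe_univ, Set.injOn_univ] at this

theorem sum_edgeList (hG : G.IsTree) {E : Fin (N - 1) → Fin N × Fin N} (hE : IsEdgeList G E)
    (v : Fin N) (g : Fin N → ℕ) :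
    ∑ k, ((if (E k).1 = v then g (E k).2 else 0) + (if (E k).2 = v then g (E k).1 else 0)) =
      ∑ w ∈ nbr G univ v, g w := by
  classical
  have h1 : ∀ w, (∑ k, ((if E k = (v, w) then g w else 0) + (if E k = (w, v) then g w else 0))) =
      if G.Adj v w then g w else 0 := by
    intro w
    by_cases hadj : G.Adj v w
    · rw [if_pos hadj]
      obtain ⟨k, hk⟩ := (hE v w).1 hadj
      have hne : v ≠ w := hadj.ne
      rw [sum_eq_single_of_mem k (mem_univ k)]
      · rcases hk with h | h <;> simp [h, hne, hne.symm]
      · intro k' _ hk'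
        have : ∀ k', E k' = (v, w) ∨ E k' = (w, v) → s((E k').1, (E k').2) = s(v, w) := by
          rintro k' (h | h) <;> simp [h, Sym2.eq_swap]
        have h' : ¬ (E k' = (v, w) ∨ E k' = (w, v)) := fun h =>
          hk' (edgeList_injective hG hE ((this k' h).trans (this k hk).symm))
        rw [not_or] at h'
        rw [if_neg h'.1, if_neg h'.2, add_zero]
    · rw [if_neg hadj]
      refine sum_eq_zero fun k _ => ?_
      rw [if_neg fun h => hadj ((hE v w).2 ⟨k, Or.inl h⟩),
        if_neg fun h => hadj ((hE v w).2 ⟨k, Or.inr h⟩), add_zero]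
  rw [nbr, sum_filter, ← sum_congr rfl fun w _ => h1 w, sum_comm]
  refine sum_congr rfl fun k _ => ?_
  rw [sum_add_distrib]
  congr 1
  · by_cases h : (E k).1 = v
    · rw [if_pos h, sum_eq_single_of_mem (E k).2 (mem_univ _),
        if_pos (show E k = (v, (E k).2) from Prod.ext h rfl)]
      intro w _ hw
      rw [if_neg]
      intro h'
      rw [h'] at hw
      exact hw rfl
    · rw [if_neg h]
      refine (sum_eq_zero fun w _ => ?_).symm
      rw [if_neg]
      intro h'
      rw [h'] at h
      exact h rfl
  · by_cases h : (E k).2 = v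
    · rw [if_pos h, sum_eq_single_of_mem (E k).1 (mem_univ _),
        if_pos (show E k = ((E k).1, v) from Prod.ext rfl h)]
      intro w _ hw
      rw [if_neg]
      intro h'
      rw [h'] at hw
      exact hw rfl
    · rw [if_neg h]
      refine (sum_eq_zero fun w _ => ?_).symm
      rw [if_neg]
      intro h'
      rw [h'] at h
      exact h rfl

/-- No adjacency lists are built. For a vertex with one remaining neighbour, the sum of the
neighbours is that neighbour and the sum of the weights is the weight of its edge, and both sums are
easily updated when a leaf is removed. -/
theorem edgeSums_runs (hG : G.IsTree) {E : Fin (N - 1) → Fin N × Fin N} (hE : IsEdgeList G E)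
    {σ : Store} (h40 : σ.ints 40 0 = N) (h1 : ∀ k : Fin (N - 1), σ.ints 1 k = (E k).1)
    (h2 : ∀ k : Fin (N - 1), σ.ints 2 k = (E k).2)
    (h3 : ∀ k : Fin (N - 1), σ.ints 3 k = e s((E k).1, (E k).2))
    (h41 : ∀ v, σ.ints 41 v = 0) (h42 : ∀ v, σ.ints 42 v = 0) (h43 : ∀ v, σ.ints 43 v = 0) :
    Runs edgeSums σ ((N + 1) * 150) (fun τ => ∀ v : Fin N, τ.ints 41 v = (nbr G univ v).card ∧
      τ.ints 42 v = ∑ w ∈ nbr G univ v, (w : ℕ) ∧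
      τ.ints 43 v = ∑ w ∈ nbr G univ v, e s(v, w)) := by
  set S : ℕ → Finset (Fin (N - 1)) := fun j => univ.filter fun k : Fin (N - 1) => k.val < j with hS
  refine (Runs.forUp_const (n := N - 1) 120 (fun j τ => ∀ v : Fin N,
    τ.ints 41 v = ∑ k ∈ S j, ((if (E k).1 = v then 1 else 0) + (if (E k).2 = v then 1 else 0)) ∧
    τ.ints 42 v = ∑ k ∈ S j,
      ((if (E k).1 = v then ((E k).2 : ℕ) else 0) + (if (E k).2 = v then ((E k).1 : ℕ) else 0)) ∧
    τ.ints 43 v = ∑ k ∈ S j, ((if (E k).1 = v then e s(v, (E k).2) else 0) +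
      (if (E k).2 = v then e s(v, (E k).1) else 0))) (by decide) ?_ ?_ ?_).mono
    (Nat.mul_le_mul (by omega) (by decide)) fun τ _ h v => ?_
  · intro v
    simp [hS, h41, h42, h43]
  · intro τ hF
    simp [hF.ints 40 (by decide), h40]
  · intro j hj τ hF hv hI
    set k : Fin (N - 1) := ⟨j, hj⟩ with hk
    have hSj : S (j + 1) = insert k (S j) := by
      ext x
      simp only [hS, mem_filter, mem_univ, true_and, mem_insert, hk, Fin.ext_iff]
      omega
    have hnot : k ∉ S j := by simp [hS, hk]
    have f1 : τ.ints 1 j = (E k).1 := by rw [hF.ints 1 (by decide)]; exact h1 k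
    have f2 : τ.ints 2 j = (E k).2 := by rw [hF.ints 2 (by decide)]; exact h2 k
    have f3 : τ.ints 3 j = e s((E k).1, (E k).2) := by rw [hF.ints 3 (by decide)]; exact h3 k
    have hne : (E k).1 ≠ (E k).2 := ((hE _ _).2 ⟨k, Or.inl rfl⟩).ne
    refine Runs.flat rfl (by decide) fun v => ?_
    obtain ⟨i1, i2, i3⟩ := hI v
    rw [hSj, sum_insert hnot, sum_insert hnot, sum_insert hnot, ← i1, ← i2, ← i3]
    simp only [Prog.run, Store.putI_ints, IExp.eval, hv, f1, f2, f3,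
      Nat.reduceEqDiff, false_and, true_and, if_false, if_true, Fin.val_inj, and_self]
    by_cases ha : v = (E k).1
    · subst ha
      simp [hne, hne.symm, add_comm]
    · by_cases hb : v = (E k).2
      · subst hb
        simp [hne, hne.symm, add_comm, Sym2.eq_swap]
      · simp [ha, hb, Ne.symm ha, Ne.symm hb]
  · obtain ⟨i1, i2, i3⟩ := h.1 v
    have hSN : S (N - 1) = univ := by simp [hS]
    rw [hSN] at i1 i2 i3
    rw [i1, i2, i3, card_eq_sum_ones]
    exact ⟨sum_edgeList hG hE v fun _ => 1, sum_edgeList hG hE v fun w => (w : ℕ),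
      sum_edgeList hG hE v fun w => e s(v, w)⟩

/-- The state after the removal of `k` leaves; the vertices in `R` are left. -/
structure PeelState (G : SimpleGraph (Fin N)) (e : Sym2 (Fin N) → ℕ) (π : Fin N → Fin N)
    (r : Fin N) (k : ℕ) (R : Finset (Fin N)) (σ : Store) : Prop where
  card : R.card + k = N
  root : r ∈ R
  closed : ∀ v ∈ R, v ≠ r → π v ∈ R
  deg : ∀ v ∈ R, σ.ints 41 v = (nbr G R v).card
  sum : ∀ v ∈ R, σ.ints 42 v = ∑ w ∈ nbr G R v, (w : ℕ)
  wsum : ∀ v ∈ R, σ.ints 43 v = ∑ w ∈ nbr G R v, e s(v, w)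
  queue : ∀ i, k ≤ i → i < σ.ints 45 0 →
    ∃ v ∈ R, v ≠ r ∧ σ.ints 44 i = v ∧ (nbr G R v).card = 1
  leaf : ∀ v ∈ R, v ≠ r → (nbr G R v).card = 1 → ∃ i, k ≤ i ∧ i < σ.ints 45 0 ∧ σ.ints 44 i = v
  inj : ∀ i j, i < σ.ints 45 0 → j < σ.ints 45 0 → σ.ints 44 i = σ.ints 44 j → i = j
  tail : k ≤ σ.ints 45 0
  gone : ∀ i < k, ∃ v, v ∉ R ∧ v ≠ r ∧ σ.ints 44 i = v ∧ σ.ints 50 v = π v ∧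
    σ.ints 51 v = e s(v, π v)
  order : ∀ i < k, ∀ j < k, ∀ v : Fin N, σ.ints 44 i = v → σ.ints 44 j = π v → i < j
  cover : ∀ v, v ∉ R → ∃ i < k, σ.ints 44 i = v
  zero : σ.ints 50 0 = 0

theorem pushAll_runs {σ : Store} {r : Fin N} (hr : (r : ℕ) = 0) (π : Fin N → Fin N)
    (h40 : σ.ints 40 0 = N) (h45 : σ.ints 45 0 = 0) (h50 : σ.ints 50 0 = 0)
    (h : ∀ v : Fin N, σ.ints 41 v = (nbr G univ v).card ∧
      σ.ints 42 v = ∑ w ∈ nbr G univ v, (w : ℕ) ∧ σ.ints 43 v = ∑ w ∈ nbr G univ v, e s(v, w)) :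
    Runs (forUp 46 (V 40) (pushLeaf (V 46))) σ ((N + 1) * 60) (PeelState G e π r 0 univ) := by
  have hr0 : ∀ v : Fin N, v ≠ r ↔ (v : ℕ) ≠ 0 := fun v => by rw [Ne, Fin.ext_iff, hr]
  refine (Runs.forUp_const (n := N) 40 (fun j τ =>
    (∀ i < τ.ints 45 0, ∃ v : Fin N, v.val < j ∧ v ≠ r ∧ τ.ints 44 i = v ∧
      (nbr G univ v).card = 1) ∧
    (∀ v : Fin N, v.val < j → v ≠ r → (nbr G univ v).card = 1 → ∃ i < τ.ints 45 0, τ.ints 44 i = v) ∧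
    ∀ i j, i < τ.ints 45 0 → j < τ.ints 45 0 → τ.ints 44 i = τ.ints 44 j → i = j)
    (by decide) ?_ ?_ ?_).mono (Nat.mul_le_mul_left _ (by decide)) fun τ F h' => ?_
  · simp [h45]
  · intro τ hF
    simp [hF.ints 40 (by decide), h40]
  · rintro j hj τ hF hv ⟨i1, i2, i3⟩
    have f41 : τ.ints 41 j = (nbr G univ ⟨j, hj⟩).card := by
      rw [hF.ints 41 (by decide)]; exact (h ⟨j, hj⟩).1
    refine Runs.flat rfl (by decide) ?_
    simp only [pushLeaf, Prog.run, Test.holds_eq, IExp.eval, hv, f41]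
    have hskip : ¬ ((nbr G univ ⟨j, hj⟩).card = 1 ∧ j ≠ 0) →
        (∀ i < (τ.putI 46 0 (j + 1)).ints 45 0, ∃ v : Fin N, v.val < j + 1 ∧ v ≠ r ∧
          (τ.putI 46 0 (j + 1)).ints 44 i = v ∧ (nbr G univ v).card = 1) ∧
        (∀ v : Fin N, v.val < j + 1 → v ≠ r → (nbr G univ v).card = 1 →
          ∃ i < (τ.putI 46 0 (j + 1)).ints 45 0, (τ.putI 46 0 (j + 1)).ints 44 i = v) ∧
        ∀ i j', i < (τ.putI 46 0 (j + 1)).ints 45 0 → j' < (τ.putI 46 0 (j + 1)).ints 45 0 →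
          (τ.putI 46 0 (j + 1)).ints 44 i = (τ.putI 46 0 (j + 1)).ints 44 j' → i = j' := by
      intro hno
      simp only [Store.putI_ints_ne _ _ _ (show (44 : ℕ) ≠ 46 by decide),
        Store.putI_ints_ne _ _ _ (show (45 : ℕ) ≠ 46 by decide)]
      refine ⟨fun i hi => ?_, fun v hv hvr hc => ?_, i3⟩
      · obtain ⟨v, h1, h2⟩ := i1 i hi
        exact ⟨v, by omega, h2⟩
      · rcases Nat.lt_succ_iff_lt_or_eq.mp hv with h' | rfl
        · exact i2 v h' hvr hc
        · exact absurd ⟨hc, (hr0 v).1 hvr⟩ hno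
    split_ifs with hc h0
    · exact hskip fun h => h.2 h0
    · have i1' : ∀ i < τ.ints 45 0, τ.ints 44 i ≠ j := fun i hi h' => by
        obtain ⟨v, h1, _, h2, _⟩ := i1 i hi
        omega
      refine ⟨fun i hi => ?_, fun v hv hvr hc' => ?_, fun i j' hi hj' => ?_⟩
      · have hi' : i < τ.ints 45 0 + 1 := by simpa [hv] using hi
        rcases Nat.lt_succ_iff_lt_or_eq.mp hi' with h' | rfl
        · obtain ⟨v, h1, h2, h3, h4⟩ := i1 i h'
          exact ⟨v, by omega, h2, by simpa [hv, h'.ne] using h3, h4⟩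
        · exact ⟨⟨j, hj⟩, by simp, (hr0 _).2 h0, by simp [], hc⟩
      · rcases Nat.lt_succ_iff_lt_or_eq.mp hv with h' | h'
        · obtain ⟨i, h1, h2⟩ := i2 v h' hvr hc'
          exact ⟨i, by simp; omega, by simpa [h1.ne] using h2⟩
        · exact ⟨τ.ints 45 0, by simp, by simp [h']⟩
      · have hi' : i < τ.ints 45 0 + 1 := by simpa [hv] using hi
        have hj'' : j' < τ.ints 45 0 + 1 := by simpa [hv] using hj'
        rcases Nat.lt_succ_iff_lt_or_eq.mp hi' with h1 | h1 <;>
        rcases Nat.lt_succ_iff_lt_or_eq.mp hj'' with h2 | h2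
        · simpa [h1.ne, h2.ne] using i3 i j' h1 h2
        · simpa [h1.ne, h2, hv] using fun h' => absurd h' (i1' i h1)
        · simpa [h2.ne, h1, hv] using fun h' => absurd h'.symm (i1' j' h2)
        · intro _; omega
    · exact hskip fun h => hc h.1
  · obtain ⟨⟨i1, i2, i3⟩, -⟩ := h'
    refine ⟨by simp, mem_univ _, fun _ _ _ => mem_univ _, fun v _ => ?_, fun v _ => ?_, fun v _ => ?_,
      fun i _ hi => ?_, fun v _ hvr hc => ?_, i3, Nat.zero_le _, by simp, by simp, by simp, ?_⟩
    · rw [F.ints 41 (by decide), (h v).1]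
    · rw [F.ints 42 (by decide), (h v).2.1]
    · rw [F.ints 43 (by decide), (h v).2.2]
    · obtain ⟨v, _, h1⟩ := i1 i hi
      exact ⟨v, mem_univ _, h1⟩
    · obtain ⟨i, h1, h2⟩ := i2 v v.2 hvr hc
      exact ⟨i, Nat.zero_le _, h1, h2⟩
    · rw [F.ints 50 (by decide), h50]

end

end FTFI

/-! ### The removal of leaves and the resulting numbering -/

namespace FTFI

open Finset

section

variable {N : ℕ} {G : SimpleGraph (Fin N)} {e : Sym2 (Fin N) → ℕ} {π : Fin N → Fin N} {r : Fin N}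
  {R : Finset (Fin N)}

/-- The parents `π` of the vertices of the tree `G` with the root `r`. -/
structure IsParentMap (G : SimpleGraph (Fin N)) (π : Fin N → Fin N) (r : Fin N) (h : Fin N → ℕ) :
    Prop where
  lt : ∀ v, v ≠ r → h (π v) < h v
  adj : ∀ v w, G.Adj v w ↔ (v ≠ r ∧ w = π v) ∨ (w ≠ r ∧ v = π w)

variable {h : Fin N → ℕ}

/-- A remaining vertex of greatest height other than the root has no remaining child, since children
are higher. -/
theorem IsParentMap.exists_leaf (hπ : IsParentMap G π r h) (hr : r ∈ R)
    (hcl : ∀ v ∈ R, v ≠ r → π v ∈ R) (hc : 1 < R.card) :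
    ∃ v ∈ R, v ≠ r ∧ (nbr G R v).card = 1 := by
  have hne : (R.erase r).Nonempty := by
    rw [← card_pos, card_erase_of_mem hr]
    omega
  obtain ⟨v, hv, hmax⟩ := exists_max_image (R.erase r) h hne
  rw [mem_erase] at hv
  refine ⟨v, hv.2, hv.1, card_eq_one.2 ⟨π v, ?_⟩⟩
  ext w
  rw [mem_nbr, hπ.adj, mem_singleton]
  constructor
  · rintro ⟨hw, ⟨_, h1⟩ | ⟨h1, rfl⟩⟩
    · exact h1
    · have h2 := hπ.lt w h1
      have h3 := hmax w (mem_erase.2 ⟨h1, hw⟩)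
      omega
  · rintro rfl
    exact ⟨hcl v hv.2 hv.1, Or.inl ⟨hv.1, rfl⟩⟩

/-- `R` is closed under parents, so the one neighbour left to a leaf is its parent. -/
theorem IsParentMap.nbr_leaf (hπ : IsParentMap G π r h) (hcl : ∀ v ∈ R, v ≠ r → π v ∈ R) {v : Fin N}
    (hv : v ∈ R) (hvr : v ≠ r) (hc : (nbr G R v).card = 1) : nbr G R v = {π v} := by
  obtain ⟨x, hx⟩ := card_eq_one.1 hc
  have : π v ∈ nbr G R v := mem_nbr.2 ⟨hcl v hv hvr, (hπ.adj _ _).2 (Or.inl ⟨hvr, rfl⟩)⟩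
  rw [hx, mem_singleton] at this
  rw [hx, this]

theorem PeelState.putI {k : ℕ} {σ : Store} (hS : PeelState G e π r k R σ) (i n : ℕ) :
    PeelState G e π r k R (σ.putI 46 i n) :=
  ⟨hS.card, hS.root, hS.closed, by simpa using hS.deg, by simpa using hS.sum, by simpa using hS.wsum,
    by simpa using hS.queue, by simpa using hS.leaf, by simpa using hS.inj, by simpa using hS.tail,
    by simpa using hS.gone, by simpa using hS.order, by simpa using hS.cover, by simpa using hS.zero⟩

/-- The effect of the removal of a leaf. -/
theorem PeelState.step (hπ : IsParentMap G π r h) {k : ℕ} {σ τ : Store}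
    (hS : PeelState G e π r k R σ) (hr : (r : ℕ) = 0) {v : Fin N} (hv : v ∈ R) (hvr : v ≠ r)
    (hc : (nbr G R v).card = 1) (hk : k < σ.ints 45 0) (hvk : σ.ints 44 k = v)
    (h41 : ∀ x, τ.ints 41 x = if x = π v then σ.ints 41 x - 1 else σ.ints 41 x)
    (h42 : ∀ x, τ.ints 42 x = if x = π v then σ.ints 42 x - v else σ.ints 42 x)
    (h43 : ∀ x, τ.ints 43 x = if x = π v then σ.ints 43 x - e s(v, π v) else σ.ints 43 x)
    (h50 : ∀ x, τ.ints 50 x = if x = v then (π v : ℕ) else σ.ints 50 x)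
    (h51 : ∀ x, τ.ints 51 x = if x = v then e s(v, π v) else σ.ints 51 x)
    (h44 : ∀ i < σ.ints 45 0, τ.ints 44 i = σ.ints 44 i)
    (hpush : τ.ints 41 (π v) = 1 → π v ≠ r →
      τ.ints 45 0 = σ.ints 45 0 + 1 ∧ τ.ints 44 (σ.ints 45 0) = π v)
    (hno : ¬ (τ.ints 41 (π v) = 1 ∧ π v ≠ r) → τ.ints 45 0 = σ.ints 45 0) :
    PeelState G e π r (k + 1) (R.erase v) τ := by
  classical
  have hnbr := hπ.nbr_leaf hS.closed hv hvr hc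
  have hne : π v ≠ v := fun h' => by have := hπ.lt v hvr; rw [h'] at this; omega
  have hπR : π v ∈ R := hS.closed v hv hvr
  have hvn : v ∈ nbr G R (π v) := mem_nbr.2 ⟨hv, (hπ.adj _ _).2 (Or.inr ⟨hvr, rfl⟩)⟩
  have hother : ∀ x ∈ R, x ≠ π v → nbr G (R.erase v) x = nbr G R x := by
    intro x hx hxv
    ext y
    rw [mem_nbr, mem_nbr, mem_erase]
    refine ⟨fun h => ⟨h.1.2, h.2⟩, fun h' => ⟨⟨?_, h'.1⟩, h'.2⟩⟩
    rintro rfl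
    have : x ∈ nbr G R y := mem_nbr.2 ⟨hx, h'.2.symm⟩
    rw [hnbr, mem_singleton] at this
    exact hxv this
  have hself : nbr G (R.erase v) (π v) = (nbr G R (π v)).erase v := by
    ext y
    rw [mem_erase, mem_nbr, mem_nbr, mem_erase, and_assoc]
  have hdeg : ∀ x ∈ R, τ.ints 41 x = (nbr G (R.erase v) x).card := by
    intro x hx
    rw [h41, hS.deg x hx]
    by_cases hxv : x = π v
    · subst hxv
      rw [if_pos rfl, hself, card_erase_of_mem hvn]
    · rw [if_neg (fun h => hxv (Fin.ext h)), hother x hx hxv]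
  -- Before the removal of `v`, a parent other than the root has at least two remaining neighbours,
  -- `v` and its own parent.
  have hcard2 : π v ≠ r → (nbr G R (π v)).card ≠ 1 := by
    intro hπr h1
    have h2 := hπ.nbr_leaf hS.closed hπR hπr h1
    rw [h2, mem_singleton] at hvn
    have h3 := hπ.lt v hvr
    have h4 := hπ.lt _ hπr
    rw [← hvn] at h4
    omega
  have htail : σ.ints 45 0 ≤ τ.ints 45 0 ∧ τ.ints 45 0 ≤ σ.ints 45 0 + 1 := by
    by_cases h' : τ.ints 41 (π v) = 1 ∧ π v ≠ r
    · rw [(hpush h'.1 h'.2).1]; omega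
    · rw [hno h']; omega
  have hnew : ∀ i, σ.ints 45 0 ≤ i → i < τ.ints 45 0 → i = σ.ints 45 0 ∧ π v ≠ r ∧
      τ.ints 44 i = π v ∧ (nbr G (R.erase v) (π v)).card = 1 := by
    intro i h1 h2
    by_cases h' : τ.ints 41 (π v) = 1 ∧ π v ≠ r
    · have h3 := hpush h'.1 h'.2
      obtain rfl : i = σ.ints 45 0 := by omega
      exact ⟨rfl, h'.2, h3.2, by rw [← hdeg _ hπR, h'.1]⟩
    · rw [hno h'] at h2
      omega
  -- Consequently the parent has not been queued before, and pushing it now creates no repetition.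
  have hold : ∀ i < σ.ints 45 0, π v ≠ r → σ.ints 44 i ≠ π v := by
    intro i hi hπr h1
    by_cases hik : k ≤ i
    · obtain ⟨y, hy, hyr, h2, h3⟩ := hS.queue i hik hi
      have : y = π v := Fin.ext (h2.symm.trans h1)
      subst this
      exact hcard2 hπr h3
    · obtain ⟨y, hy, hyr, h2, _⟩ := hS.gone i (by omega)
      have : y = π v := Fin.ext (h2.symm.trans h1)
      subst this
      exact hy hπR
  refine ⟨?_, ?_, ?_, ?_, ?_, ?_, ?_, ?_, ?_, ?_, ?_, ?_, ?_, ?_⟩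
  · have := card_pos.2 ⟨v, hv⟩
    rw [card_erase_of_mem hv]
    have := hS.card
    omega
  · exact mem_erase.2 ⟨Ne.symm hvr, hS.root⟩
  · intro x hx hxr
    rw [mem_erase] at hx ⊢
    refine ⟨fun h1 => ?_, hS.closed x hx.2 hxr⟩
    have h2 : x ∈ nbr G R v := mem_nbr.2 ⟨hx.2, (hπ.adj _ _).2 (Or.inr ⟨hxr, h1.symm⟩)⟩
    rw [hnbr, mem_singleton] at h2
    have h3 := hπ.lt v hvr
    have h4 := hπ.lt x hxr
    rw [h1] at h4
    rw [h2] at h4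
    omega
  · exact fun x hx => hdeg x (mem_erase.1 hx).2
  · intro x hx
    rw [mem_erase] at hx
    rw [h42, hS.sum x hx.2]
    by_cases hxv : x = π v
    · subst hxv
      rw [if_pos rfl, hself, ← add_sum_erase _ _ hvn, Nat.add_sub_cancel_left]
    · rw [if_neg (fun h => hxv (Fin.ext h)), hother x hx.2 hxv]
  · intro x hx
    rw [mem_erase] at hx
    rw [h43, hS.wsum x hx.2]
    by_cases hxv : x = π v
    · subst hxv
      rw [if_pos rfl, hself, ← add_sum_erase _ _ hvn, Sym2.eq_swap, Nat.add_sub_cancel_left]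
    · rw [if_neg (fun h => hxv (Fin.ext h)), hother x hx.2 hxv]
  · intro i hi hit
    by_cases hiσ : i < σ.ints 45 0
    · obtain ⟨y, hy, hyr, h1, h2⟩ := hS.queue i (by omega) hiσ
      have hyv : y ≠ v := by
        rintro rfl
        have := hS.inj i k hiσ hk (h1.trans hvk.symm)
        omega
      refine ⟨y, mem_erase.2 ⟨hyv, hy⟩, hyr, by rw [h44 i hiσ, h1], ?_⟩
      rw [hother y hy, h2]
      rintro rfl
      exact hcard2 hyr h2
    · obtain ⟨_, h1, h2, h3⟩ := hnew i (by omega) hit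
      exact ⟨π v, mem_erase.2 ⟨hne, hπR⟩, h1, h2, h3⟩
  · intro x hx hxr h1
    rw [mem_erase] at hx
    by_cases hxv : x = π v
    · subst hxv
      have h2 := hpush (by rw [hdeg _ hπR, h1]) hxr
      exact ⟨σ.ints 45 0, by omega, by omega, h2.2⟩
    · rw [hother x hx.2 hxv] at h1
      obtain ⟨i, h2, h3, h4⟩ := hS.leaf x hx.2 hxr h1
      have : i ≠ k := by
        rintro rfl
        exact hx.1 (Fin.ext (h4.symm.trans hvk))
      exact ⟨i, by omega, by omega, by rw [h44 i h3, h4]⟩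
  · intro i j hi hj hij
    by_cases h1 : i < σ.ints 45 0 <;> by_cases h2 : j < σ.ints 45 0
    · rw [h44 i h1, h44 j h2] at hij
      exact hS.inj i j h1 h2 hij
    · obtain ⟨_, h3, h4, _⟩ := hnew j (by omega) hj
      rw [h44 i h1, h4] at hij
      exact absurd hij (hold i h1 h3)
    · obtain ⟨_, h3, h4, _⟩ := hnew i (by omega) hi
      rw [h44 j h2, h4] at hij
      exact absurd hij.symm (hold j h2 h3)
    · rw [(hnew i (by omega) hi).1, (hnew j (by omega) hj).1]
  · omega
  · intro i hi
    rcases Nat.lt_succ_iff_lt_or_eq.mp hi with h' | rfl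
    · obtain ⟨y, hy, hyr, h1, h2, h3⟩ := hS.gone i h'
      have hyv : (y : ℕ) ≠ v := fun h => hy (by rwa [Fin.ext h])
      refine ⟨y, fun h => hy (mem_erase.1 h).2, hyr, by rw [h44 i (by omega), h1], ?_, ?_⟩
      · rw [h50, if_neg hyv, h2]
      · rw [h51, if_neg hyv, h3]
    · exact ⟨v, fun h => (mem_erase.1 h).1 rfl, hvr, by rw [h44 i hk, hvk],
        by rw [h50, if_pos rfl], by rw [h51, if_pos rfl]⟩
  · intro i hi j hj y h1 h2
    rw [h44 i (by omega)] at h1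
    rw [h44 j (by omega)] at h2
    rcases Nat.lt_succ_iff_lt_or_eq.mp hj with hj' | rfl
    · rcases Nat.lt_succ_iff_lt_or_eq.mp hi with hi' | rfl
      · exact hS.order i hi' j hj' y h1 h2
      · obtain rfl : v = y := Fin.ext (hvk.symm.trans h1)
        obtain ⟨y, hy, _, h3, _⟩ := hS.gone j hj'
        obtain rfl : y = π v := Fin.ext (h3.symm.trans h2)
        exact absurd hπR hy
    · rcases Nat.lt_succ_iff_lt_or_eq.mp hi with hi' | rfl
      · exact hi'
      · obtain rfl : v = y := Fin.ext (hvk.symm.trans h1)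
        exact absurd (Fin.ext (h2.symm.trans hvk)) hne
  · intro x hx
    by_cases hxv : x = v
    · exact ⟨k, by omega, by rw [h44 k hk, hvk, hxv]⟩
    · obtain ⟨i, h1, h2⟩ := hS.cover x fun h => hx (mem_erase.2 ⟨hxv, h⟩)
      exact ⟨i, by omega, by rw [h44 i (by omega), h2]⟩
  · rw [h50, if_neg, hS.zero]
    intro h
    exact hvr (Fin.ext (by rw [← h, hr]))

/-- While more than one vertex remains there is a leaf, and all leaves are queued; hence the queue
is not empty. -/
theorem peelStep_runs (hπ : IsParentMap G π r h) {k : ℕ} {σ : Store} (hr : (r : ℕ) = 0)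
    (hS : PeelState G e π r k R σ) (hk : k < N - 1) (h46 : σ.ints 46 0 = k) :
    Runs peelStep σ 120 (fun τ => ∃ R', PeelState G e π r (k + 1) R' τ) := by
  obtain ⟨x, hx, hxr, hxc⟩ := hπ.exists_leaf hS.root hS.closed (by have := hS.card; omega)
  obtain ⟨i, h1, h2, _⟩ := hS.leaf x hx hxr hxc
  have ht : k < σ.ints 45 0 := by omega
  obtain ⟨v, hv, hvr, hvk, hc⟩ := hS.queue k le_rfl ht
  have hnbr := hπ.nbr_leaf hS.closed hv hvr hc
  have f42 : σ.ints 42 v = π v := by rw [hS.sum v hv, hnbr, sum_singleton]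
  have f43 : σ.ints 43 v = e s(v, π v) := by rw [hS.wsum v hv, hnbr, sum_singleton]
  refine Runs.pre (T' := 40) 80 rfl (by decide) le_rfl ?_
  set τ0 := (Prog.setI 47 0 (.get 44 (V 46)) ;; .setI 48 0 (.get 42 (V 47)) ;;
    .setI 49 0 (.get 43 (V 47)) ;;
    .setI 50 (V 47) (V 48) ;; .setI 51 (V 47) (V 49) ;;
    .setI 41 (V 48) (.get 41 (V 48) - 1) ;; .setI 42 (V 48) (.get 42 (V 48) - V 47) ;;
    .setI 43 (V 48) (.get 43 (V 48) - V 49)).run σ with hτ0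
  have a48 : τ0.ints 48 0 = π v := by simp [hτ0, h46, hvk, f42]
  have a44 : τ0.ints 44 = σ.ints 44 := by funext j; simp [hτ0]
  have a45 : τ0.ints 45 0 = σ.ints 45 0 := by simp [hτ0]
  have a41 : ∀ x, τ0.ints 41 x = if x = π v then σ.ints 41 x - 1 else σ.ints 41 x := fun x => by
    by_cases hx : x = π v <;> simp [hτ0, h46, hvk, f42, hx]
  have a42 : ∀ x, τ0.ints 42 x = if x = π v then σ.ints 42 x - v else σ.ints 42 x := fun x => by
    by_cases hx : x = π v <;> simp [hτ0, h46, hvk, f42, hx]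
  have a43 : ∀ x, τ0.ints 43 x = if x = π v then σ.ints 43 x - e s(v, π v) else σ.ints 43 x :=
    fun x => by by_cases hx : x = π v <;> simp [hτ0, h46, hvk, f42, f43, hx]
  have a50 : ∀ x, τ0.ints 50 x = if x = v then (π v : ℕ) else σ.ints 50 x := fun x => by
    by_cases hx : x = v <;> simp [hτ0, h46, hvk, f42, hx]
  have a51 : ∀ x, τ0.ints 51 x = if x = v then e s(v, π v) else σ.ints 51 x := fun x => by
    by_cases hx : x = v <;> simp [hτ0, h46, hvk, f43, hx]
  have hr0 : π v ≠ r ↔ (π v : ℕ) ≠ 0 := by rw [Ne, Fin.ext_iff, hr]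
  refine Runs.flat rfl (by decide) ⟨R.erase v, ?_⟩
  simp only [pushLeaf, Prog.run, Test.holds_eq, IExp.eval, a48]
  split_ifs with hc1 h0
  · exact hS.step hπ hr hv hvr hc ht hvk a41 a42 a43 a50 a51 (fun i _ => by rw [a44])
      (fun _ h' => absurd h0 (hr0.1 h')) (fun _ => a45)
  · refine hS.step hπ hr hv hvr hc ht hvk (by simpa using a41) (by simpa using a42)
      (by simpa using a43) (by simpa using a50) (by simpa using a51) (fun i hi => ?_)
      (fun _ _ => ?_) (fun h' => ?_)
    · simp [a44, a45, hi.ne]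
    · simp [a45]
    · exact absurd ⟨by simpa using hc1, hr0.2 h0⟩ h'
  · exact hS.step hπ hr hv hvr hc ht hvk a41 a42 a43 a50 a51 (fun i _ => by rw [a44])
      (fun h' _ => absurd h' hc1) (fun _ => a45)

/-- A vertex is removed before its parent, so the reversed order of removal is a numbering with
parents before children and the root at 0. -/
theorem peel_runs (hG : G.IsTree) {E : Fin (N - 1) → Fin N × Fin N} (hE : IsEdgeList G E)
    (hN : 0 < N) {σ : Store} (h40 : σ.ints 40 0 = N) (h1 : ∀ k : Fin (N - 1), σ.ints 1 k = (E k).1)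
    (h2 : ∀ k : Fin (N - 1), σ.ints 2 k = (E k).2)
    (h3 : ∀ k : Fin (N - 1), σ.ints 3 k = e s((E k).1, (E k).2))
    (h41 : ∀ v, σ.ints 41 v = 0) (h42 : ∀ v, σ.ints 42 v = 0) (h43 : ∀ v, σ.ints 43 v = 0)
    (h50 : σ.ints 50 0 = 0) :
    Runs peel σ ((N + 1) * 1000) (fun τ => ∃ pos : Fin N → ℕ,
      Layout G e pos (τ.ints 54) (τ.ints 55) ∧ τ.ints 54 0 = 0 ∧
      ∀ i : Fin N, τ.ints 53 (pos i) = i) := by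
  set r : Fin N := ⟨0, hN⟩ with hr
  obtain ⟨π, h, hlt, hadj⟩ := exists_parent hG r
  have hπ : IsParentMap G π r h := ⟨hlt, hadj⟩
  refine Runs.le (T := (N + 1) * 150 + (10 + ((N + 1) * 60 + ((N + 1) * 150 + (20 +
    ((N + 1) * 100 + (N + 1) * 100)))))) ?_ (by omega)
  refine Runs.seq (edgeSums_runs hG hE h40 h1 h2 h3 h41 h42 h43) fun τ1 F1 e1 => ?_
  refine Runs.pre 10 rfl (by decide) le_rfl ?_
  set τ2 := (Prog.setI 45 0 0).run τ1 with hτ2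
  have aI : ∀ A, A ≠ 45 → τ2.ints A = τ1.ints A := fun A hA => by funext j; simp [hτ2, hA]
  have a40 : τ2.ints 40 0 = N := by rw [aI 40 (by decide), F1.ints 40 (by decide), h40]
  refine Runs.seq (pushAll_runs (r := r) (e := e) (G := G) rfl π a40 (by simp [hτ2])
    (by rw [aI 50 (by decide), F1.ints 50 (by decide), h50])
    (fun v => by rw [aI 41 (by decide), aI 42 (by decide), aI 43 (by decide)]; exact e1 v))
    fun τ3 F3 e3 => ?_
  have b40 : τ3.ints 40 0 = N := by rw [F3.ints 40 (by decide), a40]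
  refine Runs.seq (mid := fun τ => ∃ R, PeelState G e π r (N - 1) R τ)
    ((Runs.forUp_const (n := N - 1) 120 (fun k τ => ∃ R, PeelState G e π r k R τ) (by decide)
      ?_ ?_ ?_).mono (Nat.mul_le_mul (by omega) (by decide)) fun τ _ h => h.1) fun τ4 F4 e4 => ?_
  · exact ⟨univ, e3.putI _ _⟩
  · intro τ hF
    simp [hF.ints 40 (by decide), b40]
  · rintro k hk τ hF hv ⟨R, hS⟩
    refine (peelStep_runs hπ rfl hS hk hv).mono le_rfl ?_
    rintro τ' - ⟨R', hS'⟩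
    exact ⟨R', hS'.putI _ _⟩
  obtain ⟨R, hS⟩ := e4
  have c40 : τ4.ints 40 0 = N := by rw [F4.ints 40 (by decide), b40]
  have hR : ∀ v, v ∈ R ↔ v = r := by
    have h1 : R.card = 1 := by have := hS.card; omega
    obtain ⟨x, hx⟩ := card_eq_one.1 h1
    have := hS.root
    rw [hx, mem_singleton] at this
    intro v
    rw [hx, mem_singleton, this]
  -- The root is never queued; it is appended as the last vertex, in the cell `N - 1`.
  refine Runs.pre 20 rfl (by decide) le_rfl ?_
  set τ5 := (Prog.setI 44 (V 40 - 1) 0).run τ4 with hτ5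
  have dI : ∀ A, A ≠ 44 → τ5.ints A = τ4.ints A := fun A hA => by funext j; simp [hτ5, hA]
  have d44 : ∀ i < N - 1, τ5.ints 44 i = τ4.ints 44 i := fun i hi => by simp [hτ5, c40, hi.ne]
  have d44r : τ5.ints 44 (N - 1) = r := by simp [hτ5, c40, hr]
  have dmem : ∀ i < N, ∃ v : Fin N, τ5.ints 44 i = v ∧ (v = r ↔ i = N - 1) := by
    intro i hi
    by_cases hi' : i = N - 1
    · exact ⟨r, by rw [hi', d44r], by simp [hi']⟩
    · obtain ⟨v, _, hvr, hvi, _⟩ := hS.gone i (by omega)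
      exact ⟨v, by rw [d44 i (by omega), hvi], by simp [hvr, hi']⟩
  have dsurj : ∀ v : Fin N, ∃ i < N, τ5.ints 44 i = v := by
    intro v
    by_cases hv : v = r
    · exact ⟨N - 1, by omega, by rw [d44r, hv]⟩
    · obtain ⟨i, h1, h2⟩ := hS.cover v (by rwa [hR])
      exact ⟨i, by omega, by rw [d44 i h1, h2]⟩
  have dinj : ∀ i < N, ∀ j < N, τ5.ints 44 i = τ5.ints 44 j → i = j := by
    intro i hi j hj hij
    obtain ⟨v, h1, h2⟩ := dmem i hi
    obtain ⟨w, h3, h4⟩ := dmem j hj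
    have hvw : v = w := Fin.ext (by omega)
    subst hvw
    by_cases hi' : i = N - 1
    · rw [hi', (h4.1 (h2.2 hi'))]
    · have hj' : j ≠ N - 1 := fun h => hi' (h2.1 (h4.2 h))
      rw [d44 i (by omega), d44 j (by omega)] at hij
      have := hS.tail
      exact hS.inj i j (by omega) (by omega) hij
  refine Runs.seq (mid := fun τ => ∀ i < N, τ.ints 52 (τ5.ints 44 i) = N - 1 - i)
    ((Runs.forUp_const (n := N) 40 (fun k τ => ∀ i < k, τ.ints 52 (τ5.ints 44 i) = N - 1 - i)
      (by decide) (by simp) ?_ ?_).mono (Nat.mul_le_mul (by omega) (by decide)) fun τ _ h => h.1)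
      fun τ6 F6 e6 => ?_
  · intro τ hF
    simp [hF.ints 40 (by decide), dI 40, c40]
  · intro k hk τ hF hv hI
    have f40 : τ.ints 40 0 = N := by rw [hF.ints 40 (by decide), dI 40 (by decide), c40]
    have f44 : τ.ints 44 = τ5.ints 44 := hF.ints 44 (by decide)
    refine Runs.flat rfl (by decide) fun i hi => ?_
    rcases Nat.lt_succ_iff_lt_or_eq.mp hi with h' | rfl
    · have : τ5.ints 44 i ≠ τ5.ints 44 k := fun h =>
        absurd (dinj i (by omega) k hk h) (by omega)
      simp [hv, f44, this, hI i h']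
    · simp [hv, f44, f40]
  -- The array `52` inverts the reversed queue; cell `i` of the queue gets the number `N - 1 - i`.
  set pos : Fin N → ℕ := fun v => τ6.ints 52 v with hpos
  have hposi : ∀ i < N, ∀ v : Fin N, τ5.ints 44 i = v → pos v = N - 1 - i := fun i hi v h => by
    rw [hpos]; simp only [← h]; exact e6 i hi
  have h50' : ∀ v, v ≠ r → τ6.ints 50 v = π v ∧ τ6.ints 51 v = e s(v, π v) := by
    intro v hv
    obtain ⟨i, h1, h2⟩ := hS.cover v (by rwa [hR])
    obtain ⟨w, _, _, h3, h4⟩ := hS.gone i h1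
    obtain rfl : v = w := Fin.ext (by omega)
    rw [F6.ints 50 (by decide), F6.ints 51 (by decide), dI 50 (by decide), dI 51 (by decide)]
    exact h4
  have hposr : pos r = 0 := by
    rw [hposi (N - 1) (by omega) r d44r]; omega
  have hposlt : ∀ v, v ≠ r → pos (π v) < pos v := by
    intro v hv
    obtain ⟨i, hi, h1⟩ := dsurj v
    obtain ⟨j, hj, h2⟩ := dsurj (π v)
    rw [hposi i hi v h1, hposi j hj _ h2]
    have hi' : i ≠ N - 1 := by
      obtain ⟨w, h3, h4⟩ := dmem i hi
      obtain rfl : v = w := Fin.ext (by omega)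
      exact fun h => hv (h4.2 h)
    by_cases hj' : j = N - 1
    · omega
    · rw [d44 i (by omega)] at h1
      rw [d44 j (by omega)] at h2
      have := hS.order i (by omega) j (by omega) v h1 h2
      omega
  have hposN : ∀ v, pos v < N := fun v => by
    obtain ⟨i, hi, h1⟩ := dsurj v
    rw [hposi i hi v h1]; omega
  have hposinj : Function.Injective pos := by
    intro v w hvw
    obtain ⟨i, hi, h1⟩ := dsurj v
    obtain ⟨j, hj, h2⟩ := dsurj w
    rw [hposi i hi v h1, hposi j hj w h2] at hvw
    obtain rfl : i = j := by omega
    exact Fin.ext (h1.symm.trans h2)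
  refine (Runs.forUp_const (n := N) 60 (fun k τ => ∀ v : Fin N, pos v < k → τ.ints 53 (pos v) = v ∧
    τ.ints 54 (pos v) = τ6.ints 52 (τ6.ints 50 v) ∧ τ.ints 55 (pos v) = τ6.ints 51 v)
    (by decide) (by simp) ?_ ?_).mono (Nat.mul_le_mul_left _ (by decide)) fun τ _ h' => ?_
  · intro τ hF
    simp [hF.ints 40 (by decide), F6.ints 40 (by decide), dI 40, c40]
  · intro k hk τ hF hvk hI
    have f40 : τ.ints 40 0 = N := by
      rw [hF.ints 40 (by decide), F6.ints 40 (by decide), dI 40 (by decide), c40]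
    have f44 : τ.ints 44 = τ5.ints 44 := by rw [hF.ints 44 (by decide), F6.ints 44 (by decide)]
    have f50 : τ.ints 50 = τ6.ints 50 := hF.ints 50 (by decide)
    have f51 : τ.ints 51 = τ6.ints 51 := hF.ints 51 (by decide)
    have f52 : τ.ints 52 = τ6.ints 52 := hF.ints 52 (by decide)
    refine Runs.flat rfl (by decide) fun v hv => ?_
    rcases Nat.lt_succ_iff_lt_or_eq.mp hv with hlt' | heq
    · simpa [hvk, hlt'.ne] using hI v hlt'
    · obtain ⟨i, hi, h1⟩ := dsurj v
      have h2 := hposi i hi v h1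
      have h3 : τ5.ints 44 (N - 1 - k) = v := by rw [← h1]; congr 1; omega
      simp [hvk, f40, f44, f50, f51, f52, heq, h3]
  · have hv := fun v => h'.1 v (hposN v)
    have h54 : ∀ v, v ≠ r → τ.ints 54 (pos v) = pos (π v) := fun v hvr => by
      rw [(hv v).2.1, (h50' v hvr).1]
    have h0r : ∀ v, 0 < pos v ↔ v ≠ r := fun v => by
      rw [Nat.pos_iff_ne_zero, ← hposr, Ne, hposinj.eq_iff]
    have hlay : Layout G e pos (τ.ints 54) (τ.ints 55) := by
      refine ⟨hposN, hposinj, fun k hk hkN => ?_, fun i j => ?_, fun i j hi hij => ?_⟩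
      · have hs : Function.Surjective fun i => (⟨pos i, hposN i⟩ : Fin N) :=
          Finite.surjective_of_injective fun i j hij => hposinj (by simpa using hij)
        obtain ⟨v, hvk⟩ := hs ⟨k, hkN⟩
        obtain rfl : pos v = k := by simpa using hvk
        rw [h54 v ((h0r v).1 hk)]
        exact hposlt v ((h0r v).1 hk)
      · rw [hadj, h0r, h0r]
        refine or_congr (and_congr_right fun hi => ?_) (and_congr_right fun hj => ?_)
        · rw [h54 i hi, hposinj.eq_iff, eq_comm]
        · rw [h54 j hj, hposinj.eq_iff, eq_comm]
      · have hir := (h0r i).1 hi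
        rw [h54 i hir, hposinj.eq_iff] at hij
        rw [(hv i).2.2, (h50' i hir).2, hij]
    refine ⟨pos, hlay, ?_, fun i => (hv i).1⟩
    have := (hv r).2.1
    rw [hposr] at this
    rw [this, F6.ints 50 (by decide), dI 50 (by decide)]
    have h0 : τ4.ints 50 (r : ℕ) = 0 := hS.zero
    rw [h0]
    exact hposr

end

end FTFI

/-! ### Existence of numberings, and the complete integration program -/

namespace FTFI

open Finset

theorem exists_edgeList {N : ℕ} {G : SimpleGraph (Fin N)} (hG : G.IsTree) :
    ∃ E : Fin (N - 1) → Fin N × Fin N, IsEdgeList G E := by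
  classical
  have hcard : G.edgeFinset.card = N - 1 := by
    have := hG.card_edgeFinset
    rw [Fintype.card_fin] at this
    omega
  let f := (Finset.equivFinOfCardEq hcard).symm
  have hex : ∀ ε : Sym2 (Fin N), ∃ x : Fin N × Fin N, s(x.1, x.2) = ε := fun ε => by
    induction ε with | _ a b => exact ⟨(a, b), rfl⟩
  choose g hg using hex
  refine ⟨fun k => g (f k), fun i j => ?_⟩
  have key : ∀ x : Fin N × Fin N, s(x.1, x.2) = s(i, j) ↔ x = (i, j) ∨ x = (j, i) := fun x => by
    rw [Sym2.eq_iff, Prod.ext_iff, Prod.ext_iff]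
  rw [← SimpleGraph.mem_edgeSet, ← SimpleGraph.mem_edgeFinset]
  constructor
  · intro h
    refine ⟨f.symm ⟨_, h⟩, ?_⟩
    rw [← key, hg, Equiv.apply_symm_apply]
  · rintro ⟨k, hk⟩
    rw [← key, hg] at hk
    rw [← hk]
    exact (f k).2

/-- The numbering is extracted from a run of `peel`, so the combinatorial bound for distances and
the algorithm rest on the same construction. -/
theorem exists_layout {N : ℕ} {G : SimpleGraph (Fin N)} (hG : G.IsTree) (e : Sym2 (Fin N) → ℕ)
    (hN : 0 < N) : ∃ (pos : Fin N → ℕ) (par wt : ℕ → ℕ), Layout G e pos par wt := by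
  obtain ⟨E, hE⟩ := exists_edgeList hG
  -- The coefficients, the denominator and the empty field are arbitrary; `peel` uses only the edge
  -- arrays and the size in the cell 0 of the array `40`.
  obtain ⟨t, τ, -, -, pos, h, -⟩ := peel_runs (e := e) hG hE hN
    (σ := (treeInput 0 0 0 0 E e (0 : Matrix (Fin N) (Fin 0) ℝ)).putI 40 0 N)
    (by simp) (fun k => by simp [treeInput]) (fun k => by simp [treeInput])
    (fun k => by simp [treeInput]) (fun _ => rfl) (fun _ => rfl) (fun _ => rfl) rfl
  exact ⟨pos, _, _, h⟩

theorem quadVal_eq (u v w : ℝ) (q n : ℕ) :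
    quadVal u v w q n = ((quadExp u v w ((n : ℝ) / q) : ℝ) : ℂ) := by
  rw [quadVal, quadExp]
  push_cast
  congr 1
  ring

/-- Exact integration of a field on a tree. -/
def treeProg : Prog :=
  (.setI 40 0 (.get 0 0) ;; .setI 56 0 (.get 0 1)) ;;
  peel ;;
  .setI 75 0 0 ;;
  forUp 76 (.get 0 2) (
    forUp 64 (V 40) (.setS 30 (V 64) (.get 1 (V 75 + .get 53 (V 64)))) ;;
    treeSum ;;
    forUp 64 (V 40) (.setS 2 (V 75 + .get 53 (V 64)) (.get 31 (V 64))) ;;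
    .setI 75 0 (V 75 + V 40))

/-- The cost of integrating one component. -/
def treeCost (N p : ℕ) : ℕ := (Nat.log 2 N + 1) * sumCost N p

theorem le_treeCost {N p : ℕ} (hp : 0 < p) : N ≤ treeCost N p :=
  (le_sumCost hp).trans (Nat.le_mul_of_pos_left _ (by omega))

/-- The cost has one factor logarithmic in $pN$ and one logarithmic in $N$; the stated bound has
room for a second power of $\log(pN+1)$. Both logarithms are at least $\log2$, which gives the
factors 11 and 3. -/
theorem treeCost_le {N p : ℕ} (hN : 0 < N) (hp : 0 < p) :
    (treeCost N p : ℝ) ≤ 33 * (((p * N : ℕ) : ℝ) * Real.log ((p * N + 1 : ℕ) : ℝ) ^ 2 *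
      Real.log ((N + 1 : ℕ) : ℝ)) := by
  have hB : 1 ≤ p * N := Nat.mul_pos hp hN
  set B := p * N with hBdef
  have hl2 := Real.log_two_gt_d9
  have hB' : (1 : ℝ) ≤ B := by exact_mod_cast hB
  have hN' : (1 : ℝ) ≤ N := by exact_mod_cast hN
  have hL : Real.log 2 ≤ Real.log ((B + 1 : ℕ) : ℝ) :=
    Real.log_le_log (by norm_num) (by push_cast; linarith)
  have hLN : Real.log 2 ≤ Real.log ((N + 1 : ℕ) : ℝ) :=
    Real.log_le_log (by norm_num) (by push_cast; linarith)
  set L := Real.log ((B + 1 : ℕ) : ℝ) with hLdef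
  set M := Real.log ((N + 1 : ℕ) : ℝ) with hMdef
  have h1 : (Nat.clog 2 (4 * B) : ℝ) * Real.log 2 ≤ 3 * Real.log 2 + L := by
    have h2 : 2 ^ Nat.clog 2 (4 * B) ≤ 8 * (B + 1) := (two_pow_clog_le (by omega)).trans (by omega)
    have h3 : (2 : ℝ) ^ Nat.clog 2 (4 * B) ≤ 2 ^ 3 * ((B + 1 : ℕ) : ℝ) := by
      exact_mod_cast h2
    have h4 := Real.log_le_log (by positivity) h3
    rwa [Real.log_pow, Real.log_mul (by positivity) (by positivity), Real.log_pow] at h4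
  have h2 : (Nat.log 2 N : ℝ) * Real.log 2 ≤ M := by
    have h3 : (2 : ℝ) ^ Nat.log 2 N ≤ ((N + 1 : ℕ) : ℝ) := by
      exact_mod_cast (Nat.pow_log_le_self 2 hN.ne').trans (Nat.le_succ N)
    have h4 := Real.log_le_log (by positivity) h3
    rwa [Real.log_pow] at h4
  have h3 : (Nat.clog 2 (4 * B) : ℝ) + 1 ≤ 11 * L ^ 2 := by nlinarith
  have h4 : (Nat.log 2 N : ℝ) + 1 ≤ 3 * M := by nlinarith
  have hM0 : 0 ≤ M := by linarith
  rw [treeCost, sumCost, ← hBdef]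
  simp only [Nat.cast_mul, Nat.cast_add_one]
  calc ((Nat.log 2 N : ℝ) + 1) * (((Nat.clog 2 (4 * B) : ℝ) + 1) * B)
      ≤ (3 * M) * ((11 * L ^ 2) * B) := by gcongr
    _ = _ := by ring

/-- The tree is rooted once. Each component of the field is permuted to the new numbering,
integrated and permuted back; the variable `75` holds the address `d * N`, advanced by addition. -/
theorem treeProg_runs (u v w : ℝ) {N p q D : ℕ} {G : SimpleGraph (Fin N)} {e : Sym2 (Fin N) → ℕ}
    {E : Fin (N - 1) → Fin N × Fin N} (X : Matrix (Fin N) (Fin D) ℝ) (hp : 0 < p)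
    (hD : 0 < D) (hT : IsWeightedTree G e p) (hE : IsEdgeList G E) :
    RunsWithin treeProg (treeInput u v w q E e X)
      (3000000 * ((D : ℝ) * ((p * N : ℕ) : ℝ) * Real.log ((p * N + 1 : ℕ) : ℝ) ^ 2 *
        Real.log ((N + 1 : ℕ) : ℝ)))
      (fun τ => ∀ (i : Fin N) (d : Fin D), τ.nums 2 ((d : ℕ) * N + i) =
        (((fDistMatrix (quadExp u v w) G (ratWeight e q) * X) i d : ℝ) : ℂ)) := by
  have hN : 0 < N := Fin.pos (hT.isTree.connected.nonempty.some)
  set σ := treeInput u v w q E e X with hσ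
  set Z := treeCost N p with hZ
  have hNZ : N ≤ Z := le_treeCost hp
  refine Runs.within (T := 20 + ((N + 1) * 1000 + (10 +
    (D + 1) * (((N + 1) * 40 + (43000 * Z + ((N + 1) * 50 + 20))) + 20)))) ?_ ?_
  · refine Runs.pre 20 rfl (by decide) le_rfl ?_
    set τ0 := (Prog.setI 40 0 (.get 0 0) ;; .setI 56 0 (.get 0 1)).run σ with hτ0
    have aI : ∀ A, A ≠ 40 → A ≠ 56 → τ0.ints A = σ.ints A := fun A h1 h2 => by
      funext j; simp [hτ0, h1, h2]
    have aS : τ0.nums = σ.nums := rfl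
    have a40 : τ0.ints 40 0 = N := by simp [hτ0, hσ, treeInput, arr]
    have a56 : τ0.ints 56 0 = q := by simp [hτ0, hσ, treeInput, arr]
    refine Runs.seq (peel_runs (e := e) hT.isTree hE hN a40
      (fun k => by rw [aI 1 (by decide) (by decide)]; simp [hσ, treeInput])
      (fun k => by rw [aI 2 (by decide) (by decide)]; simp [hσ, treeInput])
      (fun k => by rw [aI 3 (by decide) (by decide)]; simp [hσ, treeInput])
      (fun k => by rw [aI 41 (by decide) (by decide)]; rfl)
      (fun k => by rw [aI 42 (by decide) (by decide)]; rfl)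
      (fun k => by rw [aI 43 (by decide) (by decide)]; rfl)
      (by rw [aI 50 (by decide) (by decide)]; rfl)) fun τ1 F1 e1 => ?_
    obtain ⟨pos, hL, hzero, hord⟩ := e1
    set par := τ1.ints 54 with hpar
    set wt := τ1.ints 55 with hwt
    have hP : IsParents N p par wt := by
      refine ⟨hzero, hL.par_lt, fun k h0 hk => ?_, fun k h0 hk => ?_⟩ <;>
      obtain ⟨ε, h1, h2⟩ := hL.exists_edge h0 hk <;> rw [h2]
      · exact hT.one_le ε h1
      · exact hT.le_bound ε h1
    refine Runs.pre 10 rfl (by decide) le_rfl ?_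
    set τ2 := (Prog.setI 75 0 0).run τ1 with hτ2
    have bI : ∀ A, A ≠ 75 → τ2.ints A = τ1.ints A := fun A h => by
      funext j; simp [hτ2, h]
    have bS : τ2.nums = σ.nums := by
      rw [← aS]
      funext A
      exact F1.nums A (by simp [peel, edgeSums, peelStep, pushLeaf, forUp, Prog.wS])
    have b40 : τ2.ints 40 0 = N := by rw [bI 40 (by decide), F1.ints 40 (by decide), a40]
    have b56 : τ2.ints 56 0 = q := by rw [bI 56 (by decide), F1.ints 56 (by decide), a56]
    have b53 : ∀ i, τ2.ints 53 (pos i) = i := fun i => by rw [bI 53 (by decide), hord]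
    set tgt : Fin N → Fin D → ℂ := fun i d =>
      (((fDistMatrix (quadExp u v w) G (ratWeight e q) * X) i d : ℝ) : ℂ) with htgt
    refine (Runs.forUp_const (n := D) ((N + 1) * 40 + (43000 * Z + ((N + 1) * 50 + 20)))
      (fun k τ => τ.ints 75 0 = k * N ∧ ∀ (i : Fin N) (d : Fin D), d.val < k →
        τ.nums 2 (d * N + i) = tgt i d) (by decide) ⟨by simp [hτ2], by simp⟩ ?_ ?_).mono
      (Nat.mul_le_mul_left _ (by
        have : (IExp.get 0 2).cost = 2 := rfl
        rw [this]; omega)) fun τ _ h i d => h.1.2 i d d.2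
    · intro τ hF
      rw [IExp.eval, IExp.eval_lit, hF.ints 0 (by decide), bI 0 (by decide), F1.ints 0 (by decide),
        aI 0 (by decide) (by decide)]
      simp [hσ, treeInput, arr]
    rintro k hk τ hF hvk ⟨h75, hprev⟩
    have c40 : τ.ints 40 0 = N := by rw [hF.ints 40 (by decide), b40]
    have c56 : τ.ints 56 0 = q := by rw [hF.ints 56 (by decide), b56]
    have c53 : ∀ i, τ.ints 53 (pos i) = i := fun i => by rw [hF.ints 53 (by decide), b53]
    have c54 : τ.ints 54 = par := by rw [hF.ints 54 (by decide), bI 54 (by decide)]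
    have c55 : τ.ints 55 = wt := by rw [hF.ints 55 (by decide), bI 55 (by decide)]
    have c0 : τ.nums 0 = arr ![(u : ℂ), (v : ℂ), (w : ℂ)] := by
      rw [hF.nums 0 (by decide), bS]; rfl
    have c1 : ∀ i : Fin N, τ.nums 1 (k * N + i) = X i ⟨k, hk⟩ := fun i => by
      rw [hF.nums 1 (by decide), bS]
      have hx : k * N + i = (finProdFinEquiv ((⟨k, hk⟩, i) : Fin D × Fin N) : ℕ) := by
        rw [finProdFinEquiv_apply_val, mul_comm]; exact add_comm _ _
      rw [hx]
      simp only [hσ, treeInput]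
      rw [arr_apply, Equiv.symm_apply_apply]
    refine Runs.seq (Runs.fillS_zero (n := N) 40 30 (fun y => τ.nums 1 (k * N + τ.ints 53 y))
      (by decide) rfl (by decide) (fun τ' hF' => by simp [hF'.ints 40 (by decide), c40])
      (fun y hy τ' hF' hv _ => by
        funext j
        simp [hv, hF'.ints 75 (by decide), hF'.ints 53 (by decide), hF'.nums 1 (by decide), h75]))
      fun τ3 F3 e3 => ?_
    refine Runs.seq (treeSum_runs (p := p) (q := q) (par := par) (wt := wt) (u := u) (v := v) (w := w)
      (X := fun y => τ.nums 1 (k * N + τ.ints 53 y)) hN hp hP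
      (by rw [F3.ints 40 (by decide), c40]) (fun y _ => by rw [F3.ints 54 (by decide), c54])
      (fun y _ => by rw [F3.ints 55 (by decide), c55]) (by rw [F3.ints 56 (by decide), c56])
      (by rw [F3.nums 0 (by decide), c0]; simp [arr])
      (by rw [F3.nums 0 (by decide), c0]; simp [arr])
      (by rw [F3.nums 0 (by decide), c0]; simp [arr]) e3) fun τ4 F4 e4 => ?_
    have hval : ∀ i, τ4.nums 31 (pos i) = tgt i ⟨k, hk⟩ := by
      intro i
      rw [e4 _ (hL.lt i), htgt]
      simp only [Matrix.mul_apply, Complex.ofReal_sum]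
      symm
      refine sum_bij (fun j _ => pos j) (fun j _ => mem_range.2 (hL.lt j)) (fun _ _ _ _ h => hL.inj h)
        (fun y hy => ?_) fun j _ => ?_
      · obtain ⟨j, hj⟩ := hL.exists_pos_eq (mem_range.1 hy)
        exact ⟨j, mem_univ _, hj⟩
      · rw [quadVal_eq, c53, c1, fDistMatrix, Matrix.of_apply, hL.wdist_eq]
        push_cast
        rfl
    have d40 : τ4.ints 40 0 = N := by rw [F4.ints 40 (by decide), F3.ints 40 (by decide), c40]
    have d53 : ∀ i, τ4.ints 53 (pos i) = i := fun i => by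
      rw [F4.ints 53 (by decide), F3.ints 53 (by decide), c53]
    have d75 : τ4.ints 75 0 = k * N := by rw [F4.ints 75 (by decide), F3.ints 75 (by decide), h75]
    have d2 : τ4.nums 2 = τ.nums 2 := by rw [F4.nums 2 (by decide), F3.nums 2 (by decide)]
    refine Runs.seq (mid := fun τ => ∀ (i : Fin N) (d : Fin D), d.val < k + 1 →
        τ.nums 2 (d * N + i) = tgt i d)
      ((Runs.forUp_const (n := N) 30 (fun y τ => ∀ (i : Fin N) (d : Fin D),
        (d.val < k ∨ (d.val = k ∧ pos i < y)) → τ.nums 2 (d * N + i) = tgt i d) (by decide)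
        ?_ ?_ ?_).mono (Nat.mul_le_mul_left _ (by decide)) fun τ _ h i d hd => h.1 i d ?_)
        fun τ5 F5 e5 => ?_
    · rintro i d (h | h)
      · simpa [d2] using hprev i d h
      · omega
    · intro τ' hF'
      simp [hF'.ints 40 (by decide), d40]
    · intro y hy τ' hF' hv hI
      obtain ⟨x, rfl⟩ := hL.exists_pos_eq hy
      have g53 : τ'.ints 53 (pos x) = x := by rw [hF'.ints 53 (by decide), d53]
      have g75 : τ'.ints 75 0 = k * N := by rw [hF'.ints 75 (by decide), d75]
      have g31 : τ'.nums 31 (pos x) = tgt x ⟨k, hk⟩ := by rw [hF'.nums 31 (by decide), hval]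
      refine Runs.flat rfl (by decide) fun i d hd => ?_
      simp only [Prog.run, Store.putI_nums, Store.putS_nums, IExp.eval, hv, g53, g75,
        SExp.eval, g31, true_and]
      by_cases hdk : d.val = k
      · obtain rfl : d = ⟨k, hk⟩ := Fin.ext hdk
        by_cases hix : i = x
        · subst hix
          rw [if_pos rfl]
        · rw [if_neg fun h => hix (Fin.ext (by simpa using h))]
          refine hI i _ (Or.inr ⟨rfl, ?_⟩)
          have : pos i ≠ pos x := fun h => hix (hL.inj h)
          omega
      · have hlt : d.val < k := by omega
        rw [if_neg, hI i d (Or.inl hlt)]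
        have h1 : (d.val + 1) * N ≤ k * N := Nat.mul_le_mul_right _ hlt
        have h2 := i.2
        rw [add_mul, one_mul] at h1
        omega
    · rcases Nat.lt_succ_iff_lt_or_eq.mp hd with h | h
      · exact Or.inl h
      · exact Or.inr ⟨h, hL.lt i⟩
    · refine Runs.flat rfl (by decide) ⟨?_, e5⟩
      simp [F5.ints 75 (by decide), F5.ints 40 (by decide), d75, d40, add_mul]
  · have h1 : 20 + ((N + 1) * 1000 + (10 +
        (D + 1) * (((N + 1) * 40 + (43000 * Z + ((N + 1) * 50 + 20))) + 20))) ≤ 90000 * (D * Z) := by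
      have h2 : D + 1 ≤ 2 * D := by omega
      have h3 : (N + 1) * 40 + (43000 * Z + ((N + 1) * 50 + 20)) + 20 ≤ 43220 * Z := by omega
      have h4 := Nat.mul_le_mul h2 h3
      have h5 : 2 * D * (43220 * Z) = 86440 * (D * Z) := by ring
      have h6 : Z ≤ D * Z := Nat.le_mul_of_pos_left _ hD
      omega
    have h2 := treeCost_le hN hp
    have h3 : ((20 + ((N + 1) * 1000 + (10 + (D + 1) * (((N + 1) * 40 + (43000 * Z +
      ((N + 1) * 50 + 20))) + 20))) : ℕ) : ℝ) ≤ 90000 * (D * Z) := by exact_mod_cast h1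
    refine h3.trans ?_
    have h4 := mul_le_mul_of_nonneg_left h2 (Nat.cast_nonneg (α := ℝ) D)
    have h5 : (0 : ℝ) ≤ (D : ℝ) * treeCost N p := by positivity
    calc (90000 : ℝ) * (D * Z) ≤ 90000 * (D * (33 * (((p * N : ℕ) : ℝ) *
          Real.log ((p * N + 1 : ℕ) : ℝ) ^ 2 * Real.log ((N + 1 : ℕ) : ℝ)))) :=
          mul_le_mul_of_nonneg_left h4 (by norm_num)
      _ ≤ _ := by linarith

end FTFI

theorem mainTheorem6 :
    -- the factorization and the padding of the columns
    (∀ (u v w : ℝ) (q a b : ℕ) (x : Fin a → ℝ) (y : Fin b → ℝ) (s : Fin b → ℕ),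
      0 < q → (∀ j, y j * (q : ℝ) = (s j : ℝ)) →
      FTFI.sumMatrix (FTFI.quadExp u v w) x y =
        Real.exp w •
          (Matrix.diagonal (fun i => Real.exp (u * x i ^ 2 + v * x i)) *
            FTFI.genVandermonde (fun i => Real.exp (2 * u * x i / (q : ℝ))) s *
            Matrix.diagonal (fun j => Real.exp (u * y j ^ 2 + v * y j))) ∧
      ∀ (K : ℕ) (hK : ∀ j, s j < K),
        FTFI.genVandermonde (fun i => Real.exp (2 * u * x i / (q : ℝ))) s =
          (FTFI.ordVandermonde (fun i => Real.exp (2 * u * x i / (q : ℝ))) K).submatrix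
            id (fun j => (⟨s j, hK j⟩ : Fin K)) ∧
        ∀ z : Fin b → ℝ,
          (FTFI.genVandermonde (fun i => Real.exp (2 * u * x i / (q : ℝ))) s).mulVec z =
            (FTFI.ordVandermonde (fun i => Real.exp (2 * u * x i / (q : ℝ))) K).mulVec
              (FTFI.padVector s z K)) ∧
    -- for distances in a tree, padding multiplies the number of columns by at most `p`
    (∀ (N p q : ℕ) (G : SimpleGraph (Fin N)) (e : Sym2 (Fin N) → ℕ),
      0 < p → 0 < q → FTFI.IsWeightedTree G e p →
      ∀ o : Fin N, ∃ s : Fin N → ℕ,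
        (∀ i, FTFI.wdist G (FTFI.ratWeight e q) o i * (q : ℝ) = (s i : ℝ)) ∧
        ∀ i, s i < p * (Finset.univ.image s).card) ∧
    -- multiplication by an ordinary Vandermonde matrix
    (∃ (P : FTFI.Prog) (C : ℝ), ∀ (a K : ℕ) (r : Fin a → ℝ) (c : Fin K → ℝ),
      0 < a → 0 < K →
      FTFI.RunsWithin P (FTFI.vandInput r c)
        (C * (((a + K : ℕ) : ℝ) * Real.log ((a + K : ℕ) : ℝ) ^ 2))
        (fun τ => ∀ i : Fin a,
          τ.nums 2 i = (((FTFI.ordVandermonde r K).mulVec c i : ℝ) : ℂ))) ∧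
    -- multiplication by the matrix `[f (x i + y j)]`, where `y j = s j / q`
    (∃ (P : FTFI.Prog) (C : ℝ), ∀ (u v w : ℝ) (q a b K : ℕ) (x : Fin a → ℝ)
        (y : Fin b → ℝ) (s : Fin b → ℕ) (z : Fin b → ℝ),
      0 < q → 0 < a → 0 < b → (∀ j, y j * (q : ℝ) = (s j : ℝ)) → (∀ j, s j < K) →
      FTFI.RunsWithin P (FTFI.sumMatrixInput u v w q x s z)
        (C * (((a + b + K : ℕ) : ℝ) * Real.log ((a + b + K : ℕ) : ℝ) ^ 2))
        (fun τ => ∀ i : Fin a,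
          τ.nums 3 i =
            (((FTFI.sumMatrix (FTFI.quadExp u v w) x y).mulVec z i : ℝ) : ℂ))) ∧
    -- exact integration on trees
    (∃ (P : FTFI.Prog) (C : ℝ), ∀ (u v w : ℝ) (N p q D : ℕ) (G : SimpleGraph (Fin N))
        (e : Sym2 (Fin N) → ℕ) (E : Fin (N - 1) → Fin N × Fin N)
        (X : Matrix (Fin N) (Fin D) ℝ),
      0 < p → 0 < q → 0 < D → FTFI.IsWeightedTree G e p → FTFI.IsEdgeList G E →
      FTFI.RunsWithin P (FTFI.treeInput u v w q E e X)
        (C * ((D : ℝ) * ((p * N : ℕ) : ℝ) * Real.log ((p * N + 1 : ℕ) : ℝ) ^ 2 *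
          Real.log ((N + 1 : ℕ) : ℝ)))
        (fun τ => ∀ (i : Fin N) (d : Fin D),
          τ.nums 2 ((d : ℕ) * N + i) =
            (((FTFI.fDistMatrix (FTFI.quadExp u v w) G (FTFI.ratWeight e q) * X) i d : ℝ)
              : ℂ))) := by
  refine ⟨?_, ?_, ⟨FTFI.vandProg, 5000000, fun a K r c ha hK => FTFI.vandProg_runs r c ha hK⟩,
    ⟨FTFI.sumProg, 10000000, fun u v w q a b K x y s z hq ha hb hy hs =>
      FTFI.sumProg_runs u v w x y s z hq ha hb hy hs⟩,
    ⟨FTFI.treeProg, 3000000, fun u v w N p q D G e E X hp _ hD hT hE =>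
      FTFI.treeProg_runs u v w X hp hD hT hE⟩⟩
  · intro u v w q a b x y s hq hs
    exact ⟨FTFI.sumMatrix_quadExp u v w x y s hq hs, fun K hK =>
      ⟨rfl, fun z => FTFI.genVandermonde_mulVec _ s hK z⟩⟩
  · intro N p q G e hp hq hT o
    obtain ⟨pos, par, wt, h⟩ := FTFI.exists_layout hT.isTree e (Fin.pos o)
    exact h.exists_dist hp hq hT o
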